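/- **Setting.** Let $x^\mu$, $\mu=0,\dots,n-1$, be spacetime coordinates and $\Psi^A$ fields of Grassmann parity $|A|$, with jet coordinates $\Psi^A_{(\lambda)}$, $(\lambda)$ a symmetric multi-index. Local functions depend smoothly on finitely many of the even coordinates and polynomially on the odd ones; $\partial_\mu=\frac{\partial}{\partial x^\mu}+\frac{\partial^F}{\partial x^\mu}$ is the total derivative. Let $s$ be a BRST differential: the odd, nilpotent vector field of ghost number one with $s x^\mu=0$, $s\Psi^A=S^A[x,\Psi]$, $[s,\partial_\mu]=0$. With Grassmann odd variables $\theta^\mu$ (and $s\theta^\mu=0$), the extended differential is $\tilde s=\theta^\mu\partial_\mu+s$, acting on local functions of $x,\theta,\Psi$. *Parent theory.* Its fields are $\Psi^A_{(\lambda)[\nu]}$ ($[\nu]=\nu_1\dots\nu_k$ skew-symmetric, parity $|A|+k$), with jet coordinates $\Psi^A_{(\mu)(\lambda)[\nu]}$. On these, $\frac{\partial^F}{\partial x^\kappa}$ and $\frac{\partial^F}{\partial y^\kappa}$ add an index $\kappa$ to $(\mu)$, respectively $(\lambda)$; $\frac{\partial^F}{\partial\theta^\nu}\Psi^A_{\nu_1\dots\nu_k}=(-1)^{|A|}\Psi^A_{\nu\nu_1\dots\nu_k}$;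 and $$d^F\Psi^A_{(\mu)(\lambda)\nu_1\dots\nu_k}=(-1)^{|A|}\sum_i(-1)^{i-1}\Psi^A_{(\mu\nu_i)(\lambda)\nu_1\dots\widehat{\nu_i}\dots\nu_k},\qquad \sigma^F\Psi^A_{(\mu)(\lambda)\nu_1\dots\nu_k}=(-1)^{|A|}\sum_i(-1)^{i-1}\Psi^A_{(\mu)(\lambda\nu_i)\nu_1\dots\widehat{\nu_i}\dots\nu_k}.$$ A bar denotes the replacement of $x$-derivatives $\Psi^A_{(\lambda)}$ by $y$-derivatives $\Psi^A_{()(\lambda)[]}$. The vector field $\bar s$ is the extension of $\bar s\Psi^A=\bar S^A$ (with $\bar s x^\mu=0=\bar s\theta^\mu$) that commutes, in the graded sense, with $\partial_\mu$, $\frac{\partial^F}{\partial\theta^\nu}$ and $\frac{\partial}{\partial x^\lambda}+\frac{\partial^F}{\partial y^\lambda}$. The parent differential is $s^P=d^F-\sigma^F+\bar s$. The parent differential $(\tilde s)^P$ of $\tilde s$ is the prolongation, by means of $\partial_\mu$ and of the total $\theta$-derivatives $\partial^\theta_\nu=\frac{\partial}{\partial\theta^\nu}+\frac{\partial^F}{\partial\theta^\nu}$,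 of the vector field $x^\mu\mapsto\theta^\mu$, $\theta^\mu\mapsto0$, $\Psi^A_{()(\lambda)[]}\mapsto\overline{\tilde s\Psi^A_{(\lambda)}}$; that is, it is $\theta^\mu\partial_\mu$ plus the vector field with no $x$- and $\theta$-components that commutes with $\partial_\mu$ and $\partial^\theta_\nu$ and sends $\Psi^A_{()(\lambda)[]}$ to $\overline{\tilde s\Psi^A_{(\lambda)}}-\theta^\mu\partial_\mu\Psi^A_{()(\lambda)[]}$. *Trivial pairs.* Trivial pairs $(w^a,v^a)$ of $\tilde s$ are local functions of $x,\theta,\Psi$ with $\tilde sw^a=v^a$ that are part of a coordinate system: for some local functions $\varphi^i$, the passage from $x,\theta,\Psi^A_{(\lambda)}$ to $x,\theta,\varphi^i,w^a,v^a$ is an invertible parity-preserving change of coordinates (not required to respect $\partial_\mu$). *Generalized auxiliary fields.* In a theory with fields $z^\alpha$ and BRST differential $s$, local functions $w^a,v^a$ are generalized auxiliary fields, with complementary fields $\varphi^i$, if there is an invertible change of fields (possibly involving derivatives) from $z^\alpha$ to $\varphi^i,w^a,v^a$ and the equations $sw^a|_{w=0}=0$, read algebraically in the space of fields and their derivatives,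 are equivalent to $v^a=V^a[\varphi]$ for some local functions $V^a$. Here equivalence means that $w=0,\ sw=0$ and $w=0,\ v-V=0$, each with all total derivatives, generate the same ideal. **Proposition.** (i) On local functions of the extended parent theory, $$(\tilde s)^P=\theta^\mu\Big(\frac{\partial}{\partial x^\mu}+\frac{\partial^F}{\partial y^\mu}\Big)+d^F-\sigma^F+\bar s .$$ (ii) $s^P=(\tilde s)^P|_{\theta=0}$, that is, $\big((\tilde s)^Pf\big)\big|_{\theta=0}=s^P\big(f|_{\theta=0}\big)$ for every local function $f$ of $x,\theta,\Psi^A_{(\mu)(\lambda)[\nu]}$. (iii) If $(w^a,v^a)$ are trivial pairs of $\tilde s$ with complementary coordinates $\varphi^i$, then all their total-$\theta$-derivative descendants at $\theta=0$, $$w^a_{\nu_1\dots\nu_k}=\big(\partial^\theta_{\nu_1}\cdots\partial^\theta_{\nu_k}\bar w^a\big)\big|_{\theta=0},\qquad v^a_{\nu_1\dots\nu_k}=(-1)^k\big(\partial^\theta_{\nu_1}\cdots\partial^\theta_{\nu_k}\bar v^a\big)\big|_{\theta=0}\qquad(\nu_1<\dots<\nu_k,\ 0\le k\le n),$$ are generalized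 auxiliary fields of the parent theory determined by $s^P$, with complementary fields $\varphi^i_{\nu_1\dots\nu_k}=(\partial^\theta_{\nu_1}\cdots\partial^\theta_{\nu_k}\bar\varphi^i)|_{\theta=0}$. -/

import Mathlib

open scoped ContDiff TensorProduct

universe u v w

noncomputable section

/-! ### Superfunctions

Coordinates are labelled by a type `I` with a parity `p : I → ZMod 2`. A superfunction is a smooth
function of finitely many even coordinates with values in the Grassmann algebra of the odd ones. -/

/-- The labels of the even coordinates. -/
abbrev EvenIdx {I : Type u} (p : I → ZMod 2) : Type u := {i : I // p i = 0}

/-- The labels of the odd coordinates. -/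
abbrev OddIdx {I : Type u} (p : I → ZMod 2) : Type u := {i : I // p i ≠ 0}

/-- `f` depends smoothly on finitely many of the real coordinates labelled by `E`. -/
def IsCyl {E : Type u} (f : (E → ℝ) → ℝ) : Prop :=
  ∃ (F : Finset E) (g : (F → ℝ) → ℝ), ContDiff ℝ ∞ g ∧ ∀ q, f q = g (fun i => q i)

theorem IsCyl.coord {E : Type u} (e : E) : IsCyl (fun q : E → ℝ => q e) :=
  ⟨{e}, fun r => r ⟨e, Finset.mem_singleton_self e⟩, contDiff_apply ℝ ℝ _, fun _ => rfl⟩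

theorem IsCyl.comp {E : Type u} {κ : Type v} [Fintype κ] {g : (κ → ℝ) → ℝ}
    (hg : ContDiff ℝ ∞ g) {β : κ → (E → ℝ) → ℝ} (hβ : ∀ k, IsCyl (β k)) :
    IsCyl (fun q => g (fun k => β k q)) := by
  classical
  choose F h hh hF using hβ
  have hsub : ∀ k, ∀ i ∈ F k, i ∈ Finset.univ.biUnion F := fun k i hi =>
    Finset.mem_biUnion.2 ⟨k, Finset.mem_univ k, hi⟩
  refine ⟨Finset.univ.biUnion F,
    fun r => g (fun k => h k (fun i : F k => r ⟨i, hsub k i i.2⟩)), ?_, ?_⟩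
  · refine hg.comp (contDiff_pi.2 fun k => (hh k).comp (contDiff_pi.2 fun i => ?_))
    exact contDiff_apply ℝ ℝ _
  · intro q
    simp only [hF]

theorem IsCyl.const {E : Type u} (c : ℝ) : IsCyl (fun _ : E → ℝ => c) :=
  ⟨∅, fun _ => c, contDiff_const, fun _ => rfl⟩

/-- The commutative algebra of smooth functions of finitely many of the coordinates `E`. -/
def Cyl (E : Type u) : Subalgebra ℝ ((E → ℝ) → ℝ) where
  carrier := {f | IsCyl f}
  mul_mem' {a b} ha hb :=
    IsCyl.comp (κ := Bool) (g := fun r => r true * r false)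
      ((contDiff_apply ℝ ℝ _).mul (contDiff_apply ℝ ℝ _)) (β := fun k => cond k a b)
      (by rintro (_ | _) <;> assumption)
  add_mem' {a b} ha hb :=
    IsCyl.comp (κ := Bool) (g := fun r => r true + r false)
      ((contDiff_apply ℝ ℝ _).add (contDiff_apply ℝ ℝ _)) (β := fun k => cond k a b)
      (by rintro (_ | _) <;> assumption)
  algebraMap_mem' c := IsCyl.const c

/-- The derivative along the coordinate `e` of a smooth function of finitely many coordinates. -/
theorem lineDeriv_cyl {E : Type u} [DecidableEq E] (e : E) {F : Finset E} {f : (E → ℝ) → ℝ}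
    {g : (F → ℝ) → ℝ} (hg : ContDiff ℝ ∞ g) (hf : ∀ q, f q = g (fun i => q i)) (q : E → ℝ) :
    HasLineDerivAt ℝ f (fderiv ℝ g (fun i => q i) (fun i => (Pi.single e 1 : E → ℝ) i))
      q (Pi.single e 1) := by
  have h1 : HasFDerivAt g (fderiv ℝ g (fun i : F => q i)) (fun i : F => q i) :=
    ((hg.differentiable (by simp)) _).hasFDerivAt
  have h2 := h1.hasLineDerivAt (fun i : F => (Pi.single e 1 : E → ℝ) i)
  unfold HasLineDerivAt at h2 ⊢
  have h3 : (fun t : ℝ => f (q + t • (Pi.single e 1 : E → ℝ))) =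
      fun t : ℝ => g ((fun i : F => q i) + t • (fun i : F => (Pi.single e 1 : E → ℝ) i)) := by
    funext t
    rw [hf]
    rfl
  rw [h3]
  exact h2

open Classical in
/-- The partial derivative of a smooth function along the coordinate `e`. -/
def Cyl.pderiv {E : Type u} (e : E) : Cyl E →ₗ[ℝ] Cyl E where
  toFun f := ⟨fun q => lineDeriv ℝ (f : (E → ℝ) → ℝ) q (Pi.single e 1), by
    obtain ⟨f, F, g, hg, hf⟩ := f
    refine ⟨F, fun r => fderiv ℝ g r (fun i => (Pi.single e 1 : E → ℝ) i), ?_, ?_⟩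
    · exact (hg.fderiv_right (m := ∞) (by simp)).clm_apply contDiff_const
    · intro q
      exact (lineDeriv_cyl e hg hf q).lineDeriv⟩
  map_add' f g := by
    obtain ⟨f, F, f', hf', hf⟩ := f
    obtain ⟨g, G, g', hg', hg⟩ := g
    apply Subtype.ext
    funext q
    have h1 := lineDeriv_cyl e hf' hf q
    have h2 := lineDeriv_cyl e hg' hg q
    have h3 := HasDerivAt.add h1 h2
    change lineDeriv ℝ (f + g) q _ = lineDeriv ℝ f q _ + lineDeriv ℝ g q _
    rw [h1.lineDeriv, h2.lineDeriv]
    exact h3.deriv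
  map_smul' c f := by
    obtain ⟨f, F, f', hf', hf⟩ := f
    apply Subtype.ext
    funext q
    have h1 := lineDeriv_cyl e hf' hf q
    have h3 := HasDerivAt.const_mul c h1
    change lineDeriv ℝ (c • f) q _ = c * lineDeriv ℝ f q _
    rw [h1.lineDeriv]
    exact h3.deriv

/-- The Grassmann algebra of the odd coordinates. -/
abbrev Grassmann (O : Type u) : Type u := ExteriorAlgebra ℝ (O →₀ ℝ)

/-- The supercommutative algebra of superfunctions of the coordinates `I` with parity `p`. -/
abbrev SFun {I : Type u} (p : I → ZMod 2) : Type u :=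
  Cyl (EvenIdx p) ⊗[ℝ] Grassmann (OddIdx p)

/-- The coordinate `i` as a superfunction. -/
def coord {I : Type u} (p : I → ZMod 2) (i : I) : SFun p :=
  if h : p i = 0 then (⟨fun q => q ⟨i, h⟩, IsCyl.coord _⟩ : Cyl (EvenIdx p)) ⊗ₜ[ℝ] 1
  else 1 ⊗ₜ[ℝ] ExteriorAlgebra.ι ℝ (Finsupp.single (⟨i, h⟩ : OddIdx p) 1)

/-- The (left) partial derivative along the coordinate `i`. -/
def pderiv {I : Type u} (p : I → ZMod 2) (i : I) : SFun p →ₗ[ℝ] SFun p :=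
  if h : p i = 0 then LinearMap.rTensor _ (Cyl.pderiv (⟨i, h⟩ : EvenIdx p))
  else LinearMap.lTensor _
    (CliffordAlgebra.contractLeft (Q := (0 : QuadraticForm ℝ (OddIdx p →₀ ℝ)))
      (Finsupp.lapply (⟨i, h⟩ : OddIdx p)))

/-- The parity automorphism: identity on even elements, minus the identity on odd ones. -/
def parityAut {I : Type u} (p : I → ZMod 2) : SFun p →ₐ[ℝ] SFun p :=
  Algebra.TensorProduct.map (AlgHom.id ℝ _)
    (CliffordAlgebra.involute (Q := (0 : QuadraticForm ℝ (OddIdx p →₀ ℝ))))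

/-- The sign `(-1)^a`. -/
def sgn (a : ZMod 2) : ℝ := if a = 0 then 1 else -1

/-- `f` is homogeneous of parity `a`. -/
def HasParity {I : Type u} (p : I → ZMod 2) (a : ZMod 2) (f : SFun p) : Prop :=
  parityAut p f = sgn a • f

/-- The vector field `∑ i, c i ∂/∂z i` with components `c` (only finitely many terms are nonzero
on a given superfunction). -/
def vfield {I : Type u} (p : I → ZMod 2) (c : I → SFun p) (f : SFun p) : SFun p :=
  ∑ᶠ i, c i * pderiv p i f

/-- `f` has ghost number `g`, when the coordinate `i` has ghost number `gh i`. -/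
def HasGhost {I : Type u} (p : I → ZMod 2) (gh : I → ℤ) (g : ℤ) (f : SFun p) : Prop :=
  vfield p (fun i => (gh i : ℝ) • coord p i) f = (g : ℝ) • f

/-- The point of `ℝ^J` whose coordinate `j` is the coordinate `m j` of `q`, or `0` if `m j` is
`none`. -/
def pullPoint {I : Type u} {J : Type v} {p : I → ZMod 2} {r : J → ZMod 2} (m : J → Option I)
    (hm : ∀ j i, m j = some i → p i = r j) (q : EvenIdx p → ℝ) (j : EvenIdx r) : ℝ :=
  match h : m j.1 with
  | none => 0
  | some i => q ⟨i, (hm _ _ h).trans j.2⟩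

/-- The odd coordinate `m j`, or `0` if `m j` is `none`. -/
def pullOdd {I : Type u} {J : Type v} {p : I → ZMod 2} {r : J → ZMod 2} (m : J → Option I)
    (hm : ∀ j i, m j = some i → p i = r j) (j : OddIdx r) : OddIdx p →₀ ℝ :=
  match h : m j.1 with
  | none => 0
  | some i => Finsupp.single ⟨i, fun h0 => j.2 ((hm _ _ h).symm.trans h0)⟩ 1

theorem IsCyl.pullPoint {I : Type u} {J : Type v} {p : I → ZMod 2} {r : J → ZMod 2}
    (m : J → Option I) (hm : ∀ j i, m j = some i → p i = r j) {f : (EvenIdx r → ℝ) → ℝ}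
    (hf : IsCyl f) : IsCyl (fun q => f (pullPoint (p := p) m hm q)) := by
  obtain ⟨F, g, hg, hF⟩ := hf
  simp only [hF]
  refine IsCyl.comp (κ := F) hg (β := fun k q => _root_.pullPoint m hm q k) ?_
  intro k
  unfold _root_.pullPoint
  split
  · exact IsCyl.const 0
  · exact IsCyl.coord _

/-- The substitution replacing the coordinate `j` by the coordinate `m j`, or by `0` if `m j` is
`none`. -/
def substCoord {I : Type u} {J : Type v} {p : I → ZMod 2} {r : J → ZMod 2} (m : J → Option I)
    (hm : ∀ j i, m j = some i → p i = r j) : SFun r →ₐ[ℝ] SFun p :=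
  Algebra.TensorProduct.map
    { toFun := fun f => ⟨fun q => (f : (EvenIdx r → ℝ) → ℝ) (pullPoint m hm q),
        IsCyl.pullPoint m hm f.2⟩
      map_one' := rfl
      map_mul' := fun _ _ => rfl
      map_zero' := rfl
      map_add' := fun _ _ => rfl
      commutes' := fun _ => rfl }
    (ExteriorAlgebra.map (Finsupp.linearCombination ℝ (pullOdd m hm)))

/-! ### Coordinates of field theories

Spacetime has dimension `n`. Symmetric multi-indices are functions `Fin n → ℕ`, skew-symmetric ones
are represented by the increasing ones, i.e. by finite sets `N : Finset (Fin n)`. -/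

/-- Coordinates `x^μ`, `θ^t` and `z`. The type `T` is `Fin n` if the Grassmann odd coordinates
`θ^μ` are present and `Empty` if they are not. -/
inductive Coord (T : Type) (n : ℕ) (Z : Type u) : Type u
  | x (μ : Fin n) : Coord T n Z
  | theta (t : T) : Coord T n Z
  | z (a : Z) : Coord T n Z

/-- The parity of the coordinates, given the parity of the `z`. -/
def Coord.parity (T : Type) (n : ℕ) {Z : Type u} (p : Z → ZMod 2) : Coord T n Z → ZMod 2
  | .x _ => 0
  | .theta _ => 1
  | .z a => p a

/-- The jet coordinates of the fields `F`: a field with a symmetric multi-index of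
derivatives. -/
abbrev Jet (n : ℕ) (F : Type u) : Type u := F × (Fin n → ℕ)

/-- The parity of the jet coordinates is that of the field. -/
def Jet.parity (n : ℕ) {F : Type u} (p : F → ZMod 2) : Jet n F → ZMod 2 := fun a => p a.1

/-- The `θ`-descendants `z_{[ν]}`: a variable with a skew-symmetric multi-index. -/
abbrev Desc (n : ℕ) (Z : Type u) : Type u := Z × Finset (Fin n)

/-- Each skew-symmetric index changes the parity. -/
def Desc.parity (n : ℕ) {Z : Type u} (p : Z → ZMod 2) : Desc n Z → ZMod 2 :=
  fun a => p a.1 + (a.2.card : ZMod 2)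

/-- Superfunctions of `x`, `θ` and `z`. -/
abbrev ZFun (T : Type) (n : ℕ) {Z : Type u} (p : Z → ZMod 2) : Type u :=
  SFun (Coord.parity T n p)

/-- Local functions for the fields `F` (depending explicitly on `θ` if `T` is `Fin n`). -/
abbrev LocalFun (T : Type) (n : ℕ) {F : Type u} (p : F → ZMod 2) : Type u :=
  ZFun T n (Jet.parity n p)

/-- The coordinate `x^μ`. -/
def cx (T : Type) {n : ℕ} {Z : Type u} (p : Z → ZMod 2) (μ : Fin n) : ZFun T n p :=
  coord _ (.x μ)

/-- The coordinate `θ^t`. -/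
def cθ {T : Type} (n : ℕ) {Z : Type u} (p : Z → ZMod 2) (t : T) : ZFun T n p :=
  coord _ (.theta t)

/-- The coordinate `z`. -/
def cz (T : Type) (n : ℕ) {Z : Type u} (p : Z → ZMod 2) (a : Z) : ZFun T n p :=
  coord _ (.z a)

/-- The vector field on superfunctions of `x, θ, z` with the given components along `z` and with
no components along `x` and `θ`. -/
def vert {T : Type} {n : ℕ} {Z : Type u} (p : Z → ZMod 2) (c : Z → ZFun T n p) :
    ZFun T n p → ZFun T n p :=
  vfield _ fun i => match i with
    | .x _ => 0
    | .theta _ => 0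
    | .z a => c a

/-- The explicit derivative `∂/∂x^μ`. -/
def dx {T : Type} {n : ℕ} {Z : Type u} (p : Z → ZMod 2) (μ : Fin n) (f : ZFun T n p) :
    ZFun T n p :=
  pderiv _ (.x μ) f

/-- The explicit derivative `∂/∂θ^ν`. -/
def dθ {n : ℕ} {Z : Type u} (p : Z → ZMod 2) (ν : Fin n) (f : ZFun (Fin n) n p) :
    ZFun (Fin n) n p :=
  pderiv _ (.theta ν) f

/-- Setting `θ = 0`. -/
def thetaZero {n : ℕ} {Z : Type u} (p : Z → ZMod 2) : ZFun (Fin n) n p →ₐ[ℝ] ZFun Empty n p :=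
  substCoord
    (fun i => match i with
      | .x μ => some (.x μ)
      | .theta _ => none
      | .z a => some (.z a))
    (by rintro (_ | _ | _) i h <;> simp at h <;> subst h <;> rfl)

/-- Replacing the variable `a` by the variable `g a`, with `x` and `θ` unchanged. -/
def renameZ (T : Type) (n : ℕ) {Z : Type u} {Z' : Type v} {p : Z → ZMod 2} {p' : Z' → ZMod 2}
    (g : Z → Z') (hg : ∀ a, p' (g a) = p a) : ZFun T n p →ₐ[ℝ] ZFun T n p' :=
  substCoord
    (fun i => match i with
      | .x μ => some (.x μ)
      | .theta t => some (.theta t)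
      | .z a => some (.z (g a)))
    (by rintro (_ | _ | _) i h <;> simp at h <;> subst h <;> first | rfl | exact hg _)

/-- A `θ`-independent function, seen as a function of all the coordinates. -/
def inclTheta (T : Type) (n : ℕ) {Z : Type u} (p : Z → ZMod 2) : ZFun Empty n p →ₐ[ℝ] ZFun T n p :=
  substCoord
    (fun i => match i with
      | .x μ => some (.x μ)
      | .theta t => t.elim
      | .z a => some (.z a))
    (by rintro (_ | t | _) i h
        · simp at h; subst h; rfl
        · exact t.elim
        · simp at h; subst h; rfl)

/-- `D_(m)`, the operators `D μ` applied `m μ` times each. -/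
def iterSym {n : ℕ} {X : Type u} (D : Fin n → X → X) (m : Fin n → ℕ) (f : X) : X :=
  (List.finRange n).foldr (fun μ g => (D μ)^[m μ] g) f

/-- `D_{ν₁} … D_{ν_k} f`, where `ν₁ < … < ν_k` are the elements of `N`. -/
def iterSkew {n : ℕ} {X : Type u} (D : Fin n → X → X) (N : Finset (Fin n)) (f : X) : X :=
  (N.sort (· ≤ ·)).foldr D f

/-- The part `∂^F/∂x^μ` of the total derivative, acting on the jet coordinates only. -/
def dFx {T : Type} {n : ℕ} {F : Type u} (p : F → ZMod 2) (μ : Fin n) :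
    LocalFun T n p → LocalFun T n p :=
  vert _ fun a => cz T n _ (a.1, a.2 + Pi.single μ 1)

/-- The total derivative `∂_μ = ∂/∂x^μ + ∂^F/∂x^μ`. -/
def totalD {T : Type} {n : ℕ} {F : Type u} (p : F → ZMod 2) (μ : Fin n) (f : LocalFun T n p) :
    LocalFun T n p :=
  dx _ μ f + dFx p μ f

/-! ### The original theory -/

/-- The vector field `s` with `s x = 0`, `s θ = 0`, `s Ψ^A = S^A` and `[s, ∂_μ] = 0`. -/
def evolS (T : Type) {n : ℕ} {ι : Type u} (p : ι → ZMod 2) (S : ι → LocalFun Empty n p) :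
    LocalFun T n p → LocalFun T n p :=
  vert _ fun a => iterSym (totalD p) a.2 (inclTheta T n _ (S a.1))

/-- A gauge theory with fields `Ψ^A`, `A : ι`, on an `n`-dimensional spacetime, given by its BRST
differential `s Ψ^A = S^A[x, Ψ]`, which is odd, of ghost number one and nilpotent. -/
structure BRSTTheory (n : ℕ) (ι : Type u) where
  /-- The Grassmann parity of the fields. -/
  parity : ι → ZMod 2
  /-- The ghost number of the fields. -/
  ghost : ι → ℤ
  /-- The local functions `S^A`. -/
  S : ι → LocalFun Empty n parity
  S_parity : ∀ A, HasParity _ (parity A + 1) (S A)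
  S_ghost : ∀ A, HasGhost (Coord.parity Empty n (Jet.parity n parity))
    (fun i => match i with
      | .x _ => 0
      | .theta t => t.elim
      | .z a => ghost a.1) (ghost A + 1) (S A)
  nilpotent : ∀ f, evolS Empty parity S (evolS Empty parity S f) = 0

namespace BRSTTheory

variable {n : ℕ} {ι : Type u} (𝒯 : BRSTTheory n ι)

/-- The extended differential `s̃ = θ^μ ∂_μ + s` on local functions of `x, θ, Ψ`. -/
def sTilde (f : LocalFun (Fin n) n 𝒯.parity) : LocalFun (Fin n) n 𝒯.parity :=
  ∑ μ, cθ n _ μ * totalD 𝒯.parity μ f + evolS (Fin n) 𝒯.parity 𝒯.S f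

/-! ### The parent theory

Its fields are the `Ψ^A_{(λ)[ν]}`, labelled by `((A, λ), N)`, and its jet coordinates the
`Ψ^A_{(μ)(λ)[ν]}`, labelled by `(((A, λ), N), m)`. -/

/-- The parity of the parent fields. -/
def pParity : Desc n (Jet n ι) → ZMod 2 := Desc.parity n (Jet.parity n 𝒯.parity)

/-- Local functions of the parent theory (depending explicitly on `θ` if `T` is `Fin n`). -/
abbrev ParentFun (T : Type) : Type u := LocalFun T n 𝒯.pParity

/-- The coordinate `Ψ^A_{(m)(l)[N]}`. -/
def psi (T : Type) (A : ι) (m l : Fin n → ℕ) (N : Finset (Fin n)) : 𝒯.ParentFun T :=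
  cz T n _ (((A, l), N), m)

/-- The sign `(-1)^{#{j ∈ N | j < ν}}` of the permutation moving `ν` from the front to its place
in the increasing sequence `N ∪ {ν}`. -/
def moveSign {n : ℕ} (ν : Fin n) (N : Finset (Fin n)) : ℝ := (-1) ^ (N.filter (· < ν)).card

/-- `∂^F/∂y^κ`, the action on the fields of the `y`-derivative of the superfield. -/
def dFy {T : Type} (κ : Fin n) : 𝒯.ParentFun T → 𝒯.ParentFun T :=
  vert _ fun a => match a with
    | (((A, l), N), m) => 𝒯.psi T A m (l + Pi.single κ 1) N

/-- `∂^F/∂θ^ν`: it sends `Ψ^A_{ν₁…ν_k}` to `(-1)^A Ψ^A_{ν ν₁…ν_k}`, i.e. it is the action on the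
fields of the right derivative `∂/∂θ^ν` of the superfield
`∑ (1/k!) Ψ^A_{ν₁…ν_k} θ^{ν_k} … θ^{ν₁}`. -/
def dFθ {T : Type} (ν : Fin n) : 𝒯.ParentFun T → 𝒯.ParentFun T :=
  vert _ fun a => match a with
    | (((A, l), N), m) =>
      if ν ∈ N then 0 else (sgn (𝒯.parity A) * moveSign ν N) • 𝒯.psi T A m l (insert ν N)

/-- `d^F Ψ^A_{(μ)(λ)ν₁…ν_k} = (-1)^A ∑_i (-1)^{i-1} Ψ^A_{(μ ν_i)(λ) ν₁…ν̂_i…ν_k}`. -/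
def dF {T : Type} : 𝒯.ParentFun T → 𝒯.ParentFun T :=
  vert _ fun a => match a with
    | (((A, l), N), m) =>
      ∑ ν ∈ N, (sgn (𝒯.parity A) * moveSign ν N) • 𝒯.psi T A (m + Pi.single ν 1) l (N.erase ν)

/-- `σ^F Ψ^A_{(μ)(λ)ν₁…ν_k} = (-1)^A ∑_i (-1)^{i-1} Ψ^A_{(μ)(λ ν_i) ν₁…ν̂_i…ν_k}`. -/
def sigmaF {T : Type} : 𝒯.ParentFun T → 𝒯.ParentFun T :=
  vert _ fun a => match a with
    | (((A, l), N), m) =>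
      ∑ ν ∈ N, (sgn (𝒯.parity A) * moveSign ν N) • 𝒯.psi T A m (l + Pi.single ν 1) (N.erase ν)

/-- The total `θ`-derivative `∂^θ_ν = ∂/∂θ^ν + ∂^F/∂θ^ν`. -/
def totalθ (ν : Fin n) (f : 𝒯.ParentFun (Fin n)) : 𝒯.ParentFun (Fin n) :=
  dθ _ ν f + 𝒯.dFθ ν f

/-- Replacing the `x`-derivatives of the fields by their `y`-derivatives. -/
def bar (T : Type) : LocalFun T n 𝒯.parity →ₐ[ℝ] 𝒯.ParentFun T :=
  renameZ T n (fun a => ((a, ∅), 0)) (fun a => by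
    simp [Jet.parity, pParity, Desc.parity])

/-- The prolongation of an odd characteristic `Q`, i.e. the odd vector field `V` with `V x = 0`,
`V θ = 0`, `V Ψ^A_{()(λ)[]} = Q^A_{(λ)}` that commutes with `∂_μ` and (in the graded sense) with
the `θ`-derivatives `Dθ ν`. As `Dθ_{ν₁} … Dθ_{ν_k} Ψ^A = (-1)^{k A} Ψ^A_{ν₁…ν_k}`, this forces
`V Ψ^A_{(μ)(λ)ν₁…ν_k} = (-1)^{k (A + 1)} Dθ_{ν₁} … Dθ_{ν_k} ∂_(μ) Q^A_{(λ)}`. -/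
def prolong {T : Type} (Dθ : Fin n → 𝒯.ParentFun T → 𝒯.ParentFun T)
    (Q : ι → (Fin n → ℕ) → 𝒯.ParentFun T) : 𝒯.ParentFun T → 𝒯.ParentFun T :=
  vert _ fun a => match a with
    | (((A, l), N), m) =>
      sgn ((N.card : ZMod 2) * (𝒯.parity A + 1)) •
        iterSkew Dθ N (iterSym (totalD 𝒯.pParity) m (Q A l))

/-- The extension `s̄` of `s` to the parent theory: `s̄ Ψ^A = S̄^A`, and `s̄` commutes with `∂_μ`,
`∂^F/∂θ^ν` and `∂/∂x^κ + ∂^F/∂y^κ`. -/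
def sBar (T : Type) : 𝒯.ParentFun T → 𝒯.ParentFun T :=
  𝒯.prolong 𝒯.dFθ fun A l =>
    iterSym (fun κ f => dx _ κ f + 𝒯.dFy κ f) l (𝒯.bar T (inclTheta T n _ (𝒯.S A)))

/-- The BRST differential `s^P = d^F - σ^F + s̄` of the parent theory. -/
def sP (f : 𝒯.ParentFun Empty) : 𝒯.ParentFun Empty :=
  𝒯.dF f - 𝒯.sigmaF f + 𝒯.sBar Empty f

/-- The parent differential `s̃^P` of `s̃`. On functions of `x`, `θ` and the `y`-derivatives
`Ψ^A_{()(λ)[]}`, replacing `x`-derivatives by `y`-derivatives in `s̃` gives the vector field with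
`x^μ ↦ θ^μ`, `θ^μ ↦ 0` and `Ψ^A_{()(λ)[]} ↦ bar (s̃ Ψ^A_{(λ)})`. Its prolongation to all `x`- and
`θ`-derivatives is `θ^μ ∂_μ` plus the prolongation of the characteristic
`bar (s̃ Ψ^A_{(λ)}) - θ^μ ∂_μ Ψ^A_{()(λ)[]}` by means of `∂_μ` and `∂^θ_ν`. -/
def sTildeP (f : 𝒯.ParentFun (Fin n)) : 𝒯.ParentFun (Fin n) :=
  ∑ μ, cθ n _ μ * totalD 𝒯.pParity μ f +
    𝒯.prolong 𝒯.totalθ (fun A l =>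
      𝒯.bar (Fin n) (𝒯.sTilde (cz (Fin n) n _ (A, l))) -
        ∑ μ, cθ n _ μ * totalD 𝒯.pParity μ (𝒯.psi (Fin n) A 0 l ∅)) f

end BRSTTheory

/-! ### Trivial pairs and generalized auxiliary fields

Invertible changes of coordinates are isomorphisms of the algebras of superfunctions that preserve
the parity; such isomorphisms are exactly the invertible smooth substitutions. -/

/-- The parities of variables `φ^i`, `w^a`, `v^a`, where `v^a` has the parity opposite to `w^a`. -/
def splitParity {Φ : Type v} {W : Type w} (pφ : Φ → ZMod 2) (pw : W → ZMod 2) :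
    Φ ⊕ W ⊕ W → ZMod 2
  | .inl i => pφ i
  | .inr (.inl a) => pw a
  | .inr (.inr a) => pw a + 1

/-- Trivial pairs `(w^a, v^a)`, `a : W`, of `s̃`: the coordinates `x, θ, Ψ^A_{(λ)}` can be exchanged
for `x, θ, φ^i, w^a, v^a`, with `s̃ w^a = v^a`. The change of coordinates need not respect the total
derivatives. -/
structure TrivialPairs {n : ℕ} {ι : Type u} (𝒯 : BRSTTheory n ι) (Φ : Type v) (W : Type w) where
  /-- The parity of the `φ^i`. -/
  pφ : Φ → ZMod 2
  /-- The parity of the `w^a`. -/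
  pw : W → ZMod 2
  /-- The change of coordinates. -/
  e : ZFun (Fin n) n (splitParity pφ pw) ≃ₐ[ℝ] LocalFun (Fin n) n 𝒯.parity
  e_parity : ∀ f, e (parityAut _ f) = parityAut _ (e f)
  e_x : ∀ μ, e (cx _ _ μ) = cx _ _ μ
  e_theta : ∀ μ, e (cθ _ _ μ) = cθ _ _ μ
  pair : ∀ a, 𝒯.sTilde (e (cz _ _ _ (.inr (.inl a)))) = e (cz _ _ _ (.inr (.inr a)))

/-- In the theory with fields `F` and differential `s`, the local functions `w^a`, `v^a` are
generalized auxiliary fields with complementary fields `φ^i`: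
there is an invertible change of fields (possibly involving derivatives) from `F` to
`φ^i, w^a, v^a`, and the equations `s w^a|_{w = 0} = 0`, in the space of fields and their
derivatives, are equivalent to `v^a = V^a[φ]` for some local functions `V^a` of the `φ^i`. The
equivalence is equality of the ideals generated by the two systems
`w = 0, s w = 0` and `w = 0, v - V = 0` together with their derivatives. -/
def IsGeneralizedAuxiliary {n : ℕ} {F : Type u} {Φ : Type v} {W : Type w} (p : F → ZMod 2)
    (s : LocalFun Empty n p → LocalFun Empty n p) (pφ : Φ → ZMod 2) (pw : W → ZMod 2)
    (φ : Φ → LocalFun Empty n p) (w v : W → LocalFun Empty n p) : Prop :=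
  ∃ e : LocalFun Empty n (splitParity pφ pw) ≃ₐ[ℝ] LocalFun Empty n p,
    (∀ f, e (parityAut _ f) = parityAut _ (e f)) ∧
    (∀ μ, e (cx _ _ μ) = cx _ _ μ) ∧
    (∀ μ f, e (totalD _ μ f) = totalD _ μ (e f)) ∧
    (∀ i, e (cz _ _ _ (.inl i, 0)) = φ i) ∧
    (∀ a, e (cz _ _ _ (.inr (.inl a), 0)) = w a) ∧
    (∀ a, e (cz _ _ _ (.inr (.inr a), 0)) = v a) ∧
    ∃ V : W → LocalFun Empty n pφ, (∀ a, HasParity _ (pw a + 1) (V a)) ∧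
      Ideal.span (Set.range (fun k : W × (Fin n → ℕ) => iterSym (totalD p) k.2 (w k.1)) ∪
          Set.range (fun k : W × (Fin n → ℕ) => iterSym (totalD p) k.2 (s (w k.1)))) =
        Ideal.span (Set.range (fun k : W × (Fin n → ℕ) => iterSym (totalD p) k.2 (w k.1)) ∪
          Set.range (fun k : W × (Fin n → ℕ) => iterSym (totalD p) k.2
            (v k.1 - e (renameZ Empty n (fun i : Jet n Φ => (Sum.inl i.1, i.2))
              (fun _ => rfl) (V k.1)))))

namespace TrivialPairs

variable {n : ℕ} {ι : Type u} {𝒯 : BRSTTheory n ι} {Φ : Type v} {W : Type w}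
  (tp : TrivialPairs 𝒯 Φ W)

/-- `(∂^θ_{ν₁} … ∂^θ_{ν_k} f)|_{θ = 0}`, where the `x`-derivatives in `f` have been replaced by
`y`-derivatives. -/
def descendant (𝒯 : BRSTTheory n ι) (f : LocalFun (Fin n) n 𝒯.parity) (N : Finset (Fin n)) :
    𝒯.ParentFun Empty :=
  thetaZero _ (iterSkew 𝒯.totalθ N (𝒯.bar (Fin n) f))

/-- `φ^i_{ν₁…ν_k}`. -/
def phiDesc (k : Desc n Φ) : 𝒯.ParentFun Empty :=
  descendant 𝒯 (tp.e (cz _ _ _ (.inl k.1))) k.2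

/-- `w^a_{ν₁…ν_k} = (∂^θ_{ν₁} … ∂^θ_{ν_k} w^a)|_{θ = 0}`. -/
def wDesc (k : Desc n W) : 𝒯.ParentFun Empty :=
  descendant 𝒯 (tp.e (cz _ _ _ (.inr (.inl k.1)))) k.2

/-- `v^a_{ν₁…ν_k} = (-1)^k (∂^θ_{ν₁} … ∂^θ_{ν_k} v^a)|_{θ = 0}`. -/
def vDesc (k : Desc n W) : 𝒯.ParentFun Empty :=
  sgn (k.2.card : ZMod 2) • descendant 𝒯 (tp.e (cz _ _ _ (.inr (.inr k.1)))) k.2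

end TrivialPairs

end

noncomputable section

/-! ### Hadamard's lemma -/

/-! The proof rests on one principle: a homomorphism or graded derivation of superfunctions is
determined by its values on the coordinates, and images of the right parity can be prescribed
freely. Homomorphisms here are purely algebraic, with no continuity or smoothness assumed, so both
halves need an argument. For uniqueness, Hadamard's lemma f = f(a) + ∑ (x_e - a_e) G_e, applied at
the body of the images of the coordinates, shows that a discrepancy vanishing on coordinates has
arbitrarily high Grassmann degree, hence is zero (`SF.cyl_bider_eq_zero`, `SF.bider_eq_zero`). For
existence, one first substitutes the bodies and then adds the nilpotent parts, one summand of square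
zero at a time (`SF.exists_hom`). Identities between derivations thereby become computations on x, θ
and Ψ.

(i) Both sides are odd derivations, so only the generators matter (`ZF.sTP_eq`). On Ψ_{(m)(l)[N]}
the iterated ∂^θ act on terms θ^μ(∂_y - ∂_x)Ψ. By the Leibniz rule (`ZF.iterSkew_tθ_pθ_mul`) the
terms in which θ^μ survives combine with θ^μ ∂_μ into the y-derivative, and those in which θ^μ is
struck give d^F - σ^F. The characteristic of s̄ has no explicit θ, so on it ∂^θ reduces to ∂^F/∂θ.
Setting θ = 0 in (i) gives (ii).

(iii) A change of coordinates h lifts to the parent theory by sending z_{(m)[N]} to ±∂^θ_N ∂_(m) of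
the superfield of h z. The lift commutes with ∂_μ and ∂^θ_ν and is therefore functorial
(`ZF.extend_comp`), so the inverse lifts to the inverse; it fixes θ, so everything descends to θ =
0. This yields the invertible change of fields, up to signs (`ZF.descEquiv`). For the equations, the
bar map intertwines s̃ with s̃^P (`ZF.bar_sT`), and the graded commutator of s̃^P and ∂^θ_ν is ∂_ν
(`ZF.sTP_tθ`). Moving s̃^P through ∂^θ_N gives s^P w_N = v_N plus x-derivatives of descendants of w
(`ZF.sTP_iterSkew`). Modulo the ideal of w = 0 the equations s^P w = 0 are thus v = 0, and V = 0
serves. -/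

theorem hasFDerivAt_intervalIntegral_param {V : Type*} [NormedAddCommGroup V] [NormedSpace ℝ V]
    [FiniteDimensional ℝ V] {G : V × ℝ → ℝ} (hG : ContDiff ℝ ∞ G) (x₀ : V) :
    HasFDerivAt (fun x => ∫ t in (0 : ℝ)..1, G (x, t))
      (∫ t in (0 : ℝ)..1, (fderiv ℝ G (x₀, t)).comp (ContinuousLinearMap.inl ℝ V ℝ)) x₀ := by
  have hc : Continuous G := hG.continuous
  have hc' : Continuous fun y : V × ℝ =>
      (fderiv ℝ G y).comp (ContinuousLinearMap.inl ℝ V ℝ) :=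
    (hG.continuous_fderiv (by simp)).clm_comp continuous_const
  -- The dominating constant: the derivative is bounded on the product of the closed unit ball,
  -- compact because `V` is finite-dimensional, with [0, 1].
  obtain ⟨C, hC⟩ := ((isCompact_closedBall x₀ 1).prod (isCompact_Icc (a := (0 : ℝ)) (b := 1))).exists_bound_of_continuousOn
    hc'.continuousOn
  refine intervalIntegral.hasFDerivAt_integral_of_dominated_of_fderiv_le
    (F' := fun x t => (fderiv ℝ G (x, t)).comp (ContinuousLinearMap.inl ℝ V ℝ))
    (bound := fun _ => C) (Metric.closedBall_mem_nhds x₀ one_pos) ?_ ?_ ?_ ?_ ?_ ?_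
  · exact Filter.Eventually.of_forall fun x =>
      (hc.comp (by fun_prop : Continuous fun t : ℝ => (x, t))).aestronglyMeasurable
  · exact (hc.comp (by fun_prop : Continuous fun t : ℝ => (x₀, t))).intervalIntegrable _ _
  · exact (hc'.comp (by fun_prop : Continuous fun t : ℝ => (x₀, t))).aestronglyMeasurable
  · refine Filter.Eventually.of_forall fun t ht x hx => hC (x, t) ⟨hx, ?_⟩
    rw [Set.uIoc_of_le zero_le_one] at ht
    exact ⟨ht.1.le, ht.2⟩
  · exact intervalIntegrable_const
  · refine Filter.Eventually.of_forall fun t _ x _ => ?_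
    have h1 : HasFDerivAt G (fderiv ℝ G (x, t)) (x, t) :=
      ((hG.differentiable (by simp)) _).hasFDerivAt
    exact h1.comp x (hasFDerivAt_prodMk_left x t)

/-- Each directional derivative is again an integral of a smooth function with parameter, so
induction on the order of differentiability closes. -/
theorem contDiff_intervalIntegral_param {V : Type*} [NormedAddCommGroup V] [NormedSpace ℝ V]
    [FiniteDimensional ℝ V] {G : V × ℝ → ℝ} (hG : ContDiff ℝ ∞ G) :
    ContDiff ℝ ∞ fun x => ∫ t in (0 : ℝ)..1, G (x, t) := by
  refine contDiff_infty.2 fun k => ?_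
  induction k generalizing G with
  | zero =>
    exact contDiff_zero.2 (continuous_iff_continuousAt.2 fun x =>
      (hasFDerivAt_intervalIntegral_param hG x).continuousAt)
  | succ k ih =>
    rw [Nat.cast_succ]
    refine contDiff_succ_iff_fderiv_apply.2
      ⟨fun x => (hasFDerivAt_intervalIntegral_param hG x).differentiableAt, by simp, fun y => ?_⟩
    have h : (fun x => fderiv ℝ (fun x => ∫ t in (0 : ℝ)..1, G (x, t)) x y) =
        fun x => ∫ t in (0 : ℝ)..1, fderiv ℝ G (x, t) (y, 0) := by
      funext x
      rw [(hasFDerivAt_intervalIntegral_param hG x).fderiv,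
        ContinuousLinearMap.intervalIntegral_apply]
      · rfl
      · refine Continuous.intervalIntegrable ?_ _ _
        exact ((hG.continuous_fderiv (by simp)).comp
          (by fun_prop : Continuous fun t : ℝ => (x, t))).clm_comp continuous_const
    rw [h]
    exact ih (G := fun z => fderiv ℝ G z (y, 0))
      ((hG.fderiv_right (m := ∞) (by simp)).clm_apply contDiff_const)

/-- Integrate the derivative of `g` along the segment from `a` to `r`; the coefficient `G k` is the
average of the k-th partial derivative over that segment. -/
theorem hadamard {κ : Type*} [Fintype κ] {g : (κ → ℝ) → ℝ} (hg : ContDiff ℝ ∞ g) (a : κ → ℝ) :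
    ∃ G : κ → (κ → ℝ) → ℝ, (∀ k, ContDiff ℝ ∞ (G k)) ∧
      ∀ r, g r = g a + ∑ k, (r k - a k) * G k r := by
  classical
  have hline : ContDiff ℝ ∞ fun z : (κ → ℝ) × ℝ => a + z.2 • (z.1 - a) := by fun_prop
  refine ⟨fun k r => ∫ t in (0 : ℝ)..1, fderiv ℝ g (a + t • (r - a)) (Pi.single k 1), ?_, ?_⟩
  · intro k
    exact contDiff_intervalIntegral_param
      (G := fun z => fderiv ℝ g (a + z.2 • (z.1 - a)) (Pi.single k 1))
      (((hg.fderiv_right (m := ∞) (by simp)).comp hline).clm_apply contDiff_const)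
  · intro r
    have hcf : ∀ v, Continuous fun t : ℝ => fderiv ℝ g (a + t • (r - a)) v := fun v =>
      ((hg.continuous_fderiv (by simp)).comp
        (by fun_prop : Continuous fun t : ℝ => a + t • (r - a))).clm_apply continuous_const
    have hd : ∀ t : ℝ, HasDerivAt (fun t : ℝ => g (a + t • (r - a)))
        (fderiv ℝ g (a + t • (r - a)) (r - a)) t := by
      intro t
      have h1 : HasFDerivAt g (fderiv ℝ g (a + t • (r - a))) (a + t • (r - a)) :=
        ((hg.differentiable (by simp)) _).hasFDerivAt
      have h2 : HasDerivAt (fun t : ℝ => a + t • (r - a)) (r - a) t := by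
        simpa using ((hasDerivAt_id t).smul_const (r - a)).const_add a
      exact h1.comp_hasDerivAt t h2
    have h3 := intervalIntegral.integral_eq_sub_of_hasDerivAt (a := 0) (b := 1)
      (fun t _ => hd t) ((hcf _).intervalIntegrable _ _)
    have h4 : ∀ t : ℝ, fderiv ℝ g (a + t • (r - a)) (r - a) =
        ∑ k, (r k - a k) * fderiv ℝ g (a + t • (r - a)) (Pi.single k 1) := by
      intro t
      rw [show fderiv ℝ g (a + t • (r - a)) (r - a) = fderiv ℝ g (a + t • (r - a))
        (∑ k, Pi.single k ((r - a) k)) by rw [Finset.univ_sum_single], map_sum]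
      refine Finset.sum_congr rfl fun k _ => ?_
      rw [show (Pi.single k ((r - a) k) : κ → ℝ) = (r k - a k) • Pi.single k 1 by
        rw [← Pi.single_smul]; simp, map_smul, smul_eq_mul]
    simp only [one_smul, zero_smul, add_zero, h4] at h3
    rw [intervalIntegral.integral_finsetSum] at h3
    · simp only [intervalIntegral.integral_const_mul] at h3
      rw [h3]
      simp
    · intro k _
      exact (continuous_const.mul (hcf _)).intervalIntegrable _ _

/-- `f` depends only on the coordinates in `F`. -/
def DependsOnCoords {E : Type u} (F : Finset E) (f : Cyl E) : Prop :=
  ∃ g : (F → ℝ) → ℝ, ContDiff ℝ ∞ g ∧ ∀ q, (f : (E → ℝ) → ℝ) q = g fun i => q i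

theorem exists_dependsOnCoords {E : Type u} (f : Cyl E) : ∃ F, DependsOnCoords F f := f.2

theorem DependsOnCoords.mono {E : Type u} {F F' : Finset E} {f : Cyl E} (h : DependsOnCoords F f)
    (hF : F ⊆ F') : DependsOnCoords F' f := by
  obtain ⟨g, hg, hf⟩ := h
  exact ⟨fun r => g fun i => r ⟨i, hF i.2⟩,
    hg.comp (contDiff_pi.2 fun i => contDiff_apply ℝ ℝ _), hf⟩

/-- The even coordinate `e`. -/
def Cyl.coord {E : Type u} (e : E) : Cyl E := ⟨fun q => q e, IsCyl.coord e⟩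

/-- That the coefficients depend on the same finite set `F` is what allows the expansion to be
iterated. -/
theorem DependsOnCoords.hadamard {E : Type u} {F : Finset E} {f : Cyl E}
    (h : DependsOnCoords F f) (a : E → ℝ) :
    ∃ G : E → Cyl E, (∀ e, DependsOnCoords F (G e)) ∧
      f = algebraMap ℝ _ ((f : (E → ℝ) → ℝ) a) +
        ∑ e ∈ F, (Cyl.coord e - algebraMap ℝ _ (a e)) * G e := by
  classical
  obtain ⟨g, hg, hf⟩ := h
  obtain ⟨G, hG, hgG⟩ := _root_.hadamard hg fun i => a i
  refine ⟨fun e => if he : e ∈ F then ⟨fun q => G ⟨e, he⟩ fun i => q i,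
    ⟨F, G ⟨e, he⟩, hG _, fun _ => rfl⟩⟩ else 0, ?_, ?_⟩
  · intro e
    by_cases he : e ∈ F
    · simp only [he, dif_pos]
      exact ⟨G ⟨e, he⟩, hG _, fun _ => rfl⟩
    · simp only [he, dif_neg, not_false_eq_true]
      exact ⟨fun _ => 0, contDiff_const, fun _ => rfl⟩
  · apply Subtype.ext
    funext q
    rw [← Finset.sum_coe_sort F]
    have h1 : ∀ s : Finset F, ∀ X : F → Cyl E,
        ((∑ i ∈ s, X i : Cyl E) : (E → ℝ) → ℝ) q = ∑ i ∈ s, (X i : (E → ℝ) → ℝ) q := by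
      intro s X
      rw [AddSubmonoidClass.coe_finsetSum, Finset.sum_apply]
    change (f : (E → ℝ) → ℝ) q = (f : (E → ℝ) → ℝ) a + ((∑ i : F, _ : Cyl E) : (E → ℝ) → ℝ) q
    rw [h1, hf, hf, hgG]
    congr 1
    refine Finset.sum_congr rfl fun i _ => ?_
    simp only [Finset.coe_mem, dif_pos]
    rfl

/-! ### Superalgebra -/

section Grassmann

variable {O : Type u}

/-- The parity automorphism of the Grassmann algebra. -/
def Grassmann.invol (O : Type u) : Grassmann O →ₐ[ℝ] Grassmann O :=
  CliffordAlgebra.involute (Q := (0 : QuadraticForm ℝ (O →₀ ℝ)))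

theorem Grassmann.induction {P : Grassmann O → Prop} (algebraMap : ∀ r : ℝ, P (algebraMap _ _ r))
    (add : ∀ x y, P x → P y → P (x + y))
    (ι_mul : ∀ x m, P x → P (ExteriorAlgebra.ι ℝ m * x)) (x : Grassmann O) : P x :=
  CliffordAlgebra.left_induction (0 : QuadraticForm ℝ (O →₀ ℝ)) algebraMap add ι_mul x

@[simp] theorem Grassmann.invol_ι (m : O →₀ ℝ) :
    Grassmann.invol O (ExteriorAlgebra.ι ℝ m) = -ExteriorAlgebra.ι ℝ m :=
  CliffordAlgebra.involute_ι _

@[simp] theorem Grassmann.invol_invol (x : Grassmann O) :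
    Grassmann.invol O (Grassmann.invol O x) = x :=
  CliffordAlgebra.involute_involute x

theorem Grassmann.ι_mul_ι (v m : O →₀ ℝ) :
    (ExteriorAlgebra.ι ℝ v * ExteriorAlgebra.ι ℝ m : Grassmann O) =
      -(ExteriorAlgebra.ι ℝ m * ExteriorAlgebra.ι ℝ v) :=
  eq_neg_of_add_eq_zero_left (ExteriorAlgebra.ι_add_mul_swap v m)

theorem Grassmann.ι_mul (v : O →₀ ℝ) (f : Grassmann O) :
    ExteriorAlgebra.ι ℝ v * f = Grassmann.invol O f * ExteriorAlgebra.ι ℝ v := by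
  induction f using Grassmann.induction with
  | algebraMap r => rw [AlgHom.commutes, Algebra.commutes]
  | add x y hx hy => rw [mul_add, hx, hy, map_add, add_mul]
  | ι_mul x m hx =>
    rw [map_mul, Grassmann.invol_ι, ← mul_assoc, Grassmann.ι_mul_ι, neg_mul, mul_assoc, hx]
    simp only [neg_mul, mul_assoc]

theorem Grassmann.mul_ι (v : O →₀ ℝ) (f : Grassmann O) :
    f * ExteriorAlgebra.ι ℝ v = ExteriorAlgebra.ι ℝ v * Grassmann.invol O f := by
  rw [Grassmann.ι_mul, Grassmann.invol_invol]

/-- Left multiplication by a generator turns the even combination c + invol c into the odd one and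
conversely, so the two statements are proved in one induction. Working with these combinations
avoids a decomposition into homogeneous parts. -/
theorem Grassmann.supercomm (c : Grassmann O) : ∀ f : Grassmann O,
    (c + invol O c) * f = f * (c + invol O c) ∧
      (c - invol O c) * f = invol O f * (c - invol O c) := by
  induction c using Grassmann.induction with
  | algebraMap r =>
    intro f
    simp only [AlgHom.commutes, sub_self, zero_mul, mul_zero, and_true, ← map_add]
    exact Algebra.commutes _ _
  | add x y hx hy =>
    intro f
    obtain ⟨h1, h2⟩ := hx f
    obtain ⟨h3, h4⟩ := hy f
    constructor
    · calc _ = (x + invol O x) * f + (y + invol O y) * f := by rw [map_add]; noncomm_ring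
        _ = _ := by rw [h1, h3, map_add]; noncomm_ring
    · calc _ = (x - invol O x) * f + (y - invol O y) * f := by rw [map_add]; noncomm_ring
        _ = _ := by rw [h2, h4, map_add]; noncomm_ring
  | ι_mul x m hx =>
    intro f
    obtain ⟨h1, h2⟩ := hx f
    rw [map_mul, invol_ι, neg_mul, sub_neg_eq_add, ← sub_eq_add_neg, ← mul_sub, ← mul_add]
    refine ⟨?_, ?_⟩
    · rw [mul_assoc, h2, ← mul_assoc, Grassmann.ι_mul, invol_invol, mul_assoc]
    · rw [mul_assoc, h1, ← mul_assoc, Grassmann.ι_mul, mul_assoc]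

/-- The contraction with the coordinate `o`. -/
def Grassmann.contract (o : O) : Grassmann O →ₗ[ℝ] Grassmann O :=
  CliffordAlgebra.contractLeft (Q := (0 : QuadraticForm ℝ (O →₀ ℝ))) (Finsupp.lapply o)

theorem Grassmann.contract_algebraMap (o : O) (r : ℝ) :
    contract o (algebraMap ℝ (Grassmann O) r) = 0 :=
  CliffordAlgebra.contractLeft_algebraMap (Q := (0 : QuadraticForm ℝ (O →₀ ℝ))) _ _

theorem Grassmann.contract_ι_mul (o : O) (m : O →₀ ℝ) (x : Grassmann O) :
    contract o (ExteriorAlgebra.ι ℝ m * x) = m o • x - ExteriorAlgebra.ι ℝ m * contract o x :=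
  CliffordAlgebra.contractLeft_ι_mul (Q := (0 : QuadraticForm ℝ (O →₀ ℝ))) _ _ _

theorem Grassmann.contract_ι (o : O) (m : O →₀ ℝ) :
    contract o (ExteriorAlgebra.ι ℝ m : Grassmann O) = algebraMap ℝ _ (m o) :=
  CliffordAlgebra.contractLeft_ι (Q := (0 : QuadraticForm ℝ (O →₀ ℝ))) _ _

theorem Grassmann.contract_mul (o : O) (x y : Grassmann O) :
    contract o (x * y) = contract o x * y + invol O x * contract o y := by
  induction x using Grassmann.induction with
  | algebraMap r =>
    rw [contract_algebraMap, AlgHom.commutes, ← Algebra.smul_def, ← Algebra.smul_def, map_smul,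
      zero_mul, zero_add]
  | add a b ha hb => simp only [map_add, add_mul, ha, hb]; abel
  | ι_mul a m ha =>
    rw [mul_assoc, contract_ι_mul, ha, contract_ι_mul, map_mul, invol_ι, sub_mul, smul_mul_assoc]
    noncomm_ring

theorem Grassmann.invol_contract (o : O) (x : Grassmann O) :
    invol O (contract o x) = -contract o (invol O x) := by
  induction x using Grassmann.induction with
  | algebraMap r => simp only [AlgHom.commutes, contract_algebraMap, map_zero, neg_zero]
  | add a b ha hb => simp only [map_add, ha, hb, neg_add]
  | ι_mul a m ha =>
    rw [contract_ι_mul, map_mul, invol_ι, neg_mul, map_neg, contract_ι_mul, map_sub, map_mul, ha,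
      map_smul, invol_ι]
    noncomm_ring

theorem Grassmann.finite_support_contract (x : Grassmann O) :
    {o : O | contract o x ≠ 0}.Finite := by
  induction x using Grassmann.induction with
  | algebraMap r => simp [contract_algebraMap]
  | add a b ha hb =>
    refine (ha.union hb).subset fun o ho => ?_
    by_contra h
    simp only [Set.mem_union, Set.mem_ofPred_eq, not_or, not_not] at h
    exact ho (by rw [map_add, h.1, h.2, add_zero])
  | ι_mul a m ha =>
    refine (ha.union m.hasFiniteSupport).subset fun o ho => ?_
    by_contra h
    simp only [Set.mem_union, Set.mem_ofPred_eq, not_or, not_not, Function.mem_support] at h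
    exact ho (by rw [contract_ι_mul, h.1, h.2, zero_smul, mul_zero, sub_zero])

end Grassmann

theorem Cyl.pderiv_mul {E : Type u} (e : E) (f g : Cyl E) :
    Cyl.pderiv e (f * g) = Cyl.pderiv e f * g + f * Cyl.pderiv e g := by
  classical
  obtain ⟨f, F, f', hf', hf⟩ := f
  obtain ⟨g, G, g', hg', hg⟩ := g
  apply Subtype.ext
  funext q
  have h1 := lineDeriv_cyl e hf' hf q
  have h2 := lineDeriv_cyl e hg' hg q
  have h3 := HasDerivAt.mul h1 h2
  -- Quantifying over the instance reconciles the classical one inside `Cyl.pderiv` with the one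
  -- found here.
  have h4 : ∀ D : DecidableEq E, lineDeriv ℝ (f * g) q (@Pi.single E (fun _ => ℝ) _ D e 1) =
      lineDeriv ℝ f q (@Pi.single E (fun _ => ℝ) _ D e 1) * g q +
        f q * lineDeriv ℝ g q (@Pi.single E (fun _ => ℝ) _ D e 1) := by
    intro D
    obtain rfl : D = fun a b => Classical.propDecidable (a = b) := Subsingleton.elim _ _
    rw [h1.lineDeriv, h2.lineDeriv]
    refine (HasDerivAt.deriv h3).trans ?_
    simp
  exact h4 _

theorem Cyl.pderiv_eq_zero {E : Type u} {F : Finset E} {f : Cyl E} (h : DependsOnCoords F f)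
    {e : E} (he : e ∉ F) : Cyl.pderiv e f = 0 := by
  classical
  obtain ⟨g, hg, hf⟩ := h
  apply Subtype.ext
  funext q
  refine (lineDeriv_cyl e hg hf q).lineDeriv.trans ?_
  have : (fun i : F => (Pi.single e 1 : E → ℝ) i) = 0 := by
    funext i
    exact Pi.single_eq_of_ne (fun h : (i : E) = e => he (h ▸ i.2)) _
  rw [this, map_zero]
  rfl

theorem Cyl.pderiv_coord {E : Type u} [inst : DecidableEq E] (e e' : E) :
    Cyl.pderiv e (Cyl.coord e') = if e = e' then 1 else 0 := by
  apply Subtype.ext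
  funext q
  have h : HasLineDerivAt ℝ (fun q : E → ℝ => q e') ((Pi.single e 1 : E → ℝ) e') q
      (Pi.single e 1) := by
    have := ((hasDerivAt_id (0 : ℝ)).smul_const ((Pi.single e 1 : E → ℝ) e')).const_add (q e')
    simpa [HasLineDerivAt] using this
  have h4 : ∀ D : DecidableEq E, lineDeriv ℝ (fun q : E → ℝ => q e') q (@Pi.single E (fun _ => ℝ) _ D e 1) =
      if e = e' then 1 else 0 := by
    intro D
    obtain rfl : D = inst := Subsingleton.elim _ _
    rw [h.lineDeriv, Pi.single_apply]
    simp only [eq_comm]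
  refine (h4 _).trans ?_
  split <;> rfl

theorem Cyl.pderiv_one {E : Type u} (e : E) : Cyl.pderiv e (1 : Cyl E) = 0 :=
  Cyl.pderiv_eq_zero (F := ∅) ⟨fun _ => 1, contDiff_const, fun _ => rfl⟩ (Finset.notMem_empty _)

theorem Grassmann.contract_one {O : Type u} (o : O) : contract o (1 : Grassmann O) = 0 := by
  simpa using contract_algebraMap o 1

/-! ### Graded derivations -/

theorem ZMod.two_cases (a : ZMod 2) : a = 0 ∨ a = 1 := by
  revert a; decide

theorem ZMod.add_add_self (a b : ZMod 2) : b + a + b = a := by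
  revert a b; decide

@[simp] theorem sgn_zero : sgn 0 = 1 := if_pos rfl

@[simp] theorem sgn_one : sgn 1 = -1 := if_neg (by decide)

theorem sgn_add (a b : ZMod 2) : sgn (a + b) = sgn a * sgn b := by
  have : (1 : ZMod 2) + 1 = 0 := by decide
  obtain rfl | rfl := ZMod.two_cases a <;> obtain rfl | rfl := ZMod.two_cases b <;> simp [this]

@[simp] theorem sgn_mul_self (a : ZMod 2) : sgn a * sgn a = 1 := by
  obtain rfl | rfl := ZMod.two_cases a <;> simp

/-- A supercommutative algebra, with its parity automorphism `σ`. -/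
class SuperAlgebra (A : Type u) extends Ring A, Algebra ℝ A where
  /-- The parity automorphism. -/
  σ : A →ₐ[ℝ] A
  σ_σ : ∀ f, σ (σ f) = f
  -- The elements c + σ c and c - σ c are twice the even and odd parts of c: the first must be
  -- central, the second must commute up to σ.
  even_mul : ∀ c f : A, (c + σ c) * f = f * (c + σ c)
  odd_mul : ∀ c f : A, (c - σ c) * f = σ f * (c - σ c)

section SuperAlgebra

open SuperAlgebra

variable {A : Type u} [SuperAlgebra A] {a b : ZMod 2} {f g : A} {D D' : A → A}

/-- The power `a` of the parity automorphism. -/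
def signAut (A : Type u) [SuperAlgebra A] (a : ZMod 2) : A →ₐ[ℝ] A :=
  if a = 0 then AlgHom.id ℝ _ else σ

@[simp] theorem signAut_zero : signAut A 0 = AlgHom.id ℝ _ := if_pos rfl

@[simp] theorem signAut_one : signAut A 1 = σ := if_neg (by decide)

theorem signAut_add (a b : ZMod 2) (f : A) :
    signAut A (a + b) f = signAut A a (signAut A b f) := by
  have : (1 : ZMod 2) + 1 = 0 := by decide
  obtain rfl | rfl := ZMod.two_cases a <;> obtain rfl | rfl := ZMod.two_cases b <;>
    simp [this, σ_σ]

/-- `f` is homogeneous of parity `a`. -/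
def IsHomog (a : ZMod 2) (f : A) : Prop := σ f = sgn a • f

namespace IsHomog

/-- For homogeneous `f` one of f + σ f, f - σ f equals 2 f, and the 2 can be cancelled over ℝ. -/
theorem mul_eq (hf : IsHomog a f) (g : A) : f * g = signAut A a g * f := by
  have h2 : (2 : ℝ) ≠ 0 := two_ne_zero
  have h3 : σ f = sgn a • f := hf
  apply smul_right_injective _ h2
  obtain rfl | rfl := ZMod.two_cases a
  · have := even_mul f g
    rw [h3] at this
    simpa [two_smul, add_mul, mul_add] using this
  · have := odd_mul f g
    rw [h3] at this
    simpa [two_smul, add_mul, mul_add] using this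

theorem comm (hf : IsHomog 0 f) (g : A) : f * g = g * f := by simpa using hf.mul_eq g

theorem zero (a : ZMod 2) : IsHomog a (0 : A) := by simp [IsHomog]

theorem smul (hf : IsHomog a f) (r : ℝ) : IsHomog a (r • f) := by
  unfold IsHomog at *
  rw [map_smul, hf, smul_comm]

theorem sub (hf : IsHomog a f) (hg : IsHomog a g) : IsHomog a (f - g) := by
  unfold IsHomog at *
  rw [map_sub, hf, hg, smul_sub]

theorem sum {κ : Type*} {s : Finset κ} {f : κ → A} (hf : ∀ k ∈ s, IsHomog a (f k)) :
    IsHomog a (∑ k ∈ s, f k) := by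
  unfold IsHomog at *
  rw [map_sum, Finset.smul_sum]
  exact Finset.sum_congr rfl hf

theorem signAut (hf : IsHomog a f) : signAut A b f = sgn (a * b) • f := by
  obtain rfl | rfl := ZMod.two_cases b
  · simp
  · rw [signAut_one, mul_one]; exact hf

end IsHomog

/-- `D` is a graded derivation of parity `a`. -/
structure IsSDer (a : ZMod 2) (D : A → A) : Prop where
  map_add : ∀ f g, D (f + g) = D f + D g
  map_smul : ∀ (r : ℝ) f, D (r • f) = r • D f
  map_mul : ∀ f g, D (f * g) = D f * g + signAut A a f * D g
  map_sigma : ∀ f, σ (D f) = sgn a • D (σ f)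

namespace IsSDer

theorem map_zero (h : IsSDer a D) : D 0 = 0 := by
  simpa using h.map_smul 0 0

theorem map_neg (h : IsSDer a D) (f : A) : D (-f) = -D f := by
  simpa using h.map_smul (-1) f

theorem map_sub (h : IsSDer a D) (f g : A) : D (f - g) = D f - D g := by
  rw [sub_eq_add_neg, h.map_add, h.map_neg, sub_eq_add_neg]

theorem map_sum (h : IsSDer a D) {κ : Type*} (s : Finset κ) (f : κ → A) :
    D (∑ k ∈ s, f k) = ∑ k ∈ s, D (f k) :=
  _root_.map_sum (AddMonoidHom.mk' D h.map_add) f s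

theorem map_one (h : IsSDer a D) : D 1 = 0 := by
  simpa using h.map_mul 1 1

theorem isHomog (h : IsSDer a D) (hf : IsHomog b f) : IsHomog (a + b) (D f) := by
  unfold IsHomog at *
  rw [h.map_sigma, hf, h.map_smul, smul_smul, sgn_add]

theorem add (h : IsSDer a D) (h' : IsSDer a D') : IsSDer a fun f => D f + D' f where
  map_add f g := by rw [h.map_add, h'.map_add]; abel
  map_smul r f := by rw [h.map_smul, h'.map_smul, smul_add]
  map_mul f g := by rw [h.map_mul, h'.map_mul, add_mul, mul_add]; abel
  map_sigma f := by rw [_root_.map_add, h.map_sigma, h'.map_sigma, smul_add]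

theorem smul (h : IsSDer a D) (r : ℝ) : IsSDer a fun f => r • D f where
  map_add f g := by rw [h.map_add, smul_add]
  map_smul s f := by rw [h.map_smul, smul_comm]
  map_mul f g := by rw [h.map_mul, smul_add, smul_mul_assoc, mul_smul_comm]
  map_sigma f := by rw [_root_.map_smul, h.map_sigma, smul_comm]

theorem sub (h : IsSDer a D) (h' : IsSDer a D') : IsSDer a fun f => D f - D' f := by
  simpa [sub_eq_add_neg] using h.add (h'.smul (-1))

theorem zero : IsSDer a fun _ : A => (0 : A) where
  map_add f g := by simp
  map_smul r f := by simp
  map_mul f g := by simp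
  map_sigma f := by simp

theorem sum {κ : Type*} {s : Finset κ} {D : κ → A → A}
    (h : ∀ k ∈ s, IsSDer a (D k)) : IsSDer a fun f => ∑ k ∈ s, D k f := by
  classical
  induction s using Finset.induction_on with
  | empty => simpa using IsSDer.zero
  | insert k s hk ih =>
    simp only [Finset.sum_insert hk]
    exact (h k (Finset.mem_insert_self _ _)).add
      (ih fun j hj => h j (Finset.mem_insert_of_mem hj))

theorem mul_left (h : IsSDer a D) {c : A} (hc : IsHomog b c) :
    IsSDer (b + a) fun f => c * D f where
  map_add f g := by rw [h.map_add, mul_add]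
  map_smul s f := by rw [h.map_smul, mul_smul_comm]
  map_mul f g := by
    rw [h.map_mul, mul_add, ← mul_assoc, ← mul_assoc, hc.mul_eq (signAut _ a f), signAut_add,
      ← mul_assoc]
  map_sigma f := by
    have hc' : σ c = sgn b • c := hc
    rw [_root_.map_mul, hc', h.map_sigma, smul_mul_smul_comm, sgn_add]

/-- The graded commutator. -/
theorem commutator (h : IsSDer a D) (h' : IsSDer b D') :
    IsSDer (a + b) fun f => D (D' f) - sgn (a * b) • D' (D f) where
  map_add f g := by simp only [h.map_add, h'.map_add, smul_add]; abel
  map_smul s f := by simp only [h.map_smul, h'.map_smul, smul_sub, smul_comm (sgn _)]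
  map_mul f g := by
    have h1 : ∀ f, signAut A b (D f) = sgn (a * b) • D (signAut A b f) := by
      intro f
      obtain rfl | rfl := ZMod.two_cases b
      · simp
      · simpa using h.map_sigma f
    have h2 : ∀ f, signAut A a (D' f) = sgn (a * b) • D' (signAut A a f) := by
      intro f
      obtain rfl | rfl := ZMod.two_cases a
      · simp
      · simpa using h'.map_sigma f
    have h3 : sgn (a * b) * sgn (a * b) = 1 := sgn_mul_self _
    simp only [h.map_mul, h'.map_mul, h.map_add, h'.map_add, h1, h2, smul_add, sub_mul, mul_sub,
      smul_mul_assoc, mul_smul_comm, smul_smul, h3, one_smul]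
    rw [← signAut_add, ← signAut_add, add_comm b a]
    abel
  map_sigma f := by
    simp only [_root_.map_sub, _root_.map_smul, h.map_sigma, h'.map_sigma, h.map_smul, h'.map_smul,
      sgn_add, smul_sub, smul_smul]
    congr 2
    ring

end IsSDer

end SuperAlgebra

/-! ### The algebra of superfunctions -/

section

variable {I : Type u} {p : I → ZMod 2}

theorem parityAut_tmul (c : Cyl (EvenIdx p)) (x : Grassmann (OddIdx p)) :
    parityAut p (c ⊗ₜ x) = c ⊗ₜ Grassmann.invol _ x := rfl

theorem parityAut_parityAut (f : SFun p) : parityAut p (parityAut p f) = f := by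
  induction f using TensorProduct.induction_on with
  | zero => rw [map_zero, map_zero]
  | tmul c x => rw [parityAut_tmul, parityAut_tmul, Grassmann.invol_invol]
  | add f g hf hg => rw [map_add, map_add, hf, hg]

theorem SFun.even_mul_tmul (c : Cyl (EvenIdx p)) (x : Grassmann (OddIdx p)) (f : SFun p) :
    (c ⊗ₜ (x + Grassmann.invol _ x)) * f = f * (c ⊗ₜ (x + Grassmann.invol _ x)) := by
  induction f using TensorProduct.induction_on with
  | zero => rw [mul_zero, zero_mul]
  | tmul d y =>
    rw [Algebra.TensorProduct.tmul_mul_tmul, Algebra.TensorProduct.tmul_mul_tmul,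
      (Grassmann.supercomm x y).1, mul_comm c d]
  | add f g hf hg => rw [mul_add, add_mul, hf, hg]

theorem SFun.odd_mul_tmul (c : Cyl (EvenIdx p)) (x : Grassmann (OddIdx p)) (f : SFun p) :
    (c ⊗ₜ (x - Grassmann.invol _ x)) * f =
      parityAut p f * (c ⊗ₜ (x - Grassmann.invol _ x)) := by
  induction f using TensorProduct.induction_on with
  | zero => rw [mul_zero, map_zero, zero_mul]
  | tmul d y =>
    rw [parityAut_tmul, Algebra.TensorProduct.tmul_mul_tmul, Algebra.TensorProduct.tmul_mul_tmul,
      (Grassmann.supercomm x y).2, mul_comm c d]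
  | add f g hf hg => rw [mul_add, map_add, add_mul, hf, hg]

end

/-- The algebra of superfunctions `SFun p`, as a supercommutative algebra. -/
def SF {I : Type u} (p : I → ZMod 2) : Type u := SFun p

namespace SF

open SuperAlgebra

variable {I : Type u} {p : I → ZMod 2}

theorem sub_supercomm_add {A : Type u} [Ring A] [Algebra ℝ A] (τ : A →ₐ[ℝ] A) {a b f : A}
    (ha : (a - τ a) * f = τ f * (a - τ a)) (hb : (b - τ b) * f = τ f * (b - τ b)) :
    (a + b - τ (a + b)) * f = τ f * (a + b - τ (a + b)) := by
  rw [map_add, add_sub_add_comm, add_mul, mul_add, ha, hb]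

theorem add_supercomm_add {A : Type u} [Ring A] [Algebra ℝ A] (τ : A →ₐ[ℝ] A) {a b f : A}
    (ha : (a + τ a) * f = f * (a + τ a)) (hb : (b + τ b) * f = f * (b + τ b)) :
    (a + b + τ (a + b)) * f = f * (a + b + τ (a + b)) := by
  rw [map_add, add_add_add_comm, add_mul, mul_add, ha, hb]

/-- The supercommutative algebra structure. It is not an instance by itself, so that unification
does not unfold the instances of the tensor product. -/
def superAlgebra (p : I → ZMod 2) : SuperAlgebra (SF p) where
  toRing := (Algebra.TensorProduct.instRing : Ring (SFun p))
  toAlgebra := (Algebra.TensorProduct.instAlgebra : Algebra ℝ (SFun p))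
  σ := (parityAut p : SFun p →ₐ[ℝ] SFun p)
  σ_σ := parityAut_parityAut
  even_mul c f := by
    let _ : Ring (SF p) := (Algebra.TensorProduct.instRing : Ring (SFun p))
    let _ : Algebra ℝ (SF p) := (Algebra.TensorProduct.instAlgebra : Algebra ℝ (SFun p))
    let τ : SF p →ₐ[ℝ] SF p := (parityAut p : SFun p →ₐ[ℝ] SFun p)
    refine TensorProduct.induction_on (motive := fun c : SF p => (c + τ c) * f = f * (c + τ c)) c
      ?_ (fun c x => ?_) fun a b ha hb => add_supercomm_add τ ha hb
    · exact (by rw [map_zero, add_zero, zero_mul, mul_zero] :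
        ((0 : SF p) + τ 0) * f = f * (0 + τ 0))
    · refine Eq.trans ?_ ((SFun.even_mul_tmul c x f).trans ?_)
      · exact congrArg (· * f) (TensorProduct.tmul_add c x _).symm
      · exact congrArg (f * ·) (TensorProduct.tmul_add c x _)
  odd_mul c f := by
    let _ : Ring (SF p) := (Algebra.TensorProduct.instRing : Ring (SFun p))
    let _ : Algebra ℝ (SF p) := (Algebra.TensorProduct.instAlgebra : Algebra ℝ (SFun p))
    let τ : SF p →ₐ[ℝ] SF p := (parityAut p : SFun p →ₐ[ℝ] SFun p)
    refine TensorProduct.induction_on (motive := fun c : SF p => (c - τ c) * f = τ f * (c - τ c)) c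
      ?_ (fun c x => ?_) fun a b ha hb => sub_supercomm_add τ ha hb
    · exact (by rw [map_zero, sub_zero, zero_mul, mul_zero] :
        ((0 : SF p) - τ 0) * f = τ f * (0 - τ 0))
    · refine Eq.trans ?_ ((SFun.odd_mul_tmul c x f).trans ?_)
      · exact congrArg (· * f) (TensorProduct.tmul_sub c x _).symm
      · exact congrArg (τ f * ·) (TensorProduct.tmul_sub c x _)

instance instSuperAlgebra : SuperAlgebra (SF p) := superAlgebra p

/-- The product of an even function and an element of the Grassmann algebra. -/
def tmul (c : Cyl (EvenIdx p)) (x : Grassmann (OddIdx p)) : SF p := c ⊗ₜ[ℝ] x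

theorem induction {P : SF p → Prop} (f : SF p) (tmul : ∀ c x, P (tmul c x))
    (add : ∀ f g, P f → P g → P (f + g)) : P f := by
  refine TensorProduct.induction_on (motive := P) f ?_ tmul add
  have := tmul 0 0
  unfold SF.tmul at this
  rwa [TensorProduct.tmul_zero] at this

theorem tmul_mul_tmul (c d : Cyl (EvenIdx p)) (x y : Grassmann (OddIdx p)) :
    tmul c x * tmul d y = tmul (c * d) (x * y) := Algebra.TensorProduct.tmul_mul_tmul c d x y

theorem tmul_add (c : Cyl (EvenIdx p)) (x y : Grassmann (OddIdx p)) :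
    tmul c (x + y) = tmul c x + tmul c y := TensorProduct.tmul_add c x y

theorem add_tmul (c d : Cyl (EvenIdx p)) (x : Grassmann (OddIdx p)) :
    tmul (c + d) x = tmul c x + tmul d x := TensorProduct.add_tmul c d x

theorem tmul_smul (r : ℝ) (c : Cyl (EvenIdx p)) (x : Grassmann (OddIdx p)) :
    tmul c (r • x) = r • tmul c x := TensorProduct.tmul_smul r c x

theorem tmul_zero (c : Cyl (EvenIdx p)) : tmul c (0 : Grassmann (OddIdx p)) = 0 :=
  TensorProduct.tmul_zero _ c

theorem zero_tmul (x : Grassmann (OddIdx p)) : tmul (0 : Cyl (EvenIdx p)) x = 0 :=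
  TensorProduct.zero_tmul _ x

theorem tmul_neg (c : Cyl (EvenIdx p)) (x : Grassmann (OddIdx p)) :
    tmul c (-x) = -tmul c x := by
  rw [← neg_one_smul ℝ x, tmul_smul, neg_one_smul ℝ]

theorem σ_tmul (c : Cyl (EvenIdx p)) (x : Grassmann (OddIdx p)) :
    σ (tmul c x) = tmul c (Grassmann.invol _ x) := rfl

/-- The body of a superfunction: its part without odd coordinates. -/
def body (p : I → ZMod 2) : SF p →ₐ[ℝ] Cyl (EvenIdx p) :=
  (Algebra.TensorProduct.lift (AlgHom.id ℝ _)
    ((Algebra.ofId ℝ _).comp ExteriorAlgebra.algebraMapInv) fun _ _ => mul_comm _ _ :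
    SFun p →ₐ[ℝ] Cyl (EvenIdx p))

theorem body_tmul (c : Cyl (EvenIdx p)) (x : Grassmann (OddIdx p)) :
    body p (tmul c x) = c * algebraMap ℝ _ (ExteriorAlgebra.algebraMapInv x) := rfl

/-- The even functions as superfunctions. -/
def ofCyl (p : I → ZMod 2) : Cyl (EvenIdx p) →ₐ[ℝ] SF p :=
  (Algebra.TensorProduct.includeLeft : Cyl (EvenIdx p) →ₐ[ℝ] SFun p)

/-- The elements of the Grassmann algebra as superfunctions. -/
def ofGrassmann (p : I → ZMod 2) : Grassmann (OddIdx p) →ₐ[ℝ] SF p :=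
  (Algebra.TensorProduct.includeRight : Grassmann (OddIdx p) →ₐ[ℝ] SFun p)

theorem ofCyl_apply (c : Cyl (EvenIdx p)) : ofCyl p c = tmul c 1 := rfl

theorem ofGrassmann_apply (x : Grassmann (OddIdx p)) : ofGrassmann p x = tmul 1 x := rfl

theorem tmul_eq (c : Cyl (EvenIdx p)) (x : Grassmann (OddIdx p)) :
    tmul c x = ofCyl p c * ofGrassmann p x := by
  rw [ofCyl_apply, ofGrassmann_apply, tmul_mul_tmul, mul_one, one_mul]

instance instNontrivial : Nontrivial (SF p) := (body p).toRingHom.domain_nontrivial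

/-- The coordinate `i`. -/
def coord (p : I → ZMod 2) (i : I) : SF p := _root_.coord p i

/-- The partial derivative along the coordinate `i`. -/
def pderiv (p : I → ZMod 2) (i : I) : SF p →ₗ[ℝ] SF p :=
  (_root_.pderiv p i : SFun p →ₗ[ℝ] SFun p)

theorem coord_of_even {i : I} (h : p i = 0) :
    coord p i = ofCyl p (Cyl.coord (⟨i, h⟩ : EvenIdx p)) := dif_pos h

theorem coord_of_odd {i : I} (h : p i ≠ 0) :
    coord p i = ofGrassmann p (ExteriorAlgebra.ι ℝ (Finsupp.single (⟨i, h⟩ : OddIdx p) 1)) :=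
  dif_neg h

theorem isHomog_ofCyl (c : Cyl (EvenIdx p)) : IsHomog 0 (ofCyl p c) := by
  unfold IsHomog
  rw [ofCyl_apply, σ_tmul, map_one, sgn_zero, one_smul]

theorem isHomog_ι (m : OddIdx p →₀ ℝ) : IsHomog 1 (ofGrassmann p (ExteriorAlgebra.ι ℝ m)) := by
  unfold IsHomog
  rw [ofGrassmann_apply, σ_tmul, Grassmann.invol_ι, tmul_neg, sgn_one, neg_one_smul ℝ]

theorem isHomog_coord (i : I) : IsHomog (p i) (coord p i) := by
  by_cases h : p i = 0
  · rw [coord_of_even h, h]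
    exact isHomog_ofCyl _
  · rw [coord_of_odd h, (ZMod.two_cases _).resolve_left h]
    exact isHomog_ι _

theorem pderiv_of_even {i : I} (h : p i = 0) (c : Cyl (EvenIdx p)) (x : Grassmann (OddIdx p)) :
    pderiv p i (tmul c x) = tmul (Cyl.pderiv (⟨i, h⟩ : EvenIdx p) c) x := by
  unfold pderiv
  rw [_root_.pderiv, dif_pos h]; rfl

theorem pderiv_of_odd {i : I} (h : p i ≠ 0) (c : Cyl (EvenIdx p)) (x : Grassmann (OddIdx p)) :
    pderiv p i (tmul c x) = tmul c (Grassmann.contract (⟨i, h⟩ : OddIdx p) x) := by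
  unfold pderiv
  rw [_root_.pderiv, dif_neg h]; rfl

theorem isSDer_pderiv (i : I) : IsSDer (p i) (pderiv p i) where
  map_add := map_add _
  map_smul := map_smul _
  map_mul f g := by
    induction f using SF.induction with
    | tmul c x =>
      induction g using SF.induction with
      | tmul d y =>
        by_cases h : p i = 0
        · rw [h, signAut_zero, AlgHom.id_apply]
          simp only [tmul_mul_tmul, pderiv_of_even h, Cyl.pderiv_mul, add_tmul]
        · rw [(ZMod.two_cases _).resolve_left h, signAut_one]
          simp only [tmul_mul_tmul, pderiv_of_odd h, Grassmann.contract_mul, tmul_add, σ_tmul]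
      | add f g hf hg => simp only [mul_add, map_add, hf, hg]; abel
    | add a b ha hb => simp only [add_mul, map_add, ha, hb]; abel
  map_sigma f := by
    induction f using SF.induction with
    | tmul c x =>
      by_cases h : p i = 0
      · rw [h, pderiv_of_even h, σ_tmul, σ_tmul, pderiv_of_even h, sgn_zero, one_smul]
      · rw [(ZMod.two_cases _).resolve_left h, pderiv_of_odd h, σ_tmul, σ_tmul, pderiv_of_odd h,
          Grassmann.invol_contract, tmul_neg, sgn_one, neg_one_smul ℝ]
    | add a b ha hb => simp only [map_add, ha, hb, smul_add]

theorem pderiv_coord [DecidableEq I] (i j : I) :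
    pderiv p i (coord p j) = if i = j then 1 else 0 := by
  classical
  by_cases hi : p i = 0 <;> by_cases hj : p j = 0
  · rw [coord_of_even hj, ofCyl_apply, pderiv_of_even hi, Cyl.pderiv_coord]
    simp only [Subtype.mk.injEq]
    split
    · rfl
    · rw [zero_tmul]
  · rw [coord_of_odd hj, ofGrassmann_apply, pderiv_of_even hi, Cyl.pderiv_one, zero_tmul,
      if_neg (show ¬i = j from fun h => hj (h ▸ hi))]
  · rw [coord_of_even hj, ofCyl_apply, pderiv_of_odd hi, Grassmann.contract_one, tmul_zero,
      if_neg (show ¬i = j from fun h => hi (h ▸ hj))]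
  · rw [coord_of_odd hj, ofGrassmann_apply, pderiv_of_odd hi, Grassmann.contract_ι,
      Finsupp.single_apply]
    simp only [Subtype.mk.injEq, eq_comm (a := j)]
    split
    · rw [map_one]; rfl
    · rw [map_zero, tmul_zero]

/-- This makes the `finsum` in `vfield` a genuine sum; with infinite support it would silently be 0.
-/
theorem finite_support_pderiv (f : SF p) : {i | pderiv p i f ≠ 0}.Finite := by
  induction f using SF.induction with
  | tmul c x =>
    obtain ⟨F, hF⟩ := exists_dependsOnCoords c
    refine ((F.finite_toSet.image Subtype.val).union
      ((Grassmann.finite_support_contract x).image Subtype.val)).subset fun i hi => ?_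
    by_cases h : p i = 0
    · refine Or.inl ⟨⟨i, h⟩, ?_, rfl⟩
      by_contra h'
      exact hi (by rw [pderiv_of_even h, Cyl.pderiv_eq_zero hF h', zero_tmul])
    · refine Or.inr ⟨⟨i, h⟩, fun h' => hi ?_, rfl⟩
      rw [pderiv_of_odd h, h', tmul_zero]
  | add a b ha hb =>
    refine (ha.union hb).subset fun o ho => ?_
    by_contra h
    simp only [Set.mem_union, Set.mem_ofPred_eq, not_or, not_not] at h
    exact ho (by rw [map_add, h.1, h.2, add_zero])

/-- The vector field with components `c`. -/
def vfield (p : I → ZMod 2) (c : I → SF p) : SF p → SF p := _root_.vfield p c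

theorem vfield_eq_sum (c : I → SF p) {f : SF p} {s : Finset I}
    (hs : ∀ i ∉ s, pderiv p i f = 0) : vfield p c f = ∑ i ∈ s, c i * pderiv p i f := by
  refine finsum_eq_sum_of_support_subset (f := fun i => c i * pderiv p i f) fun i hi => ?_
  by_contra h
  exact hi (by simp only [hs i h, mul_zero])

theorem exists_support_pderiv (f : SF p) : ∃ s : Finset I, ∀ i ∉ s, pderiv p i f = 0 :=
  ⟨(finite_support_pderiv f).toFinset, fun i hi => by simpa using hi⟩

theorem isSDer_vfield {a : ZMod 2} {c : I → SF p} (hc : ∀ i, IsHomog (p i + a) (c i)) :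
    IsSDer a (vfield p c) where
  map_add f g := by
    classical
    obtain ⟨s, hs⟩ := exists_support_pderiv f
    obtain ⟨t, ht⟩ := exists_support_pderiv g
    rw [vfield_eq_sum (s := s ∪ t) c (f := f), vfield_eq_sum (s := s ∪ t) c (f := g),
      vfield_eq_sum (s := s ∪ t) c, ← Finset.sum_add_distrib]
    · simp only [map_add, mul_add]
    all_goals
      intro i hi
      rw [Finset.mem_union, not_or] at hi
      simp only [map_add, hs i hi.1, ht i hi.2, add_zero]
  map_smul r f := by
    obtain ⟨s, hs⟩ := exists_support_pderiv f
    rw [vfield_eq_sum c hs, vfield_eq_sum (s := s) c, Finset.smul_sum]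
    · simp only [map_smul, mul_smul_comm]
    · intro i hi
      rw [map_smul, hs i hi, smul_zero]
  map_mul f g := by
    classical
    obtain ⟨s, hs⟩ := exists_support_pderiv f
    obtain ⟨t, ht⟩ := exists_support_pderiv g
    rw [vfield_eq_sum (s := s ∪ t) c (f := f), vfield_eq_sum (s := s ∪ t) c (f := g),
      vfield_eq_sum (s := s ∪ t) c, Finset.mul_sum, Finset.sum_mul, ← Finset.sum_add_distrib]
    · refine Finset.sum_congr rfl fun i _ => ?_
      -- Moving c_i, of parity p i + a, past an f already twisted by p i leaves the total twist a.
      have h1 : c i * signAut (SF p) (p i) f = signAut (SF p) a f * c i := by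
        rw [(hc i).mul_eq, ← signAut_add, ZMod.add_add_self]
      rw [(isSDer_pderiv i).map_mul, mul_add, ← mul_assoc, ← mul_assoc, h1,
        mul_assoc (signAut _ a f)]
    all_goals
      intro i hi
      rw [Finset.mem_union, not_or] at hi
      simp only [(isSDer_pderiv i).map_mul, hs i hi.1, ht i hi.2, add_zero, zero_mul, mul_zero]
  map_sigma f := by
    obtain ⟨s, hs⟩ := exists_support_pderiv f
    have h1 : ∀ i, pderiv p i (σ f) = sgn (p i) • σ (pderiv p i f) := by
      intro i
      rw [(isSDer_pderiv i).map_sigma, smul_smul, sgn_mul_self, one_smul]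
    rw [vfield_eq_sum c hs, vfield_eq_sum (s := s) c, map_sum, Finset.smul_sum]
    · refine Finset.sum_congr rfl fun i _ => ?_
      have hc' : σ (c i) = sgn (p i + a) • c i := hc i
      rw [map_mul, hc', h1, sgn_add, mul_smul_comm, smul_mul_assoc, smul_smul, mul_comm (sgn a)]
    · intro i hi
      rw [h1, hs i hi, map_zero, smul_zero]

theorem vfield_coord (c : I → SF p) (i : I) : vfield p c (coord p i) = c i := by
  classical
  rw [vfield_eq_sum (s := {i}), Finset.sum_singleton, pderiv_coord, if_pos rfl, mul_one]
  intro j hj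
  rw [pderiv_coord, if_neg (by simpa using hj)]

end SF

/-! ### Derivations and homomorphisms are determined by the coordinates -/

section Grassmann

variable {O : Type u}

/-- The elements of degree at least `k` of the Grassmann algebra. -/
def Grassmann.DegGE (k : ℕ) (z : Grassmann O) : Prop :=
  ∀ d < k, (DirectSum.decompose (fun i : ℕ => ⋀[ℝ]^i (O →₀ ℝ)) z d : Grassmann O) = 0

theorem Grassmann.ι_mem (m : O →₀ ℝ) : (ExteriorAlgebra.ι ℝ m : Grassmann O) ∈ ⋀[ℝ]^1 (O →₀ ℝ) := by
  change _ ∈ LinearMap.range (ExteriorAlgebra.ι ℝ : (O →₀ ℝ) →ₗ[ℝ] Grassmann O) ^ 1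
  rw [pow_one]
  exact LinearMap.mem_range_self _ _

theorem Grassmann.DegGE.add {k : ℕ} {x y : Grassmann O} (hx : DegGE k x) (hy : DegGE k y) :
    DegGE k (x + y) := fun d hd => by
  rw [DirectSum.decompose_add, DirectSum.add_apply, Submodule.coe_add, hx d hd, hy d hd, add_zero]

theorem Grassmann.DegGE.smul {k : ℕ} {x : Grassmann O} (hx : DegGE k x) (r : ℝ) :
    DegGE k (r • x) := fun d hd => by
  rw [DirectSum.decompose_smul, DirectSum.smul_apply, Submodule.coe_smul, hx d hd, smul_zero]

theorem Grassmann.DegGE.ι_mul {k : ℕ} {x : Grassmann O} (hx : DegGE k x) (m : O →₀ ℝ) :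
    DegGE (k + 1) (ExteriorAlgebra.ι ℝ m * x) := fun d hd => by
  rcases d with _ | d
  · exact DirectSum.coe_decompose_mul_of_left_mem_of_not_le (b := x) _ (Grassmann.ι_mem m)
      (by omega)
  · rw [DirectSum.coe_decompose_mul_of_left_mem_of_le
      (fun i : ℕ => ⋀[ℝ]^i (O →₀ ℝ)) (Grassmann.ι_mem m) (Nat.le_add_left 1 d),
      Nat.add_sub_cancel, hx d (by omega), mul_zero]

theorem Grassmann.DegGE.mono {k l : ℕ} {x : Grassmann O} (hx : DegGE k x) (h : l ≤ k) :
    DegGE l x := fun d hd => hx d (hd.trans_le h)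

theorem Grassmann.DegGE.mul {k : ℕ} {x : Grassmann O} (hx : DegGE k x) (y : Grassmann O) :
    DegGE k (y * x) := by
  induction y using Grassmann.induction with
  | algebraMap r =>
    rw [← Algebra.smul_def]
    exact hx.smul r
  | add a b ha hb =>
    rw [add_mul]
    exact ha.add hb
  | ι_mul a m ha =>
    rw [mul_assoc]
    exact (ha.ι_mul m).mono (Nat.le_succ _)

/-- An element without scalar part is a sum of multiples of generators, so multiplying by it raises
the degree by at least one. This drives the iteration of Hadamard's lemma. -/
theorem Grassmann.DegGE.sub_mul {k : ℕ} {x : Grassmann O} (hx : DegGE k x) (y : Grassmann O) :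
    DegGE (k + 1) ((y - algebraMap ℝ _ (ExteriorAlgebra.algebraMapInv y)) * x) := by
  induction y using Grassmann.induction with
  | algebraMap r =>
    rw [ExteriorAlgebra.algebraMap_leftInverse, sub_self, zero_mul]
    intro d _
    rw [DirectSum.decompose_zero]
    rfl
  | add a b ha hb =>
    rw [map_add, map_add, add_sub_add_comm, add_mul]
    exact ha.add hb
  | ι_mul a m ha =>
    have : ExteriorAlgebra.algebraMapInv (ExteriorAlgebra.ι ℝ m : Grassmann O) = 0 := by
      simp [ExteriorAlgebra.algebraMapInv]
    rw [map_mul, this, zero_mul, map_zero, sub_zero, mul_assoc]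
    exact (hx.mul a).ι_mul m

theorem Grassmann.eq_zero_of_degGE {x : Grassmann O} (hx : ∀ k, DegGE k x) : x = 0 := by
  apply (DirectSum.decompose (fun i : ℕ => ⋀[ℝ]^i (O →₀ ℝ))).injective
  rw [DirectSum.decompose_zero]
  ext d
  rw [hx (d + 1) d (Nat.lt_succ_self d)]
  rfl

end Grassmann

namespace SF

open SuperAlgebra

variable {I : Type u} {p : I → ZMod 2} {J : Type v} {r : J → ZMod 2}

/-- The evaluation of the even coordinates at a point. -/
def evalAt (q : EvenIdx p → ℝ) : SF p →ₐ[ℝ] Grassmann (OddIdx p) :=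
  (Algebra.TensorProduct.lift
    ((Algebra.ofId ℝ _).comp ((Pi.evalAlgHom ℝ (fun _ => ℝ) q).comp (Cyl (EvenIdx p)).val))
    (AlgHom.id ℝ _) (fun f x => Algebra.commutes ((f : (EvenIdx p → ℝ) → ℝ) q) x) :
    SFun p →ₐ[ℝ] Grassmann (OddIdx p))

theorem evalAt_tmul (q : EvenIdx p → ℝ) (c : Cyl (EvenIdx p)) (x : Grassmann (OddIdx p)) :
    evalAt q (tmul c x) = (c : (EvenIdx p → ℝ) → ℝ) q • x := 
  (Algebra.smul_def ((c : (EvenIdx p → ℝ) → ℝ) q) x).symm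

/-- In a basis of the Grassmann algebra the coefficients of `f` are ordinary functions, and `evalAt
q` reads off their values at `q`. -/
theorem eq_zero_of_evalAt {f : SF p} (hf : ∀ q, evalAt q f = 0) : f = 0 := by
  classical
  let b := Module.Basis.ofVectorSpace ℝ (Grassmann (OddIdx p))
  let e : SFun p ≃ₗ[ℝ] _ := TensorProduct.equivFinsuppOfBasisRight (M := Cyl (EvenIdx p)) b
  have key : ∀ (f : SF p) q i, ((e f i : Cyl (EvenIdx p)) : (EvenIdx p → ℝ) → ℝ) q =
      b.repr (evalAt q f) i := by
    intro f q i
    induction f using SF.induction with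
    | tmul c x =>
      rw [evalAt_tmul, map_smul]
      have h := TensorProduct.equivFinsuppOfBasisRight_apply_tmul_apply (M := Cyl (EvenIdx p)) b c x i
      have h' : e (tmul c x) i = b.repr x i • c := h
      rw [h', Finsupp.smul_apply, smul_eq_mul, mul_comm]
      rfl
    | add f g hf hg =>
      have h' : e (f + g : SF p) = e f + e g := e.map_add f g
      rw [h', Finsupp.add_apply, map_add, map_add, Finsupp.add_apply, ← hf, ← hg]
      rfl
  have h0 : e f = 0 := by
    ext i q
    rw [key, hf, map_zero]
    rfl
  exact e.map_eq_zero_iff.1 h0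

/-- Expand f by Hadamard. The twisted Leibniz rule turns D f into a sum of h₁(x_e - a_e) D(G_e),
because D kills constants and the coordinates in `F`. Evaluated at a point, the first factor has no
scalar part, so each expansion gains one Grassmann degree, for every point and every degree. -/
theorem cyl_bider_eq_zero {E : Type w} (h₁ h₂ : Cyl E →ₐ[ℝ] SF r) (D : Cyl E →ₗ[ℝ] SF r)
    (hD : ∀ f g, D (f * g) = D f * h₂ g + h₁ f * D g) {F : Finset E}
    (hF : ∀ e ∈ F, D (Cyl.coord e) = 0) {f : Cyl E} (hf : DependsOnCoords F f) : D f = 0 := by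
  have hD1 : D 1 = 0 := by
    have := hD 1 1
    simpa using this
  have hDc : ∀ c : ℝ, D (algebraMap ℝ _ c) = 0 := by
    intro c
    rw [Algebra.algebraMap_eq_smul_one, map_smul, hD1, smul_zero]
  refine eq_zero_of_evalAt fun q => Grassmann.eq_zero_of_degGE fun k => ?_
  induction k generalizing f with
  | zero => exact fun d hd => absurd hd (Nat.not_lt_zero _)
  | succ k ih =>
    -- The base point is the body at `q` of the images under `h₁`, so that h₁(x_e - a_e) evaluated
    -- at `q` is nilpotent.
    obtain ⟨G, hG, hfG⟩ := hf.hadamard fun e =>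
      ExteriorAlgebra.algebraMapInv (evalAt q (h₁ (Cyl.coord e)))
    rw [hfG, map_add, hDc, zero_add, map_sum, map_sum]
    have hsum : ∀ s : Finset E, ∀ X : E → Grassmann (OddIdx r),
        (∀ e ∈ s, Grassmann.DegGE (k + 1) (X e)) → Grassmann.DegGE (k + 1) (∑ e ∈ s, X e) := by
      classical
      intro s X hX
      induction s using Finset.induction_on with
      | empty =>
        intro d _
        rw [Finset.sum_empty, DirectSum.decompose_zero]
        rfl
      | insert e s he ihs =>
        rw [Finset.sum_insert he]
        exact (hX e (Finset.mem_insert_self _ _)).add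
          (ihs fun e' he' => hX e' (Finset.mem_insert_of_mem he'))
    refine hsum _ _ fun e he => ?_
    rw [hD, map_sub, hF e he, hDc, sub_zero, zero_mul, zero_add, map_mul, map_sub, map_sub,
      AlgHom.commutes, AlgHom.commutes]
    exact (ih (hG e)).sub_mul _

/-- The Leibniz rule twisted by two homomorphisms covers both h₁ - h₂ and h ∘ D - D' ∘ h, so
uniqueness of homomorphisms and of derivations is proved once. -/
theorem bider_eq_zero (h₁ h₂ : SF p →ₐ[ℝ] SF r) (D : SF p →ₗ[ℝ] SF r)
    (hD : ∀ f g, D (f * g) = D f * h₂ g + h₁ f * D g)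
    (hc : ∀ i, D (coord p i) = 0) (f : SF p) : D f = 0 := by
  have hD1 : D 1 = 0 := by
    have := hD 1 1
    simpa using this
  induction f using SF.induction with
  | add f g hf hg => rw [map_add, hf, hg, add_zero]
  | tmul c x =>
    have h1 : D (ofCyl p c) = 0 := by
      obtain ⟨F, hF⟩ := exists_dependsOnCoords c
      refine cyl_bider_eq_zero (h₁.comp (ofCyl p)) (h₂.comp (ofCyl p))
        (D ∘ₗ (ofCyl p).toLinearMap) (fun f g => ?_) (fun e _ => ?_) hF
      · have := hD (ofCyl p f) (ofCyl p g)
        rw [← map_mul] at this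
        exact this
      · have := hc e
        rwa [coord_of_even e.2] at this
    have h2 : ∀ m, D (ofGrassmann p (ExteriorAlgebra.ι ℝ m)) = 0 := by
      intro m
      induction m using Finsupp.induction_linear with
      | zero => simp only [map_zero]
      | add a b ha hb => simp only [map_add, ha, hb, add_zero]
      | single o t =>
        have h3 := hc o
        rw [coord_of_odd o.2] at h3
        rw [← mul_one t, ← smul_eq_mul, ← Finsupp.smul_single, map_smul, map_smul, map_smul]
        exact (congrArg (t • ·) h3).trans (smul_zero t)
    have h3 : D (ofGrassmann p x) = 0 := by
      induction x using Grassmann.induction with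
      | algebraMap t =>
        rw [AlgHom.commutes, Algebra.algebraMap_eq_smul_one, map_smul, hD1, smul_zero]
      | add a b ha hb => simp only [map_add, ha, hb, add_zero]
      | ι_mul a m ha => rw [map_mul, hD, ha, h2, zero_mul, mul_zero, add_zero]
    rw [tmul_eq, hD, h1, h3, zero_mul, mul_zero, add_zero]

theorem hom_ext {h₁ h₂ : SF p →ₐ[ℝ] SF r} (h : ∀ i, h₁ (coord p i) = h₂ (coord p i)) :
    h₁ = h₂ := by
  ext f
  refine sub_eq_zero.1 (bider_eq_zero h₁ h₂ (h₁.toLinearMap - h₂.toLinearMap) (fun f g => ?_)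
    (fun i => ?_) f)
  · simp only [LinearMap.sub_apply, AlgHom.toLinearMap_apply, map_mul]
    noncomm_ring
  · exact sub_eq_zero.2 (h i)

theorem σ_coord (i : I) : σ (coord p i) = sgn (p i) • coord p i := isHomog_coord i

theorem hom_σ {h : SF p →ₐ[ℝ] SF r} (hh : ∀ i, IsHomog (p i) (h (coord p i))) (f : SF p) :
    h (σ f) = σ (h f) := by
  have : h.comp σ = (σ : SF r →ₐ[ℝ] SF r).comp h := by
    refine hom_ext fun i => ?_
    rw [AlgHom.comp_apply, AlgHom.comp_apply, σ_coord, map_smul]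
    exact (hh i).symm
  exact DFunLike.congr_fun this f

theorem signAut_comm {h : SF p →ₐ[ℝ] SF r} (hh : ∀ f, h (σ f) = σ (h f)) (a : ZMod 2)
    (f : SF p) : h (signAut _ a f) = signAut _ a (h f) := by
  obtain rfl | rfl := ZMod.two_cases a
  · simp
  · simpa using hh f

/-- Graded derivations related by a homomorphism on coordinates are related by it. -/
theorem map_eq {a : ZMod 2} {D : SF p → SF p} {D' : SF r → SF r} (hD : IsSDer a D)
    (hD' : IsSDer a D') {h : SF p →ₐ[ℝ] SF r} (hh : ∀ f, h (σ f) = σ (h f))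
    (hc : ∀ i, h (D (coord p i)) = D' (h (coord p i))) (f : SF p) : h (D f) = D' (h f) := by
  refine sub_eq_zero.1 (bider_eq_zero (h.comp (signAut _ a)) h
    { toFun := fun f => h (D f) - D' (h f)
      map_add' := fun f g => ?_
      map_smul' := fun t f => ?_ } (fun f g => ?_) (fun i => sub_eq_zero.2 (hc i)) f)
  · simp only [hD.map_add, hD'.map_add, map_add]
    abel
  · simp only [hD.map_smul, hD'.map_smul, map_smul, smul_sub, RingHom.id_apply]
  · simp only [LinearMap.coe_mk, AddHom.coe_mk, AlgHom.comp_apply, hD.map_mul, hD'.map_mul, map_mul,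
      map_add, signAut_comm hh]
    noncomm_ring

theorem der_ext {a : ZMod 2} {D D' : SF p → SF p} (hD : IsSDer a D) (hD' : IsSDer a D')
    (hc : ∀ i, D (coord p i) = D' (coord p i)) (f : SF p) : D f = D' f :=
  map_eq hD hD' (h := AlgHom.id ℝ _) (fun _ => rfl) hc f

theorem graded_comm {a b : ZMod 2} {D D' : SF p → SF p} (hD : IsSDer a D)
    (hD' : IsSDer b D') (hc : ∀ i, D (D' (coord p i)) = sgn (a * b) • D' (D (coord p i)))
    (f : SF p) : D (D' f) = sgn (a * b) • D' (D f) :=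
  sub_eq_zero.1 (der_ext (hD.commutator hD') IsSDer.zero (fun i => sub_eq_zero.2 (hc i)) f)

/-! ### Substitutions -/

/-- Composition of even functions. -/
def cylComp {E : Type v} {E' : Type w} (b : E → Cyl E') : Cyl E →ₐ[ℝ] Cyl E' where
  toFun f := ⟨fun q => (f : (E → ℝ) → ℝ) fun e => (b e : (E' → ℝ) → ℝ) q, by
    obtain ⟨f, F, g, hg, hf⟩ := f
    simp only [hf]
    exact IsCyl.comp hg fun k : F => (b k).2⟩
  map_one' := rfl
  map_mul' _ _ := rfl
  map_zero' := rfl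
  map_add' _ _ := rfl
  commutes' _ := rfl

/-- `y` can be added to the image of any coordinate. -/
def IsShift {E : Type w} (y : SF r) : Prop :=
  ∀ (h : Cyl E →ₐ[ℝ] SF r) (_ : ∀ f g, h f * g = g * h f) (e : E),
    ∃ h' : Cyl E →ₐ[ℝ] SF r, (∀ f g, h' f * g = g * h' f) ∧
      h' (Cyl.coord e) = h (Cyl.coord e) + y ∧ ∀ e' ≠ e, h' (Cyl.coord e') = h (Cyl.coord e')

theorem IsShift.zero {E : Type w} : IsShift (E := E) (0 : SF r) :=
  fun h hh _ => ⟨h, hh, (add_zero _).symm, fun _ _ => rfl⟩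

theorem IsShift.add {E : Type w} {y z : SF r} (hy : IsShift (E := E) y) (hz : IsShift (E := E) z) :
    IsShift (E := E) (y + z) := by
  intro h hh e
  obtain ⟨h₁, hh₁, h₁e, h₁'⟩ := hy h hh e
  obtain ⟨h₂, hh₂, h₂e, h₂'⟩ := hz h₁ hh₁ e
  exact ⟨h₂, hh₂, by rw [h₂e, h₁e, add_assoc], fun e' he' => by rw [h₂' e' he', h₁' e' he']⟩

/-- When y² = 0 the Taylor series in y stops at first order: f ↦ h f + y h(∂_e f) is already
multiplicative. -/
theorem IsShift.of_sq {E : Type w} {y : SF r} (hy : IsHomog 0 y) (hyy : y * y = 0) :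
    IsShift (E := E) y := by
  classical
  intro h hh e
  refine ⟨AlgHom.ofLinearMap (h.toLinearMap + LinearMap.mulLeft ℝ y ∘ₗ h.toLinearMap ∘ₗ
    Cyl.pderiv e) ?_ ?_, ?_, ?_, ?_⟩
  · simp [Cyl.pderiv_one]
  · intro f g
    simp only [LinearMap.add_apply, AlgHom.toLinearMap_apply, LinearMap.comp_apply,
      LinearMap.mulLeft_apply, Cyl.pderiv_mul, map_add, map_mul]
    have h1 : y * h (Cyl.pderiv e f) * (y * h (Cyl.pderiv e g)) = 0 := by
      rw [mul_assoc, ← mul_assoc (h _), ← hy.comm (h _), mul_assoc, ← mul_assoc y, hyy, zero_mul]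
    have h2 : h f * (y * h (Cyl.pderiv e g)) = y * (h f * h (Cyl.pderiv e g)) := by
      rw [← mul_assoc, ← hy.comm, mul_assoc]
    rw [add_mul, mul_add (h f), mul_add (y * _), h1, h2, add_zero, mul_assoc y]
    abel
  · intro f g
    simp only [AlgHom.ofLinearMap_apply, LinearMap.add_apply, AlgHom.toLinearMap_apply,
      LinearMap.comp_apply, LinearMap.mulLeft_apply]
    rw [add_mul, mul_add, hh, mul_assoc, hh, ← mul_assoc, hy.comm, mul_assoc]
  · simp [Cyl.pderiv_coord]
  · intro e' he'
    simp [Cyl.pderiv_coord, he'.symm]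

/-- The element is twice the nilpotent even part of `c`. It is a sum of terms of the form `tmul c (ι
m * (a - invol a))`, which are even and square to zero because ι m does, and shifts can be performed
successively. -/
theorem isShift_nil {E : Type w} (c : SF r) :
    IsShift (E := E) (c + σ c - (2 : ℝ) • ofCyl r (body r c)) := by
  have hadd : ∀ a b : SF r, IsShift (E := E) (a + σ a - (2 : ℝ) • ofCyl r (body r a)) →
      IsShift (E := E) (b + σ b - (2 : ℝ) • ofCyl r (body r b)) →
      IsShift (E := E) (a + b + σ (a + b) - (2 : ℝ) • ofCyl r (body r (a + b))) := by
    intro a b ha hb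
    have := ha.add hb
    convert this using 1
    simp only [map_add, smul_add]
    abel
  induction c using SF.induction with
  | add a b ha hb => exact hadd a b ha hb
  | tmul c x =>
    induction x using Grassmann.induction with
    | algebraMap t =>
      have h1 : ∀ t : ℝ, tmul c (algebraMap ℝ _ t) = t • ofCyl r c := by
        intro t
        rw [Algebra.algebraMap_eq_smul_one, tmul_smul, ofCyl_apply]
      have : tmul c (algebraMap ℝ _ t) + σ (tmul c (algebraMap ℝ _ t)) -
          (2 : ℝ) • ofCyl r (body r (tmul c (algebraMap ℝ _ t))) = (0 : SF r) := by
        rw [σ_tmul, AlgHom.commutes, body_tmul, ExteriorAlgebra.algebraMap_leftInverse, h1,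
          mul_comm, ← Algebra.smul_def, map_smul, two_smul, sub_self]
      rw [this]
      exact IsShift.zero
    | add a b ha hb =>
      rw [tmul_add]
      exact hadd _ _ ha hb
    | ι_mul a m ha =>
      have h0 : ExteriorAlgebra.algebraMapInv (ExteriorAlgebra.ι ℝ m : Grassmann (OddIdx r)) = 0 := by
        simp [ExteriorAlgebra.algebraMapInv]
      have h1 : tmul c (ExteriorAlgebra.ι ℝ m * a) + σ (tmul c (ExteriorAlgebra.ι ℝ m * a)) -
          (2 : ℝ) • ofCyl r (body r (tmul c (ExteriorAlgebra.ι ℝ m * a))) =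
          tmul c (ExteriorAlgebra.ι ℝ m * (a - Grassmann.invol _ a)) := by
        rw [body_tmul, map_mul ExteriorAlgebra.algebraMapInv, h0, zero_mul, map_zero, mul_zero, map_zero, smul_zero, sub_zero,
          σ_tmul, map_mul, Grassmann.invol_ι, ← tmul_add, mul_sub, neg_mul, ← sub_eq_add_neg]
      rw [h1]
      refine IsShift.of_sq ?_ ?_
      · unfold IsHomog
        rw [σ_tmul, map_mul, map_sub, Grassmann.invol_invol, Grassmann.invol_ι, neg_mul, ← mul_neg,
          neg_sub, sgn_zero, one_smul]
      · rw [tmul_mul_tmul, mul_assoc, ← mul_assoc _ (ExteriorAlgebra.ι ℝ m), Grassmann.mul_ι,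
          mul_assoc, ← mul_assoc (ExteriorAlgebra.ι ℝ m), ExteriorAlgebra.ι_sq_zero, zero_mul,
          tmul_zero]

theorem exists_cyl_hom_finset {E : Type w} (β : E → SF r) (hβ : ∀ e, IsHomog 0 (β e))
    (F : Finset E) : ∃ h : Cyl E →ₐ[ℝ] SF r, (∀ f g, h f * g = g * h f) ∧
      ∀ e ∈ F, h (Cyl.coord e) = β e := by
  classical
  -- Strengthened for the induction: coordinates not yet treated are sent to the bodies of their
  -- intended images, so that adding the nilpotent part completes them.
  suffices H : ∃ h : Cyl E →ₐ[ℝ] SF r, (∀ f g, h f * g = g * h f) ∧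
      (∀ e ∈ F, h (Cyl.coord e) = β e) ∧
      ∀ e ∉ F, h (Cyl.coord e) = ofCyl r (body r (β e)) by
    obtain ⟨h, h1, h2, -⟩ := H
    exact ⟨h, h1, h2⟩
  induction F using Finset.induction_on with
  | empty =>
    refine ⟨(ofCyl r).comp (cylComp fun e => body r (β e)),
      fun f g => (isHomog_ofCyl _).comm g, by simp, fun e _ => rfl⟩
  | insert e F he ih =>
    obtain ⟨h, h1, h2, h3⟩ := ih
    -- With c = β e / 2 and β e even, the shift c + σ c - 2 body c is exactly β e minus its body.
    obtain ⟨h', h1', h2', h3'⟩ := isShift_nil ((1 / 2 : ℝ) • β e) h h1 e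
    refine ⟨h', h1', fun e' he' => ?_, fun e' he' => ?_⟩
    · obtain rfl | hne := eq_or_ne e' e
      · have hσ : σ (β e') = β e' := by simpa using show σ (β e') = sgn 0 • β e' from hβ e'
        rw [h2', h3 e' he, map_smul, map_smul, map_smul, hσ, ← add_smul, smul_smul]
        norm_num
      · rw [h3' e' hne, h2 e' (Finset.mem_of_mem_insert_of_ne he' hne)]
    · rw [Finset.mem_insert, not_or] at he'
      rw [h3' e' he'.1, h3 e' he'.2]

/-- Nilpotent parts are added one coordinate at a time, which reaches only finite sets. By
uniqueness the homomorphisms for different finite sets agree on every function that depends on both,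
and each function depends on some finite set, so they glue. -/
theorem exists_cyl_hom {E : Type w} (β : E → SF r) (hβ : ∀ e, IsHomog 0 (β e)) :
    ∃ h : Cyl E →ₐ[ℝ] SF r, (∀ f g, h f * g = g * h f) ∧ ∀ e, h (Cyl.coord e) = β e := by
  classical
  choose h hcomm hcoord using exists_cyl_hom_finset β hβ
  choose F hF using exists_dependsOnCoords (E := E)
  have hmono : ∀ (G G' : Finset E) (f : Cyl E), DependsOnCoords G f → G ⊆ G' →
      h G f = h G' f := by
    intro G G' f hf hGG'
    refine sub_eq_zero.1 (cyl_bider_eq_zero (h G) (h G') ((h G).toLinearMap - (h G').toLinearMap)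
      (fun f g => ?_) (fun e he => ?_) hf)
    · simp only [LinearMap.sub_apply, AlgHom.toLinearMap_apply, map_mul]
      noncomm_ring
    · exact sub_eq_zero.2 (by
        rw [AlgHom.toLinearMap_apply, AlgHom.toLinearMap_apply, hcoord _ _ he,
          hcoord _ _ (hGG' he)])
  have heq : ∀ (G : Finset E) (f : Cyl E), DependsOnCoords G f → h (F f) f = h G f := by
    intro G f hf
    rw [hmono _ (F f ∪ G) f (hF f) Finset.subset_union_left,
      hmono _ (F f ∪ G) f hf Finset.subset_union_right]
  have hun : ∀ f g : Cyl E, DependsOnCoords (F f ∪ F g) f ∧ DependsOnCoords (F f ∪ F g) g :=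
    fun f g => ⟨(hF f).mono Finset.subset_union_left, (hF g).mono Finset.subset_union_right⟩
  have hop : ∀ f g k : Cyl E, ∃ G, h (F f) f = h G f ∧ h (F g) g = h G g ∧ h (F k) k = h G k :=
    fun f g k => ⟨F f ∪ F g ∪ F k,
      heq _ _ ((hF f).mono (Finset.subset_union_left.trans Finset.subset_union_left)),
      heq _ _ ((hF g).mono (Finset.subset_union_right.trans Finset.subset_union_left)),
      heq _ _ ((hF k).mono Finset.subset_union_right)⟩
  refine ⟨{ toFun := fun f => h (F f) f
            map_one' := map_one _
            map_zero' := map_zero _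
            map_mul' := fun f g => ?_
            map_add' := fun f g => ?_
            commutes' := fun t => AlgHom.commutes _ _ }, fun f g => hcomm _ _ _, fun e => ?_⟩
  · obtain ⟨G, h1, h2, h3⟩ := hop f g (f * g)
    rw [h1, h2, h3, map_mul]
  · obtain ⟨G, h1, h2, h3⟩ := hop f g (f + g)
    rw [h1, h2, h3, map_add]
  · refine (heq {e} (Cyl.coord e) ⟨fun r => r ⟨e, Finset.mem_singleton_self e⟩,
      contDiff_apply ℝ ℝ _, fun _ => rfl⟩).trans (hcoord _ _ (Finset.mem_singleton_self e))

theorem mul_self {f : SF r} (hf : IsHomog 1 f) : f * f = 0 := by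
  have hσ : σ f = -f := by simpa using show σ f = sgn 1 • f from hf
  have h1 := hf.mul_eq f
  rw [signAut_one, hσ, neg_mul, eq_neg_iff_add_eq_zero, ← two_smul ℝ] at h1
  exact (smul_eq_zero.1 h1).resolve_left two_ne_zero

/-- Existence of substitutions. -/
theorem exists_hom (β : I → SF r) (hβ : ∀ i, IsHomog (p i) (β i)) :
    ∃ h : SF p →ₐ[ℝ] SF r, ∀ i, h (coord p i) = β i := by
  obtain ⟨H, hcomm, hH⟩ := exists_cyl_hom (fun e : EvenIdx p => β e) fun e => by
    have := hβ e
    rwa [e.2] at this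
  have hodd : ∀ m : OddIdx p →₀ ℝ,
      IsHomog 1 (Finsupp.linearCombination ℝ (fun o : OddIdx p => β o) m) := by
    intro m
    rw [Finsupp.linearCombination_apply]
    refine IsHomog.sum fun o _ => IsHomog.smul ?_ _
    have := hβ o
    rwa [(ZMod.two_cases _).resolve_left o.2] at this
  -- Odd elements square to zero, so the prescribed images of the odd coordinates extend to the
  -- exterior algebra.
  let K : Grassmann (OddIdx p) →ₐ[ℝ] SF r := ExteriorAlgebra.lift ℝ
    ⟨Finsupp.linearCombination ℝ fun o : OddIdx p => β o, fun m => mul_self (hodd m)⟩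
  let L : SFun p →ₐ[ℝ] SF r := Algebra.TensorProduct.lift H K fun f g => hcomm f (K g)
  refine ⟨(L : SF p →ₐ[ℝ] SF r), fun i => ?_⟩
  by_cases hi : p i = 0
  · rw [coord_of_even hi]
    have : L (Cyl.coord (⟨i, hi⟩ : EvenIdx p) ⊗ₜ 1) = H _ * K 1 :=
      Algebra.TensorProduct.lift_tmul _ _ _ _ _
    refine this.trans ?_
    rw [map_one, mul_one, hH]
  · rw [coord_of_odd hi]
    have : L (1 ⊗ₜ ExteriorAlgebra.ι ℝ (Finsupp.single (⟨i, hi⟩ : OddIdx p) 1)) = H 1 * K _ :=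
      Algebra.TensorProduct.lift_tmul _ _ _ _ _
    refine this.trans ?_
    rw [map_one, one_mul, ExteriorAlgebra.lift_ι_apply, Finsupp.linearCombination_single, one_smul]

/-- The substitution of `β i` for the coordinate `i`. -/
def subst (β : I → SF r) (hβ : ∀ i, IsHomog (p i) (β i)) : SF p →ₐ[ℝ] SF r :=
  (exists_hom β hβ).choose

theorem subst_coord (β : I → SF r) (hβ : ∀ i, IsHomog (p i) (β i)) (i : I) :
    subst β hβ (coord p i) = β i := (exists_hom β hβ).choose_spec i

theorem subst_σ (β : I → SF r) (hβ : ∀ i, IsHomog (p i) (β i)) (f : SF p) :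
    subst β hβ (σ f) = σ (subst β hβ f) :=
  hom_σ (fun i => by rw [subst_coord]; exact hβ i) f

end SF

/-! ### Iterated derivatives -/

section Iterate

variable {n : ℕ} {X : Type u} {Y : Type v}

theorem map_iterSym {D : Fin n → X → X} {D' : Fin n → Y → Y} {h : X → Y}
    (hD : ∀ μ f, h (D μ f) = D' μ (h f)) (m : Fin n → ℕ) (f : X) :
    h (iterSym D m f) = iterSym D' m (h f) := by
  unfold iterSym
  induction List.finRange n with
  | nil => rfl
  | cons μ l ih =>
    rw [List.foldr_cons, List.foldr_cons, ← ih]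
    exact (Function.Semiconj.iterate_right (f := h) (hD μ) (m μ)) _

theorem iterSym_zero (D : Fin n → X → X) (f : X) : iterSym D 0 f = f := by
  unfold iterSym
  induction List.finRange n with
  | nil => rfl
  | cons μ l ih => rw [List.foldr_cons, ih]; rfl

theorem iterSym_induction {P : X → Prop} {D : Fin n → X → X} (hD : ∀ μ f, P f → P (D μ f))
    (m : Fin n → ℕ) {f : X} (hf : P f) : P (iterSym D m f) := by
  unfold iterSym
  induction List.finRange n with
  | nil => exact hf
  | cons μ l ih =>
    rw [List.foldr_cons]
    generalize m μ = k
    induction k with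
    | zero => exact ih
    | succ k ihk =>
      rw [Function.iterate_succ_apply']
      exact hD μ _ ihk

theorem iterSym_add_single {D : Fin n → X → X} (hD : ∀ μ ν f, D μ (D ν f) = D ν (D μ f))
    (m : Fin n → ℕ) (μ : Fin n) (f : X) :
    iterSym D (m + Pi.single μ 1) f = D μ (iterSym D m f) := by
  -- In a list without repetitions μ occurs at most once, so the extra derivative appears once and
  -- commutes to the front.
  have key : ∀ l : List (Fin n), l.Nodup →
      l.foldr (fun ν g => (D ν)^[(m + Pi.single μ 1 : Fin n → ℕ) ν] g) f =
        if μ ∈ l then D μ (l.foldr (fun ν g => (D ν)^[m ν] g) f)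
        else l.foldr (fun ν g => (D ν)^[m ν] g) f := by
    intro l hl
    induction l with
    | nil => rfl
    | cons ν l ih =>
      rw [List.nodup_cons] at hl
      rw [List.foldr_cons, List.foldr_cons, ih hl.2]
      obtain rfl | hne := eq_or_ne μ ν
      · rw [if_neg hl.1, if_pos List.mem_cons_self, Pi.add_apply, Pi.single_eq_same,
          Function.iterate_succ_apply']
      · rw [Pi.add_apply, Pi.single_eq_of_ne hne.symm, add_zero]
        by_cases hμ : μ ∈ l
        · rw [if_pos hμ, if_pos (List.mem_cons_of_mem _ hμ)]
          exact ((Function.Semiconj.iterate_right (f := D μ) (hD μ ν) (m ν)) _).symm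
        · rw [if_neg hμ, if_neg (by simp [hne, hμ])]
  have := key (List.finRange n) (List.nodup_finRange n)
  rwa [if_pos (List.mem_finRange μ)] at this

theorem iterSkew_empty (D : Fin n → X → X) (f : X) : iterSkew D ∅ f = f := by
  simp [iterSkew]

theorem iterSkew_insert (D : Fin n → X → X) {a : Fin n} {N : Finset (Fin n)}
    (ha : ∀ b ∈ N, a < b) (f : X) : iterSkew D (insert a N) f = D a (iterSkew D N f) := by
  unfold iterSkew
  rw [Finset.sort_insert (r := (· ≤ ·)) (fun b hb => (ha b hb).le)
    fun h => lt_irrefl _ (ha a h), List.foldr_cons]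

theorem map_iterSkew {D : Fin n → X → X} {D' : Fin n → Y → Y} {h : X → Y}
    (hD : ∀ μ f, h (D μ f) = D' μ (h f)) (N : Finset (Fin n)) (f : X) :
    h (iterSkew D N f) = iterSkew D' N (h f) := by
  unfold iterSkew
  induction N.sort (· ≤ ·) with
  | nil => rfl
  | cons μ l ih => rw [List.foldr_cons, List.foldr_cons, ← ih, hD]

theorem moveSign_of_lt {ν : Fin n} {N : Finset (Fin n)} (h : ∀ b ∈ N, ν < b) :
    BRSTTheory.moveSign ν N = 1 := by
  rw [BRSTTheory.moveSign, Finset.filter_eq_empty_iff.2 fun b hb => not_lt.2 (h b hb).le,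
    Finset.card_empty, pow_zero]

theorem moveSign_insert {ν a : Fin n} {N : Finset (Fin n)} (ha : a ∉ N) :
    BRSTTheory.moveSign ν (insert a N) =
      if a < ν then -BRSTTheory.moveSign ν N else BRSTTheory.moveSign ν N := by
  unfold BRSTTheory.moveSign
  rw [Finset.filter_insert]
  split
  · rw [Finset.card_insert_of_notMem fun h => ha (Finset.mem_filter.1 h).1, pow_succ, mul_neg_one]
  · rfl

section Linear

variable [AddCommGroup X] [Module ℝ X]

theorem IsLinearMap.comp' {f g : X → X} (hf : IsLinearMap ℝ f) (hg : IsLinearMap ℝ g) :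
    IsLinearMap ℝ fun x => f (g x) :=
  (hf.mk' f ∘ₗ hg.mk' g).isLinear

theorem IsLinearMap.map_sum' {f : X → X} (hf : IsLinearMap ℝ f) {κ : Type*} (s : Finset κ)
    (g : κ → X) : f (∑ k ∈ s, g k) = ∑ k ∈ s, f (g k) :=
  _root_.map_sum (hf.mk' f) g s

theorem isLinearMap_iterSym {D : Fin n → X → X} (hD : ∀ μ, IsLinearMap ℝ (D μ))
    (m : Fin n → ℕ) : IsLinearMap ℝ (iterSym D m) := by
  unfold iterSym
  induction List.finRange n with
  | nil => exact LinearMap.id.isLinear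
  | cons μ l ih =>
    refine IsLinearMap.comp' (f := (D μ)^[m μ]) ?_ ih
    generalize m μ = k
    induction k with
    | zero => exact LinearMap.id.isLinear
    | succ k ihk => exact ihk.comp' (hD μ)

theorem isLinearMap_iterSkew {D : Fin n → X → X} (hD : ∀ μ, IsLinearMap ℝ (D μ))
    (N : Finset (Fin n)) : IsLinearMap ℝ (iterSkew D N) := by
  unfold iterSkew
  induction N.sort (· ≤ ·) with
  | nil => exact LinearMap.id.isLinear
  | cons μ l ih => exact (hD μ).comp' ih

/-- Moving D_ν to its place in increasing order past the smaller indices produces `moveSign`; if ν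
already occurs, it meets itself and D_ν² = 0. -/
theorem apply_iterSkew {D : Fin n → X → X} (hD : ∀ μ, IsLinearMap ℝ (D μ))
    (hanti : ∀ μ ν f, D μ (D ν f) = -D ν (D μ f)) (ν : Fin n) (N : Finset (Fin n)) (f : X) :
    D ν (iterSkew D N f) =
      if ν ∈ N then 0 else BRSTTheory.moveSign ν N • iterSkew D (insert ν N) f := by
  have hsq : ∀ f, D ν (D ν f) = 0 := fun f => by
    have h := hanti ν ν f
    rw [eq_neg_iff_add_eq_zero, ← two_smul ℝ] at h
    exact (smul_eq_zero.1 h).resolve_left two_ne_zero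
  induction N using Finset.induction_on_min with
  | empty =>
    have hν : ∀ b ∈ (∅ : Finset (Fin n)), ν < b := by simp
    rw [if_neg (Finset.notMem_empty ν), moveSign_of_lt hν, one_smul, iterSkew_insert D hν]
  | insert a N ha ih =>
    have haN : a ∉ N := fun h => lt_irrefl _ (ha a h)
    rw [iterSkew_insert D ha]
    obtain hlt | rfl | hlt := lt_trichotomy ν a
    · have hν : ∀ b ∈ insert a N, ν < b := by
        intro b hb
        obtain rfl | hb := Finset.mem_insert.1 hb
        · exact hlt
        · exact hlt.trans (ha b hb)
      rw [if_neg fun h => lt_irrefl _ (hν ν h), iterSkew_insert D hν, iterSkew_insert D ha,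
        moveSign_of_lt hν, one_smul]
    · rw [if_pos (Finset.mem_insert_self _ _), hsq]
    · rw [hanti, ih, moveSign_insert haN, if_pos hlt]
      by_cases hν : ν ∈ N
      · rw [if_pos hν, if_pos (Finset.mem_insert_of_mem hν), (hD a).map_zero, neg_zero]
      · rw [if_neg hν, if_neg (by simp [hν, hlt.ne']), (hD a).map_smul, Finset.insert_comm,
          iterSkew_insert D (N := insert ν N), neg_smul]
        intro b hb
        obtain rfl | hb := Finset.mem_insert.1 hb
        · exact hlt
        · exact ha b hb

end Linear

end Iterate

/-! ### Superfunctions of `x`, `θ` and `z` -/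

namespace SF

open SuperAlgebra

variable {I : Type u} {p : I → ZMod 2} {J : Type v} {r : J → ZMod 2}

/-- The substitution of coordinates for coordinates. -/
def substCoord (m : J → Option I) (hm : ∀ j i, m j = some i → p i = r j) : SF r →ₐ[ℝ] SF p :=
  (_root_.substCoord m hm : SFun r →ₐ[ℝ] SFun p)

theorem substCoord_of_none {m : J → Option I} (hm : ∀ j i, m j = some i → p i = r j) {j : J}
    (h : m j = none) : substCoord m hm (coord r j) = 0 := by
  by_cases hj : r j = 0
  · have h1 : ∀ q, pullPoint m hm q ⟨j, hj⟩ = 0 := by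
      intro q
      unfold pullPoint
      split
      · rfl
      · rename_i i h'
        exact absurd (h.symm.trans h') (by simp)
    rw [coord_of_even hj]
    refine Eq.trans ?_ (zero_tmul 1)
    refine (Algebra.TensorProduct.map_tmul _ _ _ _).trans ?_
    rw [map_one]
    refine congrArg (fun c => tmul c 1) (Subtype.ext (funext h1))
  · have h1 : pullOdd m hm ⟨j, hj⟩ = 0 := by
      unfold pullOdd
      split
      · rfl
      · rename_i i h'
        exact absurd (h.symm.trans h') (by simp)
    rw [coord_of_odd hj]
    refine Eq.trans ?_ (tmul_zero 1)
    refine (Algebra.TensorProduct.map_tmul _ _ _ _).trans ?_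
    rw [map_one, ExteriorAlgebra.map_apply_ι, Finsupp.linearCombination_single, h1, smul_zero,
      map_zero]
    rfl

theorem substCoord_of_some {m : J → Option I} (hm : ∀ j i, m j = some i → p i = r j) {j : J}
    {i : I} (h : m j = some i) : substCoord m hm (coord r j) = coord p i := by
  by_cases hj : r j = 0
  · have hi : p i = 0 := (hm j i h).trans hj
    have h1 : ∀ q, pullPoint m hm q ⟨j, hj⟩ = q ⟨i, hi⟩ := by
      intro q
      unfold pullPoint
      split
      · rename_i h'
        exact absurd (h.symm.trans h') (by simp)
      · rename_i i' h'
        obtain rfl : i = i' := Option.some.inj (h.symm.trans h')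
        rfl
    rw [coord_of_even hj, coord_of_even hi]
    refine (Algebra.TensorProduct.map_tmul _ _ _ _).trans ?_
    rw [map_one]
    refine congrArg (fun c => tmul c 1) (Subtype.ext (funext h1))
  · have hi : p i ≠ 0 := fun h' => hj ((hm j i h).symm.trans h')
    have h1 : pullOdd m hm ⟨j, hj⟩ = Finsupp.single ⟨i, hi⟩ 1 := by
      unfold pullOdd
      split
      · rename_i h'
        exact absurd (h.symm.trans h') (by simp)
      · rename_i i' h'
        obtain rfl : i = i' := Option.some.inj (h.symm.trans h')
        rfl
    rw [coord_of_odd hj, coord_of_odd hi]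
    refine (Algebra.TensorProduct.map_tmul _ _ _ _).trans ?_
    rw [map_one, ExteriorAlgebra.map_apply_ι, Finsupp.linearCombination_single, h1, one_smul]
    rfl

theorem substCoord_σ (m : J → Option I) (hm : ∀ j i, m j = some i → p i = r j) (f : SF r) :
    substCoord m hm (σ f) = σ (substCoord m hm f) := by
  refine hom_σ (fun j => ?_) f
  rcases h : m j with _ | i
  · rw [substCoord_of_none hm h]
    exact IsHomog.zero _
  · rw [substCoord_of_some hm h, ← hm j i h]
    exact isHomog_coord i

end SF

/-- Superfunctions of `x`, `θ` and `z`, as a supercommutative algebra. -/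
abbrev ZF (T : Type) (n : ℕ) {Z : Type u} (p : Z → ZMod 2) : Type u := SF (Coord.parity T n p)

/-- Local functions for the fields `F`, as a supercommutative algebra. -/
abbrev JF (T : Type) (n : ℕ) {F : Type u} (p : F → ZMod 2) : Type u := ZF T n (Jet.parity n p)

namespace ZF

open SuperAlgebra

section Coordinates

variable {T : Type} {n : ℕ} {Z : Type u} {p : Z → ZMod 2} {Z' : Type v} {p' : Z' → ZMod 2}

/-- The coordinate `x^μ`. -/
def cx (T : Type) (p : Z → ZMod 2) (μ : Fin n) : ZF T n p := SF.coord _ (.x μ)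

/-- The coordinate `θ^t`. -/
def cθ (n : ℕ) (p : Z → ZMod 2) (t : T) : ZF T n p := SF.coord _ (.theta t)

/-- The coordinate `z`. -/
def cz (T : Type) (n : ℕ) (p : Z → ZMod 2) (a : Z) : ZF T n p := SF.coord _ (.z a)

theorem isHomog_cx (μ : Fin n) : IsHomog 0 (cx T p μ) := SF.isHomog_coord (Coord.x μ)

theorem isHomog_cθ (t : T) : IsHomog 1 (cθ n p t) := SF.isHomog_coord (Coord.theta t)

theorem isHomog_cz (a : Z) : IsHomog (p a) (cz T n p a) := SF.isHomog_coord (Coord.z a)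

/-- The vector field with components `c` along `z`. -/
def vert (c : Z → ZF T n p) : ZF T n p → ZF T n p := _root_.vert p c

theorem isSDer_vert {a : ZMod 2} {c : Z → ZF T n p} (hc : ∀ z, IsHomog (p z + a) (c z)) :
    IsSDer a (vert c) := by
  refine SF.isSDer_vfield fun i => ?_
  rcases i with μ | t | z
  · exact IsHomog.zero _
  · exact IsHomog.zero _
  · exact hc z

theorem vert_cx (c : Z → ZF T n p) (μ : Fin n) : vert c (cx T p μ) = 0 := SF.vfield_coord _ _

theorem vert_cθ (c : Z → ZF T n p) (t : T) : vert c (cθ n p t) = 0 := SF.vfield_coord _ _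

theorem vert_cz (c : Z → ZF T n p) (z : Z) : vert c (cz T n p z) = c z := SF.vfield_coord _ _

/-- The derivative `∂/∂x^μ`. -/
def dx (μ : Fin n) : ZF T n p → ZF T n p := _root_.dx p μ

theorem isSDer_dx (μ : Fin n) : IsSDer 0 (dx μ : ZF T n p → ZF T n p) :=
  SF.isSDer_pderiv (p := Coord.parity T n p) (Coord.x μ)

theorem dx_cx (μ ν : Fin n) : dx μ (cx T p ν) = if μ = ν then 1 else 0 := by
  classical
  exact (SF.pderiv_coord (Coord.x μ) (Coord.x ν)).trans (by simp)

theorem dx_cθ (μ : Fin n) (t : T) : dx μ (cθ n p t) = 0 := by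
  classical
  exact (SF.pderiv_coord (Coord.x μ) (Coord.theta t)).trans (by simp)

theorem dx_cz (μ : Fin n) (z : Z) : dx μ (cz T n p z) = 0 := by
  classical
  exact (SF.pderiv_coord (Coord.x μ) (Coord.z z)).trans (by simp)

/-- The derivative `∂/∂θ^ν`. -/
def dθ (ν : Fin n) : ZF (Fin n) n p → ZF (Fin n) n p := _root_.dθ p ν

theorem isSDer_dθ (ν : Fin n) : IsSDer 1 (dθ ν : ZF (Fin n) n p → ZF (Fin n) n p) :=
  SF.isSDer_pderiv (p := Coord.parity (Fin n) n p) (Coord.theta ν)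

theorem dθ_cx (ν μ : Fin n) : dθ ν (cx (Fin n) p μ) = 0 := by
  classical
  exact (SF.pderiv_coord (Coord.theta ν) (Coord.x μ)).trans (by simp)

theorem dθ_cθ (ν μ : Fin n) : dθ ν (cθ n p μ) = if ν = μ then 1 else 0 := by
  classical
  exact (SF.pderiv_coord (Coord.theta ν) (Coord.theta μ)).trans (by simp)

theorem dθ_cz (ν : Fin n) (z : Z) : dθ ν (cz (Fin n) n p z) = 0 := by
  classical
  exact (SF.pderiv_coord (Coord.theta ν) (Coord.z z)).trans (by simp)

theorem hom_ext {A : ZF T n p →ₐ[ℝ] SF p'} {B : ZF T n p →ₐ[ℝ] SF p'}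
    (hx : ∀ μ, A (cx T p μ) = B (cx T p μ)) (hθ : ∀ t, A (cθ n p t) = B (cθ n p t))
    (hz : ∀ z, A (cz T n p z) = B (cz T n p z)) : A = B := by
  refine SF.hom_ext fun i => ?_
  rcases i with μ | t | z
  · exact hx μ
  · exact hθ t
  · exact hz z

theorem map_eq {a : ZMod 2} {D : ZF T n p → ZF T n p} {D' : SF p' → SF p'} (hD : IsSDer a D)
    (hD' : IsSDer a D') {h : ZF T n p →ₐ[ℝ] SF p'} (hh : ∀ f, h (σ f) = σ (h f))
    (hx : ∀ μ, h (D (cx T p μ)) = D' (h (cx T p μ)))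
    (hθ : ∀ t, h (D (cθ n p t)) = D' (h (cθ n p t)))
    (hz : ∀ z, h (D (cz T n p z)) = D' (h (cz T n p z))) (f : ZF T n p) :
    h (D f) = D' (h f) := by
  refine SF.map_eq hD hD' hh (fun i => ?_) f
  rcases i with μ | t | z
  · exact hx μ
  · exact hθ t
  · exact hz z

theorem der_ext {a : ZMod 2} {D D' : ZF T n p → ZF T n p} (hD : IsSDer a D)
    (hD' : IsSDer a D') (hx : ∀ μ, D (cx T p μ) = D' (cx T p μ))
    (hθ : ∀ t, D (cθ n p t) = D' (cθ n p t))
    (hz : ∀ z, D (cz T n p z) = D' (cz T n p z)) (f : ZF T n p) : D f = D' f :=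
  map_eq hD hD' (h := AlgHom.id ℝ _) (fun _ => rfl) hx hθ hz f

theorem graded_comm {a b : ZMod 2} {D D' : ZF T n p → ZF T n p} (hD : IsSDer a D)
    (hD' : IsSDer b D') (hx : ∀ μ, D (D' (cx T p μ)) = sgn (a * b) • D' (D (cx T p μ)))
    (hθ : ∀ t, D (D' (cθ n p t)) = sgn (a * b) • D' (D (cθ n p t)))
    (hz : ∀ z, D (D' (cz T n p z)) = sgn (a * b) • D' (D (cz T n p z))) (f : ZF T n p) :
    D (D' f) = sgn (a * b) • D' (D f) := by
  refine SF.graded_comm hD hD' (fun i => ?_) f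
  rcases i with μ | t | z
  · exact hx μ
  · exact hθ t
  · exact hz z

theorem comm_right {b : ZMod 2} {D D' : ZF T n p → ZF T n p} (hD : IsSDer 0 D)
    (hD' : IsSDer b D') (hx : ∀ μ, D (D' (cx T p μ)) = D' (D (cx T p μ)))
    (hθ : ∀ t, D (D' (cθ n p t)) = D' (D (cθ n p t)))
    (hz : ∀ z, D (D' (cz T n p z)) = D' (D (cz T n p z))) (f : ZF T n p) :
    D (D' f) = D' (D f) := by
  have h1 : sgn (0 * b) = 1 := by simp
  have := graded_comm hD hD' (by simpa only [h1, one_smul] using hx)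
    (by simpa only [h1, one_smul] using hθ) (by simpa only [h1, one_smul] using hz) f
  rwa [h1, one_smul] at this

theorem anticomm {D D' : ZF T n p → ZF T n p} (hD : IsSDer 1 D)
    (hD' : IsSDer 1 D') (hx : ∀ μ, D (D' (cx T p μ)) = -D' (D (cx T p μ)))
    (hθ : ∀ t, D (D' (cθ n p t)) = -D' (D (cθ n p t)))
    (hz : ∀ z, D (D' (cz T n p z)) = -D' (D (cz T n p z))) (f : ZF T n p) :
    D (D' f) = -D' (D f) := by
  have h1 : sgn (1 * 1) = -1 := by simp
  have := graded_comm hD hD' (by simpa only [h1, neg_one_smul] using hx)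
    (by simpa only [h1, neg_one_smul] using hθ) (by simpa only [h1, neg_one_smul] using hz) f
  rwa [h1, neg_one_smul] at this

theorem isLinearMap_of_isSDer {a : ZMod 2} {D : ZF T n p → ZF T n p} (hD : IsSDer a D) :
    IsLinearMap ℝ D := ⟨hD.map_add, hD.map_smul⟩

end Coordinates

/-! ### Setting `θ = 0` and renaming variables -/

section Rename

variable {T : Type} {n : ℕ} {Z : Type u} {p : Z → ZMod 2} {Z' : Type v} {p' : Z' → ZMod 2}

/-- Setting `θ = 0`. -/
def thetaZero : ZF (Fin n) n p →ₐ[ℝ] ZF Empty n p :=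
  (_root_.thetaZero p : SFun (Coord.parity (Fin n) n p) →ₐ[ℝ] SFun (Coord.parity Empty n p))

theorem thetaZero_cx (μ : Fin n) : thetaZero (cx (Fin n) p μ) = cx Empty p μ :=
  SF.substCoord_of_some (j := Coord.x μ) (i := Coord.x μ) _ rfl

theorem thetaZero_cθ (μ : Fin n) : thetaZero (cθ n p μ) = 0 :=
  SF.substCoord_of_none (j := Coord.theta μ) _ rfl

theorem thetaZero_cz (z : Z) : thetaZero (cz (Fin n) n p z) = cz Empty n p z :=
  SF.substCoord_of_some (j := Coord.z z) (i := Coord.z z) _ rfl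

theorem thetaZero_σ (f : ZF (Fin n) n p) : thetaZero (σ f) = σ (thetaZero f) :=
  SF.substCoord_σ _ _ f

/-- `θ`-independent functions as functions of all the coordinates. -/
def inclTheta (T : Type) : ZF Empty n p →ₐ[ℝ] ZF T n p :=
  (_root_.inclTheta T n p : SFun (Coord.parity Empty n p) →ₐ[ℝ] SFun (Coord.parity T n p))

theorem inclTheta_cx (μ : Fin n) : inclTheta T (cx Empty p μ) = cx T p μ :=
  SF.substCoord_of_some (j := Coord.x μ) (i := Coord.x μ) _ rfl

theorem inclTheta_cz (z : Z) : inclTheta T (cz Empty n p z) = cz T n p z :=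
  SF.substCoord_of_some (j := Coord.z z) (i := Coord.z z) _ rfl

theorem inclTheta_σ (f : ZF Empty n p) : inclTheta T (σ f) = σ (inclTheta T f) :=
  SF.substCoord_σ _ _ f

/-- Replacing the variable `a` by `g a`. -/
def renameZ (T : Type) (n : ℕ) (g : Z → Z') (hg : ∀ a, p' (g a) = p a) :
    ZF T n p →ₐ[ℝ] ZF T n p' :=
  (_root_.renameZ T n g hg : SFun (Coord.parity T n p) →ₐ[ℝ] SFun (Coord.parity T n p'))

theorem renameZ_cx (g : Z → Z') (hg : ∀ a, p' (g a) = p a) (μ : Fin n) :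
    renameZ T n g hg (cx T p μ) = cx T p' μ :=
  SF.substCoord_of_some (j := Coord.x μ) (i := Coord.x μ) _ rfl

theorem renameZ_cθ (g : Z → Z') (hg : ∀ a, p' (g a) = p a) (t : T) :
    renameZ T n g hg (cθ n p t) = cθ n p' t :=
  SF.substCoord_of_some (j := Coord.theta t) (i := Coord.theta t) _ rfl

theorem renameZ_cz (g : Z → Z') (hg : ∀ a, p' (g a) = p a) (z : Z) :
    renameZ T n g hg (cz T n p z) = cz T n p' (g z) :=
  SF.substCoord_of_some (j := Coord.z z) (i := Coord.z (g z)) _ rfl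

theorem renameZ_σ (g : Z → Z') (hg : ∀ a, p' (g a) = p a) (f : ZF T n p) :
    renameZ T n g hg (σ f) = σ (renameZ T n g hg f) :=
  SF.substCoord_σ _ _ f

theorem thetaZero_inclTheta (f : ZF Empty n p) : thetaZero (inclTheta (Fin n) f) = f := by
  have : thetaZero.comp (inclTheta (Fin n)) = AlgHom.id ℝ (ZF Empty n p) :=
    hom_ext (fun μ => by simp only [AlgHom.comp_apply, inclTheta_cx, thetaZero_cx, AlgHom.id_apply])
      (fun t => t.elim)
      fun z => by simp only [AlgHom.comp_apply, inclTheta_cz, thetaZero_cz, AlgHom.id_apply]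
  exact DFunLike.congr_fun this f

end Rename

/-! ### Total derivatives -/

section Jets

variable {T : Type} {n : ℕ} {F : Type u} {p : F → ZMod 2} {F' : Type v} {p' : F' → ZMod 2}

/-- The total derivative `∂_μ`. -/
def totD (μ : Fin n) : JF T n p → JF T n p := totalD p μ

theorem totD_eq (μ : Fin n) (f : JF T n p) :
    totD μ f = dx μ f +
      vert (fun a : Jet n F => cz T n (Jet.parity n p) (a.1, a.2 + Pi.single μ 1)) f := rfl

theorem isSDer_totD (μ : Fin n) : IsSDer 0 (totD μ : JF T n p → JF T n p) :=
  (isSDer_dx μ).add (isSDer_vert fun a => by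
    rw [add_zero]
    exact isHomog_cz (p := Jet.parity n p) (a.1, a.2 + Pi.single μ 1))

theorem totD_cx (μ ν : Fin n) :
    totD μ (cx T (Jet.parity n p) ν) = if μ = ν then 1 else 0 := by
  rw [totD_eq, dx_cx, vert_cx, add_zero]

theorem totD_cθ (μ : Fin n) (t : T) : totD μ (cθ n (Jet.parity n p) t) = 0 := by
  rw [totD_eq, dx_cθ, vert_cθ, add_zero]

theorem totD_cz (μ : Fin n) (a : F) (m : Fin n → ℕ) :
    totD μ (cz T n (Jet.parity n p) (a, m)) = cz T n (Jet.parity n p) (a, m + Pi.single μ 1) := by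
  rw [totD_eq, dx_cz, vert_cz, zero_add]

theorem totD_comm (μ ν : Fin n) (f : JF T n p) : totD μ (totD ν f) = totD ν (totD μ f) := by
  refine comm_right (isSDer_totD μ) (isSDer_totD ν) (fun κ => ?_) (fun t => ?_) (fun z => ?_) f
  · rw [totD_cx, totD_cx]
    split <;> split <;> simp only [(isSDer_totD _).map_one, (isSDer_totD _).map_zero]
  · rw [totD_cθ, totD_cθ, (isSDer_totD _).map_zero, (isSDer_totD _).map_zero]
  · rw [totD_cz, totD_cz, totD_cz, totD_cz, add_right_comm]

theorem iterSym_totD_cz (a : F) (m m' : Fin n → ℕ) :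
    iterSym totD m' (cz T n (Jet.parity n p) (a, m)) = cz T n (Jet.parity n p) (a, m + m') := by
  have h1 : ∀ (μ : Fin n) (k : ℕ) (m : Fin n → ℕ),
      (totD μ)^[k] (cz T n (Jet.parity n p) (a, m)) =
        cz T n (Jet.parity n p) (a, m + Pi.single μ k) := by
    intro μ k m
    induction k with
    | zero => rw [Pi.single_zero, add_zero]; rfl
    | succ k ih =>
      rw [Function.iterate_succ_apply', ih, totD_cz, add_assoc, ← Pi.single_add]
  have h2 : ∀ l : List (Fin n), l.foldr (fun μ g => (totD μ)^[m' μ] g)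
      (cz T n (Jet.parity n p) (a, m)) =
        cz T n (Jet.parity n p) (a, m + (l.map fun μ => Pi.single μ (m' μ)).sum) := by
    intro l
    induction l with
    | nil => rw [List.map_nil, List.sum_nil, add_zero]; rfl
    | cons μ l ih =>
      rw [List.foldr_cons, ih, h1, List.map_cons, List.sum_cons, add_assoc, add_comm (Pi.single _ _)]
  refine (h2 _).trans ?_
  rw [← Fin.sum_univ_def, Finset.univ_sum_single]

theorem thetaZero_totD (μ : Fin n) (f : JF (Fin n) n p) :
    thetaZero (totD μ f) = totD μ (thetaZero f) := by
  refine map_eq (isSDer_totD μ) (isSDer_totD μ) thetaZero_σ (fun κ => ?_) (fun t => ?_)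
    (fun z => ?_) f
  · rw [thetaZero_cx, totD_cx, totD_cx]
    split <;> simp
  · rw [thetaZero_cθ, totD_cθ, (isSDer_totD _).map_zero, map_zero]
  · rw [thetaZero_cz, totD_cz, totD_cz, thetaZero_cz]

theorem inclTheta_totD (μ : Fin n) (f : JF Empty n p) :
    inclTheta T (totD μ f) = totD μ (inclTheta T f) := by
  refine map_eq (isSDer_totD μ) (isSDer_totD μ) inclTheta_σ (fun κ => ?_) (fun t => t.elim)
    (fun z => ?_) f
  · rw [inclTheta_cx, totD_cx, totD_cx]
    split <;> simp
  · rw [inclTheta_cz, totD_cz, totD_cz, inclTheta_cz]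

end Jets

end ZF

/-- Superfunctions of `x`, `θ` and the jets of the `θ`-descendants of `z`. -/
abbrev PF (T : Type) (n : ℕ) {Z : Type u} (p : Z → ZMod 2) : Type u := JF T n (Desc.parity n p)

/-! ### Jets of descendants, total θ-derivatives and superfields. -/

namespace ZF

open SuperAlgebra

theorem isHomog_iterSkew {n : ℕ} {A : Type u} [SuperAlgebra A] {D : Fin n → A → A}
    (hD : ∀ ν, IsSDer 1 (D ν)) (N : Finset (Fin n)) {a : ZMod 2} {f : A} (hf : IsHomog a f) :
    IsHomog (a + N.card) (iterSkew D N f) := by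
  induction N using Finset.induction_on_min with
  | empty => simpa [iterSkew_empty] using hf
  | insert b N hb ih =>
    rw [iterSkew_insert D hb, Finset.card_insert_of_notMem fun h => lt_irrefl _ (hb b h),
      Nat.cast_succ, add_comm _ (1 : ZMod 2), add_left_comm]
    exact (hD b).isHomog ih

theorem isHomog_iterSym {n : ℕ} {A : Type u} [SuperAlgebra A] {D : Fin n → A → A}
    (hD : ∀ ν, IsSDer 0 (D ν)) (m : Fin n → ℕ) {a : ZMod 2} {f : A} (hf : IsHomog a f) :
    IsHomog a (iterSym D m f) :=
  iterSym_induction (fun μ f hf => by simpa using (hD μ).isHomog hf) m hf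

section Parent

variable {T : Type} {n : ℕ} {Z : Type u} {p : Z → ZMod 2} {Z' : Type v} {p' : Z' → ZMod 2}

/-- The jet coordinate `z_{(m)[N]}`. -/
def pz (T : Type) (p : Z → ZMod 2) (z : Z) (m : Fin n → ℕ) (N : Finset (Fin n)) : PF T n p :=
  cz T n (Jet.parity n (Desc.parity n p)) ((z, N), m)

/-- The coordinate `x^μ`. -/
def px (T : Type) (p : Z → ZMod 2) (μ : Fin n) : PF T n p := cx T (Jet.parity n (Desc.parity n p)) μ

/-- The coordinate `θ^t`. -/
def pθ (n : ℕ) (p : Z → ZMod 2) (t : T) : PF T n p := cθ n (Jet.parity n (Desc.parity n p)) t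

theorem isHomog_pz (z : Z) (m : Fin n → ℕ) (N : Finset (Fin n)) :
    IsHomog (p z + N.card) (pz T p z m N) :=
  isHomog_cz (p := Jet.parity n (Desc.parity n p)) ((z, N), m)

theorem totD_px (μ ν : Fin n) : totD μ (px T p ν) = if μ = ν then 1 else 0 := totD_cx μ ν

theorem totD_pθ (μ : Fin n) (t : T) : totD μ (pθ n p t) = 0 := totD_cθ μ t

theorem totD_pz (μ : Fin n) (z : Z) (m : Fin n → ℕ) (N : Finset (Fin n)) :
    totD μ (pz T p z m N) = pz T p z (m + Pi.single μ 1) N := totD_cz μ _ m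

theorem iterSym_totD_pz (z : Z) (m m' : Fin n → ℕ) (N : Finset (Fin n)) :
    iterSym totD m' (pz T p z m N) = pz T p z (m + m') N := iterSym_totD_cz _ m m'

/-- `∂^F/∂θ^ν`. -/
def fθ (ν : Fin n) : PF T n p → PF T n p :=
  vert fun a => if ν ∈ a.1.2 then 0 else
    (sgn (p a.1.1) * BRSTTheory.moveSign ν a.1.2) • pz T p a.1.1 a.2 (insert ν a.1.2)

theorem isSDer_fθ (ν : Fin n) : IsSDer 1 (fθ ν : PF T n p → PF T n p) := by
  refine isSDer_vert fun a => ?_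
  split
  · exact IsHomog.zero _
  · rename_i h
    refine IsHomog.smul ?_ _
    have := isHomog_pz (T := T) (p := p) a.1.1 a.2 (insert ν a.1.2)
    rwa [Finset.card_insert_of_notMem h, Nat.cast_succ, ← add_assoc] at this

theorem fθ_px (ν μ : Fin n) : fθ ν (px T p μ) = 0 := vert_cx _ _

theorem fθ_pθ (ν : Fin n) (t : T) : fθ ν (pθ n p t) = 0 := vert_cθ _ _

theorem fθ_pz (ν : Fin n) (z : Z) (m : Fin n → ℕ) (N : Finset (Fin n)) :
    fθ ν (pz T p z m N) = if ν ∈ N then 0 else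
      (sgn (p z) * BRSTTheory.moveSign ν N) • pz T p z m (insert ν N) := vert_cz _ _

/-- The total derivative `∂^θ_ν`. -/
def tθ (ν : Fin n) (f : PF (Fin n) n p) : PF (Fin n) n p := dθ ν f + fθ ν f

theorem isSDer_tθ (ν : Fin n) : IsSDer 1 (tθ ν : PF (Fin n) n p → PF (Fin n) n p) :=
  (isSDer_dθ ν).add (isSDer_fθ ν)

theorem tθ_px (ν μ : Fin n) : tθ ν (px (Fin n) p μ) = 0 :=
  (congrArg₂ (· + ·) (dθ_cx ν μ) (fθ_px ν μ)).trans (add_zero _)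

theorem tθ_pθ (ν μ : Fin n) : tθ ν (pθ n p μ) = if ν = μ then 1 else 0 :=
  (congrArg₂ (· + ·) (dθ_cθ ν μ) (fθ_pθ ν μ)).trans (add_zero _)

theorem tθ_pz (ν : Fin n) (z : Z) (m : Fin n → ℕ) (N : Finset (Fin n)) :
    tθ ν (pz (Fin n) p z m N) = if ν ∈ N then 0 else
      (sgn (p z) * BRSTTheory.moveSign ν N) • pz (Fin n) p z m (insert ν N) :=
  (congrArg₂ (· + ·) (dθ_cz ν _) (fθ_pz ν z m N)).trans (zero_add _)

theorem totD_tθ (μ ν : Fin n) (f : PF (Fin n) n p) : totD μ (tθ ν f) = tθ ν (totD μ f) := by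
  refine comm_right (isSDer_totD μ) (isSDer_tθ ν) (fun κ => ?_) (fun κ => ?_) (fun a => ?_) f
  · change totD μ (tθ ν (px _ p κ)) = tθ ν (totD μ (px _ p κ))
    rw [tθ_px, totD_px, (isSDer_totD μ).map_zero]
    split
    · rw [(isSDer_tθ ν).map_one]
    · rw [(isSDer_tθ ν).map_zero]
  · change totD μ (tθ ν (pθ n p κ)) = tθ ν (totD μ (pθ n p κ))
    rw [tθ_pθ, totD_pθ, (isSDer_tθ ν).map_zero]
    split
    · rw [(isSDer_totD μ).map_one]
    · rw [(isSDer_totD μ).map_zero]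
  · obtain ⟨⟨z, N⟩, m⟩ := a
    change totD μ (tθ ν (pz _ p z m N)) = tθ ν (totD μ (pz _ p z m N))
    rw [tθ_pz, totD_pz, tθ_pz]
    split
    · rw [(isSDer_totD μ).map_zero]
    · rw [(isSDer_totD μ).map_smul, totD_pz]

/-- Exactly one of the two insertions passes the other new index. This sign is the source of the
anticommutation of the ∂^θ. -/
theorem moveSign_antisymm {μ ν : Fin n} {N : Finset (Fin n)} (hμ : μ ∉ N) (hν : ν ∉ N)
    (h : μ ≠ ν) : BRSTTheory.moveSign ν N * BRSTTheory.moveSign μ (insert ν N) =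
      -(BRSTTheory.moveSign μ N * BRSTTheory.moveSign ν (insert μ N)) := by
  rw [moveSign_insert hν, moveSign_insert hμ]
  obtain h | h := h.lt_or_gt
  · rw [if_pos h, if_neg h.not_gt]
    ring
  · rw [if_pos h, if_neg h.not_gt]
    ring

theorem tθ_tθ (μ ν : Fin n) (f : PF (Fin n) n p) : tθ μ (tθ ν f) = -tθ ν (tθ μ f) := by
  refine anticomm (isSDer_tθ μ) (isSDer_tθ ν) (fun κ => ?_) (fun κ => ?_) (fun a => ?_) f
  · change tθ μ (tθ ν (px _ p κ)) = -tθ ν (tθ μ (px _ p κ))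
    rw [tθ_px, tθ_px, (isSDer_tθ μ).map_zero, (isSDer_tθ ν).map_zero, neg_zero]
  · change tθ μ (tθ ν (pθ n p κ)) = -tθ ν (tθ μ (pθ n p κ))
    rw [tθ_pθ, tθ_pθ]
    split <;> split <;> simp only [(isSDer_tθ _).map_one, (isSDer_tθ _).map_zero, neg_zero]
  · obtain ⟨⟨z, N⟩, m⟩ := a
    change tθ μ (tθ ν (pz _ p z m N)) = -tθ ν (tθ μ (pz _ p z m N))
    rw [tθ_pz, tθ_pz]
    by_cases hν : ν ∈ N
    · rw [if_pos hν, (isSDer_tθ μ).map_zero]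
      split
      · rw [(isSDer_tθ ν).map_zero, neg_zero]
      · rw [(isSDer_tθ ν).map_smul, tθ_pz, if_pos (Finset.mem_insert_of_mem hν), smul_zero,
          neg_zero]
    · rw [if_neg hν, (isSDer_tθ μ).map_smul, tθ_pz]
      by_cases hμ : μ ∈ N
      · rw [if_pos hμ, if_pos (Finset.mem_insert_of_mem hμ), (isSDer_tθ ν).map_zero, smul_zero,
          neg_zero]
      · rw [if_neg hμ, (isSDer_tθ ν).map_smul, tθ_pz]
        obtain rfl | h := eq_or_ne μ ν
        · rw [if_pos (Finset.mem_insert_self _ _), smul_zero, neg_zero]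
        · rw [if_neg (by simp [h, hμ]), if_neg (by simp [h.symm, hν]), smul_smul, smul_smul,
            mul_mul_mul_comm, moveSign_antisymm hμ hν h, Finset.insert_comm μ ν, mul_neg, neg_smul,
            mul_mul_mul_comm]

theorem isLinearMap_tθ (ν : Fin n) : IsLinearMap ℝ (tθ ν : PF (Fin n) n p → PF (Fin n) n p) :=
  isLinearMap_of_isSDer (isSDer_tθ ν)

theorem tθ_iterSkew (ν : Fin n) (N : Finset (Fin n)) (f : PF (Fin n) n p) :
    tθ ν (iterSkew tθ N f) =
      if ν ∈ N then 0 else BRSTTheory.moveSign ν N • iterSkew tθ (insert ν N) f :=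
  apply_iterSkew isLinearMap_tθ tθ_tθ ν N f

/-- `z` as a superfield. -/
def bar (T : Type) (n : ℕ) (p : Z → ZMod 2) : ZF T n p →ₐ[ℝ] PF T n p :=
  renameZ T n (fun a => ((a, ∅), 0)) fun a => by simp [Jet.parity, Desc.parity]

theorem bar_cx (μ : Fin n) : bar T n p (cx T p μ) = px T p μ := renameZ_cx _ _ _

theorem bar_cθ (t : T) : bar T n p (cθ n p t) = pθ n p t := renameZ_cθ _ _ _

theorem bar_cz (z : Z) : bar T n p (cz T n p z) = pz T p z 0 ∅ := renameZ_cz _ _ _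

theorem bar_σ (f : ZF T n p) : bar T n p (σ f) = σ (bar T n p f) := renameZ_σ _ _ f

/-- Adding indices from the largest down, every `moveSign` is 1, and each ∂^θ contributes one factor
(-1)^{p z}. -/
theorem iterSkew_tθ_pz (z : Z) (m : Fin n → ℕ) (N : Finset (Fin n)) :
    iterSkew tθ N (pz (Fin n) p z m ∅) = sgn (N.card * p z) • pz (Fin n) p z m N := by
  induction N using Finset.induction_on_min with
  | empty => simp [iterSkew_empty]
  | insert a N ha ih =>
    have haN : a ∉ N := fun h => lt_irrefl _ (ha a h)
    rw [iterSkew_insert tθ ha, ih, (isSDer_tθ a).map_smul, tθ_pz, if_neg haN, moveSign_of_lt ha,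
      Finset.card_insert_of_notMem haN, smul_smul, mul_one, Nat.cast_succ, add_mul, one_mul,
      sgn_add]

end Parent

end ZF

namespace ZF

open SuperAlgebra

/-! ### The derivation `θ^μ ∂_μ` -/

section ThetaD

variable {n : ℕ} {F : Type u} {p : F → ZMod 2}

theorem isSDer_sum_cθ_mul {Z : Type u} {p : Z → ZMod 2}
    {D : Fin n → ZF (Fin n) n p → ZF (Fin n) n p} (hD : ∀ μ, IsSDer 0 (D μ)) :
    IsSDer 1 fun f => ∑ μ, cθ n p μ * D μ f :=
  IsSDer.sum fun μ _ => by
    have := (hD μ).mul_left (isHomog_cθ (n := n) (p := p) μ)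
    rwa [add_zero] at this

/-- The vector field `θ^μ ∂_μ`. -/
def thetaD (f : JF (Fin n) n p) : JF (Fin n) n p := ∑ μ, cθ n (Jet.parity n p) μ * totD μ f

theorem isSDer_thetaD : IsSDer 1 (thetaD : JF (Fin n) n p → JF (Fin n) n p) :=
  isSDer_sum_cθ_mul isSDer_totD

theorem thetaD_cx (μ : Fin n) :
    thetaD (cx (Fin n) (Jet.parity n p) μ) = cθ n (Jet.parity n p) μ := by
  unfold thetaD
  simp only [totD_cx, mul_ite, mul_one, mul_zero, Finset.sum_ite_eq', Finset.mem_univ, if_true]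

theorem thetaD_cθ (μ : Fin n) : thetaD (cθ n (Jet.parity n p) μ) = 0 := by
  unfold thetaD
  simp only [totD_cθ, mul_zero, Finset.sum_const_zero]

end ThetaD

/-! ### Prolongation of odd characteristics. -/

section Prolong

variable {T : Type} {n : ℕ} {Z : Type u} {p : Z → ZMod 2} {Z' : Type v} {p' : Z' → ZMod 2}

/-- The prolongation of the characteristic `Q`. -/
def prol (Dθ : Fin n → PF T n p → PF T n p) (Q : Z → PF T n p) : PF T n p → PF T n p :=
  vert fun a => sgn (a.1.2.card * (p a.1.1 + 1)) •
    iterSkew Dθ a.1.2 (iterSym totD a.2 (Q a.1.1))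

variable {Dθ : Fin n → PF T n p → PF T n p} {Q : Z → PF T n p}

theorem isSDer_prol (hD : ∀ ν, IsSDer 1 (Dθ ν)) (hQ : ∀ z, IsHomog (p z + 1) (Q z)) :
    IsSDer 1 (prol Dθ Q) := by
  refine isSDer_vert fun a => IsHomog.smul ?_ _
  have := isHomog_iterSkew hD a.1.2 (isHomog_iterSym (isSDer_totD) a.2 (hQ a.1.1))
  rwa [add_right_comm] at this

theorem prol_px (μ : Fin n) : prol Dθ Q (px T p μ) = 0 := vert_cx _ _

theorem prol_pθ (t : T) : prol Dθ Q (pθ n p t) = 0 := vert_cθ _ _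

theorem prol_pz (z : Z) (m : Fin n → ℕ) (N : Finset (Fin n)) :
    prol Dθ Q (pz T p z m N) =
      sgn (N.card * (p z + 1)) • iterSkew Dθ N (iterSym totD m (Q z)) := vert_cz _ _

/-- The factor (-1)^{k(p z + 1)} built into `prol` is what this forces: it changes by -(-1)^{p z}
for each new index, where (-1)^{p z} is the sign in `tθ_pz` and the minus sign is that of
anticommutation. -/
theorem prol_tθ {Q : Z → PF (Fin n) n p} (hQ : ∀ z, IsHomog (p z + 1) (Q z)) (ν : Fin n)
    (f : PF (Fin n) n p) : prol tθ Q (tθ ν f) = -tθ ν (prol tθ Q f) := by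
  have hV := isSDer_prol isSDer_tθ hQ
  refine anticomm hV (isSDer_tθ ν) (fun κ => ?_) (fun κ => ?_) (fun a => ?_) f
  · change prol tθ Q (tθ ν (px _ p κ)) = -tθ ν (prol tθ Q (px _ p κ))
    rw [tθ_px, prol_px, hV.map_zero, (isSDer_tθ ν).map_zero, neg_zero]
  · change prol tθ Q (tθ ν (pθ n p κ)) = -tθ ν (prol tθ Q (pθ n p κ))
    rw [tθ_pθ, prol_pθ, (isSDer_tθ ν).map_zero, neg_zero]
    split
    · rw [hV.map_one]
    · rw [hV.map_zero]
  · obtain ⟨⟨z, N⟩, m⟩ := a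
    change prol tθ Q (tθ ν (pz _ p z m N)) = -tθ ν (prol tθ Q (pz _ p z m N))
    rw [tθ_pz, prol_pz, (isSDer_tθ ν).map_smul, tθ_iterSkew]
    split
    · rw [hV.map_zero, smul_zero, neg_zero]
    · rename_i hν
      rw [hV.map_smul, prol_pz, Finset.card_insert_of_notMem hν, smul_smul, smul_smul, ← neg_smul,
        Nat.cast_succ, add_mul, one_mul, sgn_add, sgn_add (p z), sgn_one]
      congr 1
      linear_combination -(sgn (N.card * (p z + 1)) * BRSTTheory.moveSign ν N) *
        sgn_mul_self (p z)

end Prolong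

/-! ### The parent differential -/

section ParentDifferential

variable {T : Type} {n : ℕ} {ι : Type u} {p : ι → ZMod 2} {S : ι → JF Empty n p}

/-- The derivation `s`. -/
def ev (T : Type) (S : ι → JF Empty n p) : JF T n p → JF T n p :=
  vert fun a : Jet n ι => iterSym totD a.2 (inclTheta T (S a.1))

/-- The derivation `s̃`. -/
def sT (S : ι → JF Empty n p) (f : JF (Fin n) n p) : JF (Fin n) n p :=
  thetaD f + ev (Fin n) S f

theorem isHomog_inclTheta {Z : Type u} {p : Z → ZMod 2} {a : ZMod 2} {f : ZF Empty n p}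
    (hf : IsHomog a f) : IsHomog a (inclTheta T f) := by
  have h : σ f = sgn a • f := hf
  unfold IsHomog
  rw [← inclTheta_σ, h, map_smul]

theorem isHomog_bar {Z : Type u} {p : Z → ZMod 2} {a : ZMod 2} {f : ZF T n p}
    (hf : IsHomog a f) : IsHomog a (bar T n p f) := by
  have h : σ f = sgn a • f := hf
  unfold IsHomog
  rw [← bar_σ, h, map_smul]

theorem isSDer_ev (hS : ∀ A, IsHomog (p A + 1) (S A)) : IsSDer 1 (ev T S) :=
  isSDer_vert fun a => isHomog_iterSym isSDer_totD a.2 (isHomog_inclTheta (hS a.1))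

theorem isSDer_sT (hS : ∀ A, IsHomog (p A + 1) (S A)) : IsSDer 1 (sT S) :=
  isSDer_thetaD.add (isSDer_ev hS)

/-- The characteristic of the parent differential of `s̃`. -/
def charP (S : ι → JF Empty n p) (z : Jet n ι) : PF (Fin n) n (Jet.parity n p) :=
  bar (Fin n) n _ (sT S (cz (Fin n) n _ z)) - thetaD (pz (Fin n) _ z 0 ∅)

/-- The parent differential of `s̃`. -/
def sTP (S : ι → JF Empty n p) (f : PF (Fin n) n (Jet.parity n p)) :
    PF (Fin n) n (Jet.parity n p) :=
  thetaD f + prol tθ (charP S) f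

theorem isHomog_charP (hS : ∀ A, IsHomog (p A + 1) (S A)) (z : Jet n ι) :
    IsHomog (Jet.parity n p z + 1) (charP S z) := by
  refine IsHomog.sub (isHomog_bar ?_) ?_
  · rw [add_comm]
    exact (isSDer_sT hS).isHomog (isHomog_cz z)
  · have := isSDer_thetaD.isHomog (isHomog_pz (T := Fin n) (p := Jet.parity n p) z 0 ∅)
    rwa [Finset.card_empty, Nat.cast_zero, add_zero, add_comm] at this

theorem isSDer_sTP (hS : ∀ A, IsHomog (p A + 1) (S A)) : IsSDer 1 (sTP S) :=
  isSDer_thetaD.add (isSDer_prol isSDer_tθ (isHomog_charP hS))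

/-- The characteristic `charP` is bar(s̃ Ψ) minus θ^μ ∂_μ Ψ, and `sTP` adds this last term back; on
x both sides give θ, on θ both give 0. -/
theorem bar_sT (hS : ∀ A, IsHomog (p A + 1) (S A)) (f : JF (Fin n) n p) :
    bar (Fin n) n _ (sT S f) = sTP S (bar (Fin n) n _ f) := by
  refine map_eq (isSDer_sT hS) (isSDer_sTP hS) bar_σ (fun μ => ?_) (fun μ => ?_) (fun z => ?_) f
  · unfold sT sTP ev
    rw [thetaD_cx, vert_cx, add_zero, bar_cx, prol_px, add_zero, bar_cθ]
    exact (thetaD_cx μ).symm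
  · unfold sT sTP ev
    rw [thetaD_cθ, vert_cθ, add_zero, map_zero, bar_cθ, prol_pθ, add_zero]
    exact (thetaD_cθ μ).symm
  · unfold sTP
    rw [bar_cz, prol_pz, Finset.card_empty, Nat.cast_zero, zero_mul, sgn_zero, one_smul,
      iterSkew_empty, iterSym_zero, charP]
    abel

theorem tθ_pθ_mul {Z : Type u} {p : Z → ZMod 2} (ν μ : Fin n) (f : PF (Fin n) n p) :
    tθ ν (pθ n p μ * f) = (if ν = μ then f else 0) - pθ n p μ * tθ ν f := by
  have h : IsHomog 1 (pθ n p μ) := isHomog_cθ (p := Jet.parity n (Desc.parity n p)) μ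
  rw [(isSDer_tθ ν).map_mul, tθ_pθ, h.signAut, mul_one, sgn_one, neg_one_smul, neg_mul,
    ← sub_eq_add_neg, ite_mul, one_mul, zero_mul]

theorem thetaD_tθ {Z : Type u} {p : Z → ZMod 2} (ν : Fin n) (f : PF (Fin n) n p) :
    thetaD (tθ ν f) = totD ν f - tθ ν (thetaD f) := by
  have h : ∀ μ : Fin n, tθ ν (pθ n p μ * totD μ f) =
      (if ν = μ then totD μ f else 0) - pθ n p μ * totD μ (tθ ν f) := fun μ => by
    rw [tθ_pθ_mul, totD_tθ]
  have h2 : tθ ν (thetaD f) = ∑ μ, tθ ν (pθ n p μ * totD μ f) := (isSDer_tθ ν).map_sum _ _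
  rw [h2]
  simp only [h, Finset.sum_sub_distrib, Finset.sum_ite_eq, Finset.mem_univ, if_true]
  exact (sub_sub_cancel _ _).symm

/-- The prolonged part anticommutes with ∂^θ_ν, while in θ^μ ∂_μ the derivative ∂^θ_ν strikes the
explicit θ^ν and leaves ∂_ν. -/
theorem sTP_tθ (hS : ∀ A, IsHomog (p A + 1) (S A)) (ν : Fin n)
    (f : PF (Fin n) n (Jet.parity n p)) :
    sTP S (tθ ν f) = totD ν f - tθ ν (sTP S f) := by
  unfold sTP
  rw [thetaD_tθ, prol_tθ (isHomog_charP hS), (isSDer_tθ ν).map_add]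
  abel

/-- The real span of the derivatives `∂_ν ∂^θ_M f`. -/
def derSpan {Z : Type u} {p : Z → ZMod 2} (f : PF (Fin n) n p) :
    Submodule ℝ (PF (Fin n) n p) :=
  Submodule.span ℝ (Set.range fun k : Fin n × Finset (Fin n) => totD k.1 (iterSkew tθ k.2 f))

/-- ∂^θ_ν commutes with ∂_μ and turns ∂^θ_M into zero or ± the iterated derivative with index M ∪
{ν}, so errors once in the span stay there. -/
theorem tθ_mem_derSpan {Z : Type u} {p : Z → ZMod 2} (ν : Fin n) (f : PF (Fin n) n p)
    {g : PF (Fin n) n p} (hg : g ∈ derSpan f) : tθ ν g ∈ derSpan f := by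
  induction hg using Submodule.span_induction with
  | mem x hx =>
    obtain ⟨⟨μ, M⟩, rfl⟩ := hx
    change tθ ν (totD μ (iterSkew tθ M f)) ∈ _
    rw [← totD_tθ, tθ_iterSkew]
    split
    · rw [(isSDer_totD μ).map_zero]
      exact Submodule.zero_mem _
    · rw [(isSDer_totD μ).map_smul]
      exact Submodule.smul_mem _ _ (Submodule.subset_span ⟨(μ, insert ν M), rfl⟩)
  | zero => rw [(isSDer_tθ ν).map_zero]; exact Submodule.zero_mem _
  | add x y _ _ hx hy => rw [(isSDer_tθ ν).map_add]; exact Submodule.add_mem _ hx hy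
  | smul c x _ hx => rw [(isSDer_tθ ν).map_smul]; exact Submodule.smul_mem _ c hx

/-- Each exchange of s̃^P with one ∂^θ costs a sign and a term ∂_ν ∂^θ_M f; the remaining ∂^θ
preserve the span of such terms. -/
theorem sTP_iterSkew (hS : ∀ A, IsHomog (p A + 1) (S A)) (N : Finset (Fin n))
    (f : PF (Fin n) n (Jet.parity n p)) :
    sTP S (iterSkew tθ N f) - sgn (N.card : ZMod 2) • iterSkew tθ N (sTP S f) ∈ derSpan f := by
  induction N using Finset.induction_on_min with
  | empty => simp [iterSkew_empty]
  | insert a N ha ih =>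
    have haN : a ∉ N := fun h => lt_irrefl _ (ha a h)
    have h1 : totD a (iterSkew tθ N f) ∈ derSpan f := Submodule.subset_span ⟨(a, N), rfl⟩
    convert Submodule.sub_mem _ h1 (tθ_mem_derSpan a f ih) using 1
    rw [iterSkew_insert tθ ha, iterSkew_insert tθ ha, sTP_tθ hS, (isSDer_tθ a).map_sub,
      (isSDer_tθ a).map_smul, Finset.card_insert_of_notMem haN, Nat.cast_succ, sgn_add, sgn_one,
      mul_neg_one, neg_smul]
    abel

end ParentDifferential

end ZF

namespace ZF

open SuperAlgebra

/-! ### The form of the parent differential -/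

section Vert

variable {T : Type} {n : ℕ} {Z : Type u} {p : Z → ZMod 2}

theorem isHomog_thetaZero {a : ZMod 2} {f : ZF (Fin n) n p} (hf : IsHomog a f) :
    IsHomog a (thetaZero f) := by
  have h : σ f = sgn a • f := hf
  unfold IsHomog
  rw [← thetaZero_σ, h, map_smul]

theorem thetaZero_vert {a : ZMod 2} {c : Z → ZF (Fin n) n p} {c' : Z → ZF Empty n p}
    (hc : ∀ z, IsHomog (p z + a) (c z)) (hcc : ∀ z, thetaZero (c z) = c' z)
    (f : ZF (Fin n) n p) : thetaZero (vert c f) = vert c' (thetaZero f) := by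
  have hc' : ∀ z, IsHomog (p z + a) (c' z) := fun z => hcc z ▸ isHomog_thetaZero (hc z)
  refine map_eq (isSDer_vert hc) (isSDer_vert hc') thetaZero_σ (fun μ => ?_) (fun μ => ?_)
    (fun z => ?_) f
  · rw [vert_cx, thetaZero_cx, vert_cx, map_zero]
  · rw [vert_cθ, thetaZero_cθ, (isSDer_vert hc').map_zero, map_zero]
  · rw [vert_cz, thetaZero_cz, vert_cz, hcc]

theorem inclTheta_vert {a : ZMod 2} {c : Z → ZF Empty n p} {c' : Z → ZF T n p}
    (hc : ∀ z, IsHomog (p z + a) (c z)) (hcc : ∀ z, inclTheta T (c z) = c' z)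
    (f : ZF Empty n p) : inclTheta T (vert c f) = vert c' (inclTheta T f) := by
  have hc' : ∀ z, IsHomog (p z + a) (c' z) := fun z => hcc z ▸ isHomog_inclTheta (hc z)
  refine map_eq (isSDer_vert hc) (isSDer_vert hc') inclTheta_σ (fun μ => ?_) (fun t => t.elim)
    (fun z => ?_) f
  · rw [vert_cx, inclTheta_cx, vert_cx, map_zero]
  · rw [vert_cz, inclTheta_cz, vert_cz, hcc]

theorem inclTheta_dx (μ : Fin n) (f : ZF Empty n p) :
    inclTheta T (dx μ f) = dx μ (inclTheta T f) := by
  refine map_eq (isSDer_dx μ) (isSDer_dx μ) inclTheta_σ (fun κ => ?_) (fun t => t.elim)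
    (fun z => ?_) f
  · rw [inclTheta_cx, dx_cx, dx_cx]
    split <;> simp
  · rw [inclTheta_cz, dx_cz, dx_cz, map_zero]

theorem thetaZero_pz (z : Z) (m : Fin n → ℕ) (N : Finset (Fin n)) :
    thetaZero (pz (Fin n) p z m N) = pz Empty p z m N := thetaZero_cz _

theorem inclTheta_pz (z : Z) (m : Fin n → ℕ) (N : Finset (Fin n)) :
    inclTheta T (pz Empty p z m N) = pz T p z m N := inclTheta_cz _

theorem isHomog_fθ_component (ν : Fin n) (a : Jet n (Desc n Z)) :
    IsHomog (Jet.parity n (Desc.parity n p) a + 1) (if ν ∈ a.1.2 then 0 else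
      (sgn (p a.1.1) * BRSTTheory.moveSign ν a.1.2) • pz T p a.1.1 a.2 (insert ν a.1.2)) := by
  have := (isSDer_fθ ν).isHomog (isHomog_pz (T := T) (p := p) a.1.1 a.2 a.1.2)
  rwa [fθ_pz, add_comm (1 : ZMod 2)] at this

theorem thetaZero_fθ (ν : Fin n) (f : PF (Fin n) n p) :
    thetaZero (fθ ν f) = fθ ν (thetaZero f) :=
  thetaZero_vert (isHomog_fθ_component ν) (fun a => by
    split
    · rw [map_zero]
    · rw [map_smul, thetaZero_pz]) f

theorem inclTheta_fθ (ν : Fin n) (f : PF Empty n p) :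
    inclTheta T (fθ ν f) = fθ ν (inclTheta T f) :=
  inclTheta_vert (isHomog_fθ_component ν) (fun a => by
    split
    · rw [map_zero]
    · rw [map_smul, inclTheta_pz]) f

/-- A function without explicit θ does not see ∂/∂θ^ν, so only the field part of the total
θ-derivative acts. -/
theorem inclTheta_fθ_eq_tθ (ν : Fin n) (f : PF Empty n p) :
    inclTheta (Fin n) (fθ ν f) = tθ ν (inclTheta (Fin n) f) := by
  refine map_eq (isSDer_fθ ν) (isSDer_tθ ν) inclTheta_σ (fun κ => ?_) (fun t => t.elim)
    (fun a => ?_) f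
  · change inclTheta (Fin n) (fθ ν (px Empty p κ)) = tθ ν (inclTheta (Fin n) (cx Empty _ κ))
    rw [fθ_px, inclTheta_cx, map_zero]
    exact (tθ_px ν κ).symm
  · obtain ⟨⟨z, N⟩, m⟩ := a
    change inclTheta (Fin n) (fθ ν (pz Empty p z m N)) =
      tθ ν (inclTheta (Fin n) (pz Empty p z m N))
    rw [fθ_pz, inclTheta_pz, tθ_pz]
    split
    · rw [map_zero]
    · rw [map_smul, inclTheta_pz]

theorem iterSkew_tθ_inclTheta (N : Finset (Fin n)) (f : PF Empty n p) :
    iterSkew tθ N (inclTheta (Fin n) f) = iterSkew fθ N (inclTheta (Fin n) f) := by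
  rw [← map_iterSkew (h := inclTheta (Fin n)) inclTheta_fθ_eq_tθ,
    ← map_iterSkew (h := inclTheta (Fin n)) inclTheta_fθ]

theorem bar_inclTheta (f : ZF Empty n p) :
    bar T n p (inclTheta T f) = inclTheta T (bar Empty n p f) := by
  have : (bar T n p).comp (inclTheta T) = (inclTheta T).comp (bar Empty n p) :=
    hom_ext (fun μ => by
        rw [AlgHom.comp_apply, AlgHom.comp_apply, inclTheta_cx, bar_cx, bar_cx]
        exact (inclTheta_cx μ).symm)
      (fun t => t.elim)
      (fun z => by
        rw [AlgHom.comp_apply, AlgHom.comp_apply, inclTheta_cz, bar_cz, bar_cz, inclTheta_pz])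
  exact DFunLike.congr_fun this f

theorem inclTheta_empty (f : ZF Empty n p) : inclTheta Empty f = f := by
  have : inclTheta Empty = AlgHom.id ℝ (ZF Empty n p) :=
    hom_ext inclTheta_cx (fun t => t.elim) inclTheta_cz
  exact DFunLike.congr_fun this f

/-- Only the factor ∂^θ_μ can strike θ^μ, and at most once. `moveSign` is the sign of bringing that
factor to the front of the sequence N. In part (i) the struck terms become d^F and σ^F. -/
theorem iterSkew_tθ_pθ_mul (μ : Fin n) (N : Finset (Fin n)) (f : PF (Fin n) n p) :
    iterSkew tθ N (pθ n p μ * f) = sgn (N.card : ZMod 2) • (pθ n p μ * iterSkew tθ N f) -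
      if μ ∈ N then (sgn (N.card : ZMod 2) * BRSTTheory.moveSign μ N) •
        iterSkew tθ (N.erase μ) f else 0 := by
  induction N using Finset.induction_on_min with
  | empty => simp [iterSkew_empty]
  | insert a N ha ih =>
    have haN : a ∉ N := fun h => lt_irrefl _ (ha a h)
    rw [iterSkew_insert tθ ha, iterSkew_insert tθ ha, ih, (isSDer_tθ a).map_sub,
      (isSDer_tθ a).map_smul, tθ_pθ_mul, Finset.card_insert_of_notMem haN, Nat.cast_succ,
      sgn_add, sgn_one, mul_neg_one, neg_smul, neg_mul, moveSign_insert haN]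
    obtain rfl | hne := eq_or_ne a μ
    · rw [if_pos rfl, if_neg haN, (isSDer_tθ a).map_zero, if_pos (Finset.mem_insert_self _ _),
        Finset.erase_insert haN, if_neg (lt_irrefl a), moveSign_of_lt ha, mul_one, neg_smul,
        smul_sub]
      abel
    · rw [if_neg hne]
      by_cases hμ : μ ∈ N
      · have h2 : ∀ b ∈ N.erase μ, a < b := fun b hb => ha b (Finset.mem_of_mem_erase hb)
        rw [if_pos hμ, if_pos (Finset.mem_insert_of_mem hμ), if_pos (ha μ hμ),
          (isSDer_tθ a).map_smul, Finset.erase_insert_of_ne hne, iterSkew_insert tθ h2, zero_sub,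
          smul_neg, mul_neg, neg_neg]
      · rw [if_neg hμ, if_neg (by simp [hne.symm, hμ]), (isSDer_tθ a).map_zero, zero_sub, smul_neg]

end Vert

/-! ### The y-derivatives, d^F, σ^F and s̄, and the proof of (i) and (ii). -/

section Parent

variable {T : Type} {n : ℕ} {ι : Type u} {p : ι → ZMod 2} {S : ι → JF Empty n p}

/-- `∂^F/∂y^κ`. -/
def fy (κ : Fin n) : PF T n (Jet.parity n p) → PF T n (Jet.parity n p) :=
  vert fun a => pz T (Jet.parity n p) (a.1.1.1, a.1.1.2 + Pi.single κ 1) a.2 a.1.2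

theorem isHomog_fy_component (κ : Fin n) (a : Jet n (Desc n (Jet n ι))) :
    IsHomog (Jet.parity n (Desc.parity n (Jet.parity n p)) a + 0)
      (pz T (Jet.parity n p) (a.1.1.1, a.1.1.2 + Pi.single κ 1) a.2 a.1.2) := by
  rw [add_zero]
  exact isHomog_pz (p := Jet.parity n p) _ _ _

theorem isSDer_fy (κ : Fin n) :
    IsSDer 0 (fy κ : PF T n (Jet.parity n p) → PF T n (Jet.parity n p)) :=
  isSDer_vert (isHomog_fy_component κ)

theorem fy_pz (κ : Fin n) (z : Jet n ι) (m : Fin n → ℕ) (N : Finset (Fin n)) :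
    fy κ (pz T (Jet.parity n p) z m N) =
      pz T (Jet.parity n p) (z.1, z.2 + Pi.single κ 1) m N := vert_cz _ _

/-- The `y`-derivative `∂/∂x^κ + ∂^F/∂y^κ`. -/
def dy (κ : Fin n) (f : PF T n (Jet.parity n p)) : PF T n (Jet.parity n p) := dx κ f + fy κ f

theorem isSDer_dy (κ : Fin n) :
    IsSDer 0 (dy κ : PF T n (Jet.parity n p) → PF T n (Jet.parity n p)) :=
  (isSDer_dx κ).add (isSDer_fy κ)

theorem dy_px (κ μ : Fin n) : dy κ (px T (Jet.parity n p) μ) = if κ = μ then 1 else 0 :=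
  (congrArg₂ (· + ·) (dx_cx κ μ) (vert_cx _ μ)).trans (add_zero _)

theorem dy_pθ (κ : Fin n) (t : T) : dy κ (pθ n (Jet.parity n p) t) = 0 :=
  (congrArg₂ (· + ·) (dx_cθ κ t) (vert_cθ _ t)).trans (add_zero _)

theorem dy_pz (κ : Fin n) (z : Jet n ι) (m : Fin n → ℕ) (N : Finset (Fin n)) :
    dy κ (pz T (Jet.parity n p) z m N) =
      pz T (Jet.parity n p) (z.1, z.2 + Pi.single κ 1) m N :=
  (congrArg₂ (· + ·) (dx_cz κ _) (fy_pz κ z m N)).trans (zero_add _)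

theorem bar_totD (μ : Fin n) (f : JF T n p) :
    bar T n _ (totD μ f) = dy μ (bar T n _ f) := by
  refine map_eq (isSDer_totD μ) (isSDer_dy μ) bar_σ (fun κ => ?_) (fun t => ?_) (fun z => ?_) f
  · rw [totD_cx, bar_cx, dy_px]
    split <;> simp
  · rw [totD_cθ, bar_cθ, dy_pθ, map_zero]
  · rw [bar_cz, totD_cz, dy_pz, bar_cz]

theorem inclTheta_dy (κ : Fin n) (f : PF Empty n (Jet.parity n p)) :
    inclTheta T (dy κ f) = dy κ (inclTheta T f) := by
  unfold dy
  rw [map_add, inclTheta_dx]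
  exact congrArg _ (inclTheta_vert (isHomog_fy_component κ) (fun a => inclTheta_pz _ _ _) f)

/-- `d^F`. -/
def dF : PF T n (Jet.parity n p) → PF T n (Jet.parity n p) :=
  vert fun a => ∑ ν ∈ a.1.2, (sgn (p a.1.1.1) * BRSTTheory.moveSign ν a.1.2) •
    pz T (Jet.parity n p) a.1.1 (a.2 + Pi.single ν 1) (a.1.2.erase ν)

/-- `σ^F`. -/
def sigmaF : PF T n (Jet.parity n p) → PF T n (Jet.parity n p) :=
  vert fun a => ∑ ν ∈ a.1.2, (sgn (p a.1.1.1) * BRSTTheory.moveSign ν a.1.2) •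
    pz T (Jet.parity n p) (a.1.1.1, a.1.1.2 + Pi.single ν 1) a.2 (a.1.2.erase ν)

theorem isHomog_sum_erase (c : Fin n → ℝ) (z : Fin n → Jet n ι) (m : Fin n → Fin n → ℕ)
    (N : Finset (Fin n)) {a : ZMod 2} (hz : ∀ ν, Jet.parity n p (z ν) = a) :
    IsHomog (a + N.card + 1) (∑ ν ∈ N, c ν • pz T (Jet.parity n p) (z ν) (m ν) (N.erase ν)) := by
  refine IsHomog.sum fun ν hν => IsHomog.smul ?_ _
  have h := isHomog_pz (T := T) (p := Jet.parity n p) (z ν) (m ν) (N.erase ν)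
  have h2 : (N.card : ZMod 2) = (N.erase ν).card + 1 := by
    rw [← Finset.card_erase_add_one hν, Nat.cast_succ]
  -- Modulo 2, erasing an index shifts the parity just as adding one does.
  have h3 : (1 : ZMod 2) + 1 = 0 := by decide
  rwa [h2, add_assoc, add_assoc, h3, add_zero, ← hz ν]

theorem isHomog_dF_component (a : Jet n (Desc n (Jet n ι))) :
    IsHomog (Jet.parity n (Desc.parity n (Jet.parity n p)) a + 1)
      (∑ ν ∈ a.1.2, (sgn (p a.1.1.1) * BRSTTheory.moveSign ν a.1.2) •
        pz T (Jet.parity n p) a.1.1 (a.2 + Pi.single ν 1) (a.1.2.erase ν)) :=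
  isHomog_sum_erase _ (fun _ => a.1.1) _ a.1.2 fun _ => rfl

theorem isHomog_sigmaF_component (a : Jet n (Desc n (Jet n ι))) :
    IsHomog (Jet.parity n (Desc.parity n (Jet.parity n p)) a + 1)
      (∑ ν ∈ a.1.2, (sgn (p a.1.1.1) * BRSTTheory.moveSign ν a.1.2) •
        pz T (Jet.parity n p) (a.1.1.1, a.1.1.2 + Pi.single ν 1) a.2 (a.1.2.erase ν)) :=
  isHomog_sum_erase _ (fun ν => (a.1.1.1, a.1.1.2 + Pi.single ν 1)) _ a.1.2 fun _ => rfl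

theorem isSDer_dF : IsSDer 1 (dF : PF T n (Jet.parity n p) → PF T n (Jet.parity n p)) :=
  isSDer_vert isHomog_dF_component

theorem isSDer_sigmaF : IsSDer 1 (sigmaF : PF T n (Jet.parity n p) → PF T n (Jet.parity n p)) :=
  isSDer_vert isHomog_sigmaF_component

theorem thetaZero_dF (f : PF (Fin n) n (Jet.parity n p)) :
    thetaZero (dF f) = dF (thetaZero f) :=
  thetaZero_vert isHomog_dF_component (fun a => by
    simp only [map_sum, map_smul, thetaZero_pz]) f

theorem thetaZero_sigmaF (f : PF (Fin n) n (Jet.parity n p)) :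
    thetaZero (sigmaF f) = sigmaF (thetaZero f) :=
  thetaZero_vert isHomog_sigmaF_component (fun a => by
    simp only [map_sum, map_smul, thetaZero_pz]) f

/-- The characteristic of `s̄`. -/
def charB (T : Type) (S : ι → JF Empty n p) (z : Jet n ι) : PF T n (Jet.parity n p) :=
  iterSym dy z.2 (bar T n _ (inclTheta T (S z.1)))

/-- The vector field `s̄`. -/
def sB (T : Type) (S : ι → JF Empty n p) :
    PF T n (Jet.parity n p) → PF T n (Jet.parity n p) := prol fθ (charB T S)

theorem isHomog_charB (hS : ∀ A, IsHomog (p A + 1) (S A)) (z : Jet n ι) :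
    IsHomog (Jet.parity n p z + 1) (charB T S z) :=
  isHomog_iterSym isSDer_dy z.2 (isHomog_bar (isHomog_inclTheta (hS z.1)))

theorem charB_eq (z : Jet n ι) : charB T S z = inclTheta T (charB Empty S z) := by
  unfold charB
  rw [bar_inclTheta, map_iterSym (h := inclTheta T) inclTheta_dy, inclTheta_empty]

theorem isSDer_sB (hS : ∀ A, IsHomog (p A + 1) (S A)) : IsSDer 1 (sB T S) :=
  isSDer_prol isSDer_fθ (isHomog_charB hS)

theorem thetaZero_sB (hS : ∀ A, IsHomog (p A + 1) (S A)) (f : PF (Fin n) n (Jet.parity n p)) :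
    thetaZero (sB (Fin n) S f) = sB Empty S (thetaZero f) := by
  have h1 : ∀ z, thetaZero (charB (Fin n) S z) = charB Empty S z := fun z => by
    rw [charB_eq, thetaZero_inclTheta]
  refine thetaZero_vert (a := 1) (fun a => IsHomog.smul ?_ _) (fun a => ?_) f
  · have := isHomog_iterSkew isSDer_fθ a.1.2
      (isHomog_iterSym isSDer_totD a.2 (isHomog_charB (T := Fin n) hS a.1.1))
    rwa [add_right_comm] at this
  · rw [map_smul, map_iterSkew (h := thetaZero) thetaZero_fθ,
      map_iterSym (h := thetaZero) thetaZero_totD, h1]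

/-- The characteristic of s̄ and its x-derivatives are free of explicit θ, which is why prolonging
by ∂^θ or by ∂^F/∂θ gives the same s̄. -/
theorem iterSkew_tθ_charB (m : Fin n → ℕ) (N : Finset (Fin n)) (z : Jet n ι) :
    iterSkew tθ N (iterSym totD m (charB (Fin n) S z)) =
      iterSkew fθ N (iterSym totD m (charB (Fin n) S z)) := by
  rw [charB_eq, ← map_iterSym (h := inclTheta (Fin n)) inclTheta_totD, iterSkew_tθ_inclTheta]

/-- The bar map turns the total derivatives in s̃ into y-derivatives, whereas the subtracted θ^μ ∂_μ
acts by x-derivatives; their difference remains. -/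
theorem charP_eq (z : Jet n ι) : charP S z =
    ∑ μ, pθ n (Jet.parity n p) μ * (pz (Fin n) (Jet.parity n p) (z.1, z.2 + Pi.single μ 1) 0 ∅ -
      pz (Fin n) (Jet.parity n p) z (Pi.single μ 1) ∅) + charB (Fin n) S z := by
  have h1 : bar (Fin n) n _ (ev (Fin n) S (cz (Fin n) n _ z)) = charB (Fin n) S z := by
    unfold ev
    rw [vert_cz, map_iterSym (h := bar (Fin n) n _) bar_totD]
    rfl
  have h2 : bar (Fin n) n _ (thetaD (cz (Fin n) n (Jet.parity n p) z)) =
      ∑ μ, pθ n (Jet.parity n p) μ *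
        pz (Fin n) (Jet.parity n p) (z.1, z.2 + Pi.single μ 1) 0 ∅ := by
    obtain ⟨A, l⟩ := z
    unfold thetaD
    simp only [map_sum, map_mul, bar_cθ, totD_cz, bar_cz]
  have h3 : thetaD (pz (Fin n) (Jet.parity n p) z 0 ∅) = ∑ μ, pθ n (Jet.parity n p) μ *
        pz (Fin n) (Jet.parity n p) z (Pi.single μ 1) ∅ := by
    refine Finset.sum_congr rfl fun μ _ => ?_
    rw [totD_pz, zero_add]
    rfl
  rw [charP, sT, map_add, h1, h2, h3]
  simp only [mul_sub, Finset.sum_sub_distrib]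
  abel

theorem iterSym_totD_pθ_mul {Z : Type u} {p : Z → ZMod 2} (m : Fin n → ℕ) (t : T)
    (f : PF T n p) : iterSym totD m (pθ n p t * f) = pθ n p t * iterSym totD m f := by
  refine (map_iterSym (h := fun f => pθ n p t * f) (fun μ f => ?_) m f).symm
  rw [(isSDer_totD μ).map_mul, totD_pθ, zero_mul, zero_add, signAut_zero, AlgHom.id_apply]

theorem iterSkew_tθ_sum {Z : Type u} {p : Z → ZMod 2} (N : Finset (Fin n))
    (f : Fin n → PF (Fin n) n p) : iterSkew tθ N (∑ μ, f μ) = ∑ μ, iterSkew tθ N (f μ) :=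
  (isLinearMap_iterSkew isLinearMap_tθ N).map_sum' _ _

/-- The terms with a surviving θ^μ keep the index set N, and those where it was struck lose μ; in
the former all signs from commuting and from descendants cancel in pairs, in the latter (-1)^A times
`moveSign` remains, as in the definitions of d^F and σ^F. -/
theorem iterSkew_tθ_charP (m : Fin n → ℕ) (N : Finset (Fin n)) (z : Jet n ι) :
    sgn (N.card * (Jet.parity n p z + 1)) • iterSkew tθ N (iterSym totD m (charP S z)) =
    ∑ μ, (pθ n (Jet.parity n p) μ * (pz (Fin n) (Jet.parity n p) (z.1, z.2 + Pi.single μ 1) m N -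
        pz (Fin n) (Jet.parity n p) z (m + Pi.single μ 1) N) +
      if μ ∈ N then (sgn (p z.1) * BRSTTheory.moveSign μ N) •
        (pz (Fin n) (Jet.parity n p) z (m + Pi.single μ 1) (N.erase μ) -
          pz (Fin n) (Jet.parity n p) (z.1, z.2 + Pi.single μ 1) m (N.erase μ)) else 0) +
      sgn (N.card * (Jet.parity n p z + 1)) •
        iterSkew fθ N (iterSym totD m (charB (Fin n) S z)) := by
  have hsym := isLinearMap_iterSym
    (fun μ => isLinearMap_of_isSDer (isSDer_totD (T := Fin n) (n := n)
      (p := Desc.parity n (Jet.parity n p)) μ)) m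
  have hskew : ∀ N, IsLinearMap ℝ (iterSkew (tθ (n := n) (p := Jet.parity n p)) N) :=
    isLinearMap_iterSkew isLinearMap_tθ
  rw [charP_eq, hsym.map_add, (hskew N).map_add, iterSkew_tθ_charB, smul_add, hsym.map_sum',
    iterSkew_tθ_sum, Finset.smul_sum]
  congr 1
  refine Finset.sum_congr rfl fun μ _ => ?_
  rw [iterSym_totD_pθ_mul, hsym.map_sub, iterSym_totD_pz, iterSym_totD_pz, zero_add,
    add_comm (Pi.single μ 1) m, iterSkew_tθ_pθ_mul, (hskew N).map_sub, (hskew _).map_sub,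
    iterSkew_tθ_pz, iterSkew_tθ_pz, iterSkew_tθ_pz, iterSkew_tθ_pz, smul_sub, sub_eq_add_neg]
  have hz : Jet.parity n p (z.1, z.2 + Pi.single μ 1) = p z.1 := rfl
  have hz' : Jet.parity n p z = p z.1 := rfl
  rw [hz', hz, ← smul_sub, ← smul_sub, mul_smul_comm, smul_smul, smul_smul]
  congr 1
  · rw [mul_add, mul_one, sgn_add]
    have h1 := sgn_mul_self (N.card * p z.1)
    have h2 := sgn_mul_self (N.card : ZMod 2)
    rw [show sgn (N.card * p z.1) * sgn N.card * sgn N.card * sgn (N.card * p z.1) = 1 by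
      linear_combination sgn (N.card * p z.1) * sgn (N.card * p z.1) * h2 + h1, one_smul]
  · split
    · rename_i hμ
      rw [smul_smul, smul_smul, ← smul_neg, neg_sub, ← Finset.card_erase_add_one hμ, Nat.cast_succ]
      congr 1
      generalize ((N.erase μ).card : ZMod 2) = k
      rw [mul_add, mul_one, sgn_add, add_mul, sgn_add, one_mul]
      linear_combination (sgn (p z.1) * BRSTTheory.moveSign μ N) *
        (sgn (k + 1) * sgn (k + 1) * sgn_mul_self (k * p z.1) + sgn_mul_self (k + 1))
    · rw [smul_zero, neg_zero]

/-- On Ψ the x-derivative in the characteristic cancels against θ^μ ∂_μ, so only the y-derivative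
multiplies θ^μ. -/
theorem sTP_eq (hS : ∀ A, IsHomog (p A + 1) (S A)) (f : PF (Fin n) n (Jet.parity n p)) :
    sTP S f = ∑ μ, pθ n (Jet.parity n p) μ * dy μ f + dF f - sigmaF f + sB (Fin n) S f := by
  refine der_ext (isSDer_sTP hS)
    ((((isSDer_sum_cθ_mul isSDer_dy).add isSDer_dF).sub isSDer_sigmaF).add (isSDer_sB hS))
    (fun μ => ?_) (fun μ => ?_) (fun a => ?_) f
  · change sTP S (px (Fin n) _ μ) = ∑ κ, pθ n _ κ * dy κ (px (Fin n) _ μ) +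
      dF (px (Fin n) _ μ) - sigmaF (px (Fin n) _ μ) + sB (Fin n) S (px (Fin n) _ μ)
    have h1 : thetaD (px (Fin n) (Jet.parity n p) μ) = pθ n _ μ := thetaD_cx μ
    have h2 : dF (px (Fin n) (Jet.parity n p) μ) = 0 := vert_cx _ _
    have h3 : sigmaF (px (Fin n) (Jet.parity n p) μ) = 0 := vert_cx _ _
    rw [sTP, sB, h1, h2, h3, prol_px, prol_px]
    simp only [dy_px, mul_ite, mul_one, mul_zero, Finset.sum_ite_eq', Finset.mem_univ, if_true,
      add_zero, sub_zero]
  · change sTP S (pθ n _ μ) = ∑ κ, pθ n _ κ * dy κ (pθ n _ μ) +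
      dF (pθ n _ μ) - sigmaF (pθ n _ μ) + sB (Fin n) S (pθ n _ μ)
    have h1 : thetaD (pθ n (Jet.parity n p) μ) = 0 := thetaD_cθ μ
    have h2 : dF (pθ n (Jet.parity n p) μ) = 0 := vert_cθ _ _
    have h3 : sigmaF (pθ n (Jet.parity n p) μ) = 0 := vert_cθ _ _
    rw [sTP, sB, h1, h2, h3, prol_pθ, prol_pθ]
    simp only [dy_pθ, mul_zero, Finset.sum_const_zero, add_zero, sub_zero]
  · obtain ⟨⟨z, N⟩, m⟩ := a
    change sTP S (pz (Fin n) _ z m N) = ∑ κ, pθ n _ κ * dy κ (pz (Fin n) _ z m N) +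
      dF (pz (Fin n) _ z m N) - sigmaF (pz (Fin n) _ z m N) + sB (Fin n) S (pz (Fin n) _ z m N)
    have h1 : thetaD (pz (Fin n) (Jet.parity n p) z m N) =
        ∑ μ, pθ n (Jet.parity n p) μ * pz (Fin n) (Jet.parity n p) z (m + Pi.single μ 1) N :=
      Finset.sum_congr rfl fun μ _ => by rw [totD_pz]; rfl
    have h2 : dF (pz (Fin n) (Jet.parity n p) z m N) =
        ∑ ν ∈ N, (sgn (p z.1) * BRSTTheory.moveSign ν N) •
          pz (Fin n) (Jet.parity n p) z (m + Pi.single ν 1) (N.erase ν) := vert_cz _ _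
    have h3 : sigmaF (pz (Fin n) (Jet.parity n p) z m N) =
        ∑ ν ∈ N, (sgn (p z.1) * BRSTTheory.moveSign ν N) •
          pz (Fin n) (Jet.parity n p) (z.1, z.2 + Pi.single ν 1) m (N.erase ν) := vert_cz _ _
    rw [sTP, sB, h1, h2, h3, prol_pz, prol_pz, iterSkew_tθ_charP, Finset.sum_add_distrib,
      Finset.sum_ite_mem, Finset.univ_inter]
    simp only [dy_pz, mul_sub, smul_sub, Finset.sum_sub_distrib]
    abel

theorem thetaZero_sTP (hS : ∀ A, IsHomog (p A + 1) (S A)) (f : PF (Fin n) n (Jet.parity n p)) :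
    thetaZero (sTP S f) = dF (thetaZero f) - sigmaF (thetaZero f) + sB Empty S (thetaZero f) := by
  have h : ∀ μ, thetaZero (pθ n (Jet.parity n p) μ) = 0 := fun μ => thetaZero_cθ μ
  rw [sTP_eq hS, map_add, map_sub, map_add, thetaZero_dF, thetaZero_sigmaF, thetaZero_sB hS]
  simp only [map_sum, map_mul, h, zero_mul, Finset.sum_const_zero, zero_add]

end Parent

end ZF

namespace ZF

open SuperAlgebra

/-! ### Extension of a change of coordinates to the parent theory -/

section Extend

variable {n : ℕ} {Z : Type u} {p : Z → ZMod 2} {Z' : Type v} {p' : Z' → ZMod 2}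
  {Z'' : Type w} {p'' : Z'' → ZMod 2}

/-- `h` preserves the parity and leaves `x` and `θ` unchanged. -/
structure IsBaseHom (h : ZF (Fin n) n p →ₐ[ℝ] ZF (Fin n) n p') : Prop where
  map_σ : ∀ f, h (σ f) = σ (h f)
  map_cx : ∀ μ, h (cx (Fin n) p μ) = cx (Fin n) p' μ
  map_cθ : ∀ μ, h (cθ n p μ) = cθ n p' μ

theorem IsBaseHom.isHomog {h : ZF (Fin n) n p →ₐ[ℝ] ZF (Fin n) n p'} (hh : IsBaseHom h)
    {a : ZMod 2} {f : ZF (Fin n) n p} (hf : IsHomog a f) : IsHomog a (h f) := by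
  have h1 : σ f = sgn a • f := hf
  unfold IsHomog
  rw [← hh.map_σ, h1, map_smul]

theorem IsBaseHom.comp {h' : ZF (Fin n) n p' →ₐ[ℝ] ZF (Fin n) n p''}
    {h : ZF (Fin n) n p →ₐ[ℝ] ZF (Fin n) n p'} (hh' : IsBaseHom h') (hh : IsBaseHom h) :
    IsBaseHom (h'.comp h) where
  map_σ f := by rw [AlgHom.comp_apply, AlgHom.comp_apply, hh.map_σ, hh'.map_σ]
  map_cx μ := by rw [AlgHom.comp_apply, hh.map_cx, hh'.map_cx]
  map_cθ μ := by rw [AlgHom.comp_apply, hh.map_cθ, hh'.map_cθ]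

theorem IsBaseHom.id : IsBaseHom (AlgHom.id ℝ (ZF (Fin n) n p)) :=
  ⟨fun _ => rfl, fun _ => rfl, fun _ => rfl⟩

/-- The substitution of the descendants of `h z` for those of `z`. -/
def extend (h : ZF (Fin n) n p →ₐ[ℝ] ZF (Fin n) n p') (hh : IsBaseHom h) :
    PF (Fin n) n p →ₐ[ℝ] PF (Fin n) n p' :=
  SF.subst (fun i => match i with
    | .x μ => px (Fin n) p' μ
    | .theta μ => pθ n p' μ
    | .z a => sgn (a.1.2.card * p a.1.1) •
        iterSkew tθ a.1.2 (iterSym totD a.2 (bar (Fin n) n p' (h (cz (Fin n) n p a.1.1)))))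
    (by
      rintro (μ | μ | a)
      · exact isHomog_cx μ
      · exact isHomog_cθ μ
      · exact (isHomog_iterSkew isSDer_tθ a.1.2 (isHomog_iterSym isSDer_totD a.2
          (isHomog_bar (hh.isHomog (isHomog_cz a.1.1))))).smul _)

variable {h : ZF (Fin n) n p →ₐ[ℝ] ZF (Fin n) n p'} (hh : IsBaseHom h)

theorem extend_px (μ : Fin n) : extend h hh (px (Fin n) p μ) = px (Fin n) p' μ :=
  SF.subst_coord _ _ (Coord.x μ)

theorem extend_pθ (μ : Fin n) : extend h hh (pθ n p μ) = pθ n p' μ :=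
  SF.subst_coord _ _ (Coord.theta μ)

theorem extend_pz (z : Z) (m : Fin n → ℕ) (N : Finset (Fin n)) :
    extend h hh (pz (Fin n) p z m N) = sgn (N.card * p z) •
      iterSkew tθ N (iterSym totD m (bar (Fin n) n p' (h (cz (Fin n) n p z)))) :=
  SF.subst_coord _ _ _

theorem extend_σ (f : PF (Fin n) n p) : extend h hh (σ f) = σ (extend h hh f) :=
  SF.subst_σ _ _ f

theorem totD_iterSkew_tθ (μ : Fin n) (N : Finset (Fin n)) (f : PF (Fin n) n p) :
    totD μ (iterSkew tθ N f) = iterSkew tθ N (totD μ f) :=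
  map_iterSkew (h := totD μ) (fun ν f => totD_tθ μ ν f) N f

theorem extend_totD (μ : Fin n) (f : PF (Fin n) n p) :
    extend h hh (totD μ f) = totD μ (extend h hh f) := by
  refine map_eq (isSDer_totD μ) (isSDer_totD μ) (extend_σ hh) (fun κ => ?_) (fun κ => ?_)
    (fun a => ?_) f
  · change extend h hh (totD μ (px _ p κ)) = totD μ (extend h hh (px _ p κ))
    rw [totD_px, extend_px, totD_px]
    split <;> simp
  · change extend h hh (totD μ (pθ n p κ)) = totD μ (extend h hh (pθ n p κ))
    rw [totD_pθ, extend_pθ, totD_pθ, map_zero]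
  · obtain ⟨⟨z, N⟩, m⟩ := a
    change extend h hh (totD μ (pz _ p z m N)) = totD μ (extend h hh (pz _ p z m N))
    rw [totD_pz, extend_pz, extend_pz, (isSDer_totD μ).map_smul, totD_iterSkew_tθ,
      iterSym_add_single totD_comm]

theorem extend_tθ (ν : Fin n) (f : PF (Fin n) n p) :
    extend h hh (tθ ν f) = tθ ν (extend h hh f) := by
  refine map_eq (isSDer_tθ ν) (isSDer_tθ ν) (extend_σ hh) (fun κ => ?_) (fun κ => ?_)
    (fun a => ?_) f
  · change extend h hh (tθ ν (px _ p κ)) = tθ ν (extend h hh (px _ p κ))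
    rw [tθ_px, extend_px, tθ_px, map_zero]
  · change extend h hh (tθ ν (pθ n p κ)) = tθ ν (extend h hh (pθ n p κ))
    rw [tθ_pθ, extend_pθ, tθ_pθ]
    split <;> simp
  · obtain ⟨⟨z, N⟩, m⟩ := a
    change extend h hh (tθ ν (pz _ p z m N)) = tθ ν (extend h hh (pz _ p z m N))
    rw [tθ_pz, extend_pz, (isSDer_tθ ν).map_smul, tθ_iterSkew]
    split
    · rw [map_zero, smul_zero]
    · rename_i hν
      rw [map_smul, extend_pz, Finset.card_insert_of_notMem hν, smul_smul, smul_smul,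
        Nat.cast_succ, add_mul, one_mul, sgn_add]
      congr 1
      linear_combination (BRSTTheory.moveSign ν N * sgn (N.card * p z)) * sgn_mul_self (p z)

theorem extend_bar (f : ZF (Fin n) n p) :
    extend h hh (bar (Fin n) n p f) = bar (Fin n) n p' (h f) := by
  have : (extend h hh).comp (bar (Fin n) n p) = (bar (Fin n) n p').comp h := by
    refine hom_ext (fun μ => ?_) (fun μ => ?_) (fun z => ?_)
    · rw [AlgHom.comp_apply, AlgHom.comp_apply, bar_cx, extend_px, hh.map_cx, bar_cx]
    · rw [AlgHom.comp_apply, AlgHom.comp_apply, bar_cθ, extend_pθ, hh.map_cθ, bar_cθ]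
    · rw [AlgHom.comp_apply, AlgHom.comp_apply, bar_cz, extend_pz, Finset.card_empty,
        Nat.cast_zero, zero_mul, sgn_zero, one_smul, iterSkew_empty, iterSym_zero]
  exact DFunLike.congr_fun this f

/-- Extensions commute with ∂_μ and ∂^θ_ν, so composites are compared on superfields, where
`extend_bar` reduces them to the original homomorphisms. -/
theorem extend_comp {h' : ZF (Fin n) n p' →ₐ[ℝ] ZF (Fin n) n p''} (hh' : IsBaseHom h')
    (f : PF (Fin n) n p) :
    extend h' hh' (extend h hh f) = extend (h'.comp h) (hh'.comp hh) f := by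
  have : (extend h' hh').comp (extend h hh) = extend (h'.comp h) (hh'.comp hh) := by
    refine hom_ext (fun μ => ?_) (fun μ => ?_) (fun a => ?_)
    · change extend h' hh' (extend h hh (px _ p μ)) = extend _ (hh'.comp hh) (px _ p μ)
      rw [extend_px, extend_px, extend_px]
    · change extend h' hh' (extend h hh (pθ n p μ)) = extend _ (hh'.comp hh) (pθ n p μ)
      rw [extend_pθ, extend_pθ, extend_pθ]
    · obtain ⟨⟨z, N⟩, m⟩ := a
      change extend h' hh' (extend h hh (pz _ p z m N)) = extend _ (hh'.comp hh) (pz _ p z m N)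
      rw [extend_pz, extend_pz, map_smul, map_iterSkew (h := extend h' hh') (extend_tθ hh'),
        map_iterSym (h := extend h' hh') (extend_totD hh'), extend_bar, AlgHom.comp_apply]
  exact DFunLike.congr_fun this f

theorem extend_id (f : PF (Fin n) n p) : extend (AlgHom.id ℝ _) IsBaseHom.id f = f := by
  have : extend (AlgHom.id ℝ (ZF (Fin n) n p)) IsBaseHom.id = AlgHom.id ℝ _ := by
    refine hom_ext (extend_px _) (extend_pθ _) (fun a => ?_)
    obtain ⟨⟨z, N⟩, m⟩ := a
    change extend _ IsBaseHom.id (pz _ p z m N) = pz _ p z m N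
    rw [extend_pz, AlgHom.id_apply, bar_cz, iterSym_totD_pz, zero_add, iterSkew_tθ_pz, smul_smul,
      sgn_mul_self, one_smul]
  exact DFunLike.congr_fun this f

/-- The substitution of the descendants of `h z` at `θ = 0` for those of `z`. -/
def extendZero (h : ZF (Fin n) n p →ₐ[ℝ] ZF (Fin n) n p') (hh : IsBaseHom h) :
    PF Empty n p →ₐ[ℝ] PF Empty n p' :=
  (thetaZero.comp (extend h hh)).comp (inclTheta (Fin n))

theorem extendZero_apply (f : PF Empty n p) :
    extendZero h hh f = thetaZero (extend h hh (inclTheta (Fin n) f)) := rfl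

theorem thetaZero_px (μ : Fin n) : thetaZero (px (Fin n) p μ) = px Empty p μ := thetaZero_cx μ

theorem inclTheta_px (μ : Fin n) : inclTheta (Fin n) (px Empty p μ) = px (Fin n) p μ :=
  inclTheta_cx μ

theorem thetaZero_pθ (μ : Fin n) : thetaZero (pθ n p μ) = 0 := thetaZero_cθ μ

/-- Since θ^μ is sent to θ^μ, the extension descends to θ = 0, even though `h` may involve θ
explicitly. Functoriality is thereby inherited by `extendZero`. -/
theorem thetaZero_extend (f : PF (Fin n) n p) :
    thetaZero (extend h hh f) = extendZero h hh (thetaZero f) := by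
  have : thetaZero.comp (extend h hh) = (extendZero h hh).comp thetaZero := by
    refine hom_ext (fun μ => ?_) (fun μ => ?_) (fun a => ?_)
    · change thetaZero (extend h hh (px _ p μ)) = extendZero h hh (thetaZero (px _ p μ))
      rw [thetaZero_px, extendZero_apply, inclTheta_px]
    · change thetaZero (extend h hh (pθ n p μ)) = extendZero h hh (thetaZero (pθ n p μ))
      rw [thetaZero_pθ, extend_pθ, thetaZero_pθ, map_zero]
    · obtain ⟨⟨z, N⟩, m⟩ := a
      change thetaZero (extend h hh (pz _ p z m N)) = extendZero h hh (thetaZero (pz _ p z m N))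
      rw [thetaZero_pz, extendZero_apply, inclTheta_pz]
  exact DFunLike.congr_fun this f

theorem extendZero_comp {h' : ZF (Fin n) n p' →ₐ[ℝ] ZF (Fin n) n p''} (hh' : IsBaseHom h')
    (f : PF Empty n p) :
    extendZero h' hh' (extendZero h hh f) = extendZero (h'.comp h) (hh'.comp hh) f := by
  rw [extendZero_apply hh, ← thetaZero_extend, extend_comp]
  rfl

theorem extendZero_id (f : PF Empty n p) : extendZero (AlgHom.id ℝ _) IsBaseHom.id f = f := by
  rw [extendZero_apply, extend_id, thetaZero_inclTheta]

theorem extendZero_σ (f : PF Empty n p) : extendZero h hh (σ f) = σ (extendZero h hh f) := by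
  rw [extendZero_apply, inclTheta_σ, extend_σ, thetaZero_σ, extendZero_apply]

theorem extendZero_totD (μ : Fin n) (f : PF Empty n p) :
    extendZero h hh (totD μ f) = totD μ (extendZero h hh f) := by
  rw [extendZero_apply, inclTheta_totD, extend_totD, thetaZero_totD, extendZero_apply]

theorem extendZero_px (μ : Fin n) : extendZero h hh (px Empty p μ) = px Empty p' μ := by
  rw [extendZero_apply, inclTheta_px, extend_px, thetaZero_px]

theorem extendZero_pz (z : Z) (N : Finset (Fin n)) :
    extendZero h hh (pz Empty p z 0 N) = sgn (N.card * p z) •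
      thetaZero (iterSkew tθ N (bar (Fin n) n p' (h (cz (Fin n) n p z)))) := by
  rw [extendZero_apply, inclTheta_pz, extend_pz, iterSym_zero, map_smul]

/-- The change of coordinates of the parent theory at `θ = 0`. -/
def extendEquiv (e : ZF (Fin n) n p ≃ₐ[ℝ] ZF (Fin n) n p') (he : IsBaseHom e.toAlgHom)
    (he' : IsBaseHom e.symm.toAlgHom) : PF Empty n p ≃ₐ[ℝ] PF Empty n p' :=
  AlgEquiv.ofAlgHom (extendZero e.toAlgHom he) (extendZero e.symm.toAlgHom he')
    (AlgHom.ext fun f => by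
      have h1 : e.toAlgHom.comp e.symm.toAlgHom = AlgHom.id ℝ _ :=
        AlgHom.ext fun f => e.apply_symm_apply f
      have h2 := extendZero_comp he' he f
      simp only [h1] at h2
      exact h2.trans (extendZero_id f))
    (AlgHom.ext fun f => by
      have h1 : e.symm.toAlgHom.comp e.toAlgHom = AlgHom.id ℝ _ :=
        AlgHom.ext fun f => e.symm_apply_apply f
      have h2 := extendZero_comp he he' f
      simp only [h1] at h2
      exact h2.trans (extendZero_id f))

end Extend

/-! ### Relabelling and rescaling of fields -/

section Rescale

variable {T : Type} {n : ℕ} {F : Type u} {p : F → ZMod 2} {F' : Type v} {p' : F' → ZMod 2}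

/-- The change of fields that replaces the field `a` by `c a` times the field `γ a`. -/
def rescale (T : Type) (n : ℕ) (γ : F → F') (hγ : ∀ a, p' (γ a) = p a) (c : F → ℝ) :
    JF T n p →ₐ[ℝ] JF T n p' :=
  SF.subst (fun i => match i with
    | .x μ => cx T (Jet.parity n p') μ
    | .theta t => cθ n (Jet.parity n p') t
    | .z a => c a.1 • cz T n (Jet.parity n p') (γ a.1, a.2))
    (by
      rintro (μ | μ | a)
      · exact isHomog_cx μ
      · exact isHomog_cθ μ
      · have := isHomog_cz (T := T) (n := n) (p := Jet.parity n p') (γ a.1, a.2)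
        have h : Jet.parity n p' (γ a.1, a.2) = p a.1 := hγ a.1
        rw [h] at this
        exact this.smul _)

variable {γ : F → F'} {hγ : ∀ a, p' (γ a) = p a} {c : F → ℝ}

theorem rescale_cx (μ : Fin n) :
    rescale T n γ hγ c (cx T (Jet.parity n p) μ) = cx T (Jet.parity n p') μ :=
  SF.subst_coord _ _ _

theorem rescale_cθ (t : T) :
    rescale T n γ hγ c (cθ n (Jet.parity n p) t) = cθ n (Jet.parity n p') t :=
  SF.subst_coord _ _ _

theorem rescale_cz (a : F) (m : Fin n → ℕ) :
    rescale T n γ hγ c (cz T n (Jet.parity n p) (a, m)) =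
      c a • cz T n (Jet.parity n p') (γ a, m) :=
  SF.subst_coord _ _ _

theorem rescale_σ (f : JF T n p) :
    rescale T n γ hγ c (σ f) = σ (rescale T n γ hγ c f) := SF.subst_σ _ _ f

theorem rescale_totD (μ : Fin n) (f : JF T n p) :
    rescale T n γ hγ c (totD μ f) = totD μ (rescale T n γ hγ c f) := by
  refine map_eq (isSDer_totD μ) (isSDer_totD μ) rescale_σ (fun κ => ?_) (fun κ => ?_)
    (fun a => ?_) f
  · rw [rescale_cx, totD_cx, totD_cx]
    split <;> simp
  · rw [rescale_cθ, totD_cθ, totD_cθ, map_zero]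
  · rw [rescale_cz, totD_cz, rescale_cz, (isSDer_totD μ).map_smul, totD_cz]

theorem rescale_rescale {γ' : F' → F} {hγ' : ∀ a, p (γ' a) = p' a} {c' : F' → ℝ}
    (hg : ∀ a, γ' (γ a) = a) (hc : ∀ a, c a * c' (γ a) = 1) (f : JF T n p) :
    rescale T n γ' hγ' c' (rescale T n γ hγ c f) = f := by
  have : (rescale T n γ' hγ' c').comp (rescale T n γ hγ c) = AlgHom.id ℝ _ := by
    refine hom_ext (fun μ => ?_) (fun t => ?_) (fun a => ?_)
    · rw [AlgHom.comp_apply, rescale_cx, rescale_cx, AlgHom.id_apply]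
    · rw [AlgHom.comp_apply, rescale_cθ, rescale_cθ, AlgHom.id_apply]
    · rw [AlgHom.comp_apply, rescale_cz, map_smul, rescale_cz, hg, smul_smul, hc, one_smul,
        AlgHom.id_apply]
  exact DFunLike.congr_fun this f

/-- The invertible change of fields that replaces the field `a` by `c a` times the field `γ a`. -/
def rescaleEquiv (T : Type) (n : ℕ) (γ : F ≃ F') (hγ : ∀ a, p' (γ a) = p a) (c : F → ℝ)
    (hc : ∀ a, c a * c a = 1) : JF T n p ≃ₐ[ℝ] JF T n p' :=
  AlgEquiv.ofAlgHom (rescale T n γ hγ c)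
    (rescale T n γ.symm (fun a => by rw [← hγ, γ.apply_symm_apply]) fun a => c (γ.symm a))
    (AlgHom.ext fun f => rescale_rescale γ.apply_symm_apply (fun a => hc _) f)
    (AlgHom.ext fun f => rescale_rescale γ.symm_apply_apply
      (fun a => by rw [γ.symm_apply_apply, hc]) f)

end Rescale

end ZF

namespace ZF

open SuperAlgebra

/-! ### Descendants of trivial pairs -/

/-- The second family of generators may be altered modulo the ideal of the first: this is how s w
and v are exchanged modulo w. -/
theorem span_union_congr {R : Type u} [Ring R] {κ : Type v} {A : Set R} {b c : κ → R}
    (h : ∀ k, b k - c k ∈ Ideal.span A) :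
    Ideal.span (A ∪ Set.range b) = Ideal.span (A ∪ Set.range c) := by
  have key : ∀ {b c : κ → R}, (∀ k, b k - c k ∈ Ideal.span A) →
      Ideal.span (A ∪ Set.range b) ≤ Ideal.span (A ∪ Set.range c) := by
    intro b c h
    refine Ideal.span_le.2 (Set.union_subset (fun x hx => Ideal.subset_span (Or.inl hx)) ?_)
    rintro _ ⟨k, rfl⟩
    have h1 := Ideal.add_mem _ (Ideal.span_mono Set.subset_union_left (h k))
      (Ideal.subset_span (Or.inr ⟨k, rfl⟩) : c k ∈ Ideal.span (A ∪ Set.range c))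
    rwa [sub_add_cancel] at h1
  refine le_antisymm (key h) (key fun k => ?_)
  rw [← neg_sub]
  exact Submodule.neg_mem _ (h k)

section Descendants

variable {n : ℕ} {ι : Type u} {p : ι → ZMod 2} {S : ι → JF Empty n p}

/-- The BRST differential of the parent theory. -/
def sP (S : ι → JF Empty n p) (f : PF Empty n (Jet.parity n p)) : PF Empty n (Jet.parity n p) :=
  dF f - sigmaF f + sB Empty S f

/-- The descendant of `f` with index `N`. -/
def desc (f : JF (Fin n) n p) (N : Finset (Fin n)) : PF Empty n (Jet.parity n p) :=
  thetaZero (iterSkew tθ N (bar (Fin n) n _ f))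

/-- The commutation errors of s̃^P with the ∂^θ are x-derivatives of descendants of `f`, hence lie
in the ideal these generate. For f = w this says that s^P w_N and v_N agree modulo that ideal. -/
theorem iterSym_sP_desc (hS : ∀ A, IsHomog (p A + 1) (S A)) (f : JF (Fin n) n p)
    (N : Finset (Fin n)) (m : Fin n → ℕ) :
    iterSym totD m (sP S (desc f N)) -
        iterSym totD m (sgn (N.card : ZMod 2) • desc (sT S f) N) ∈
      Ideal.span (Set.range fun k : Finset (Fin n) × (Fin n → ℕ) =>
        iterSym totD k.2 (desc f k.1)) := by
  have hL := isLinearMap_iterSym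
    (fun μ => isLinearMap_of_isSDer (isSDer_totD (T := Empty) (n := n)
      (p := Desc.parity n (Jet.parity n p)) μ)) m
  -- Both terms are lifted to functions of θ: the first by part (ii), the second because bar
  -- intertwines s̃ and s̃^P.
  have h1 : sP S (desc f N) - sgn (N.card : ZMod 2) • desc (sT S f) N =
      thetaZero (sTP S (iterSkew tθ N (bar (Fin n) n _ f)) -
        sgn (N.card : ZMod 2) • iterSkew tθ N (sTP S (bar (Fin n) n _ f))) := by
    rw [map_sub, map_smul, thetaZero_sTP hS, ← bar_sT hS]
    rfl
  rw [← hL.map_sub, h1]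
  have h2 := sTP_iterSkew hS N (bar (Fin n) n _ f)
  generalize sTP S (iterSkew tθ N (bar (Fin n) n _ f)) -
    sgn (N.card : ZMod 2) • iterSkew tθ N (sTP S (bar (Fin n) n _ f)) = d at h2 ⊢
  induction h2 using Submodule.span_induction with
  | mem x hx =>
    obtain ⟨⟨ν, M⟩, rfl⟩ := hx
    change iterSym totD m (thetaZero (totD ν (iterSkew tθ M _))) ∈ _
    -- A further ∂_ν only raises the multi-index: ∂_(m) ∂_ν f_M is itself one of the generators.
    rw [thetaZero_totD, ← map_iterSym (h := totD ν) (fun μ g => totD_comm ν μ g),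
      ← iterSym_add_single totD_comm]
    exact Ideal.subset_span ⟨(M, m + Pi.single ν 1), rfl⟩
  | zero => rw [map_zero, hL.map_zero]; exact Ideal.zero_mem _
  | add x y _ _ hx hy => rw [map_add, hL.map_add]; exact Ideal.add_mem _ hx hy
  | smul c x _ hx =>
    rw [map_smul, hL.map_smul, Algebra.smul_def]
    exact Ideal.mul_mem_left _ _ hx

variable {Φ : Type v} {W : Type w} {pφ : Φ → ZMod 2} {pw : W → ZMod 2}

/-- Descendants of a disjoint union are the disjoint union of the descendants. -/
def descSum (n : ℕ) (Φ : Type v) (W : Type w) :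
    Desc n Φ ⊕ Desc n W ⊕ Desc n W ≃ Desc n (Φ ⊕ W ⊕ W) where
  toFun
    | .inl k => (.inl k.1, k.2)
    | .inr (.inl k) => (.inr (.inl k.1), k.2)
    | .inr (.inr k) => (.inr (.inr k.1), k.2)
  invFun
    | (.inl i, N) => .inl (i, N)
    | (.inr (.inl a), N) => .inr (.inl (a, N))
    | (.inr (.inr a), N) => .inr (.inr (a, N))
  left_inv := by rintro (_ | _ | _) <;> rfl
  right_inv := by rintro ⟨_ | _ | _, _⟩ <;> rfl

/-- The signs relating the coordinates `z_{[N]}` to the descendants of `z`. -/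
def descSign (pφ : Φ → ZMod 2) (pw : W → ZMod 2) : Desc n Φ ⊕ Desc n W ⊕ Desc n W → ℝ
  | .inl k => sgn (k.2.card * pφ k.1)
  | .inr (.inl k) => sgn (k.2.card * pw k.1)
  | .inr (.inr k) => sgn (k.2.card * pw k.1)

theorem parity_descSum (k : Desc n Φ ⊕ Desc n W ⊕ Desc n W) :
    Desc.parity n (splitParity pφ pw) (descSum n Φ W k) =
      splitParity (Desc.parity n pφ) (Desc.parity n pw) k := by
  rcases k with k | k | k
  · rfl
  · rfl
  · exact add_right_comm _ _ _

theorem descSign_mul_self (k : Desc n Φ ⊕ Desc n W ⊕ Desc n W) :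
    descSign pφ pw k * descSign pφ pw k = 1 := by
  rcases k with k | k | k <;> exact sgn_mul_self _

variable (e : ZF (Fin n) n (splitParity pφ pw) ≃ₐ[ℝ] JF (Fin n) n p)
  (he : IsBaseHom e.toAlgHom) (he' : IsBaseHom e.symm.toAlgHom)

/-- The change of fields of the parent theory to the descendants of `φ`, `w` and `v`. -/
def descEquiv : JF Empty n (splitParity (Desc.parity n pφ) (Desc.parity n pw)) ≃ₐ[ℝ]
    PF Empty n (Jet.parity n p) :=
  (rescaleEquiv Empty n (descSum n Φ W) parity_descSum (descSign pφ pw)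
    descSign_mul_self).trans (extendEquiv e he he')

theorem descEquiv_apply (f : JF Empty n (splitParity (Desc.parity n pφ) (Desc.parity n pw))) :
    descEquiv e he he' f = extendZero e.toAlgHom he
      (rescale Empty n (descSum n Φ W) parity_descSum (descSign pφ pw) f) := rfl

theorem descEquiv_σ (f : JF Empty n (splitParity (Desc.parity n pφ) (Desc.parity n pw))) :
    descEquiv e he he' (σ f) = σ (descEquiv e he he' f) := by
  rw [descEquiv_apply, rescale_σ, extendZero_σ, descEquiv_apply]

theorem descEquiv_cx (μ : Fin n) : descEquiv e he he' (cx Empty _ μ) = cx Empty _ μ := by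
  rw [descEquiv_apply, rescale_cx]
  exact extendZero_px he μ

theorem descEquiv_totD (μ : Fin n)
    (f : JF Empty n (splitParity (Desc.parity n pφ) (Desc.parity n pw))) :
    descEquiv e he he' (totD μ f) = totD μ (descEquiv e he he' f) := by
  rw [descEquiv_apply, rescale_totD, extendZero_totD, descEquiv_apply]

theorem descEquiv_cz (k : Desc n Φ ⊕ Desc n W ⊕ Desc n W) :
    descEquiv e he he' (cz Empty n _ (k, 0)) =
      (descSign pφ pw k * sgn ((descSum n Φ W k).2.card *
        splitParity pφ pw (descSum n Φ W k).1)) •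
        desc (e (cz (Fin n) n _ (descSum n Φ W k).1)) (descSum n Φ W k).2 := by
  rw [descEquiv_apply, rescale_cz, map_smul, mul_smul]
  exact congrArg _ (extendZero_pz he (descSum n Φ W k).1 (descSum n Φ W k).2)

theorem descEquiv_phi (k : Desc n Φ) : descEquiv e he he' (cz Empty n _ (.inl k, 0)) =
    desc (e (cz (Fin n) n _ (.inl k.1))) k.2 := by
  rw [descEquiv_cz]
  refine (congrArg₂ _ ?_ rfl).trans (one_smul ℝ _)
  exact sgn_mul_self _

theorem descEquiv_w (k : Desc n W) : descEquiv e he he' (cz Empty n _ (.inr (.inl k), 0)) =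
    desc (e (cz (Fin n) n _ (.inr (.inl k.1)))) k.2 := by
  rw [descEquiv_cz]
  refine (congrArg₂ _ ?_ rfl).trans (one_smul ℝ _)
  exact sgn_mul_self _

/-- The factor (-1)^k in the definition of v_N comes from here: `descSign` uses the parity of w for
v, while the lift of v carries the opposite parity. -/
theorem descEquiv_v (k : Desc n W) : descEquiv e he he' (cz Empty n _ (.inr (.inr k), 0)) =
    sgn (k.2.card : ZMod 2) • desc (e (cz (Fin n) n _ (.inr (.inr k.1)))) k.2 := by
  rw [descEquiv_cz]
  refine congrArg₂ _ ?_ rfl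
  change sgn (k.2.card * pw k.1) * sgn (k.2.card * (pw k.1 + 1)) = _
  rw [mul_add, mul_one, sgn_add, ← mul_assoc, sgn_mul_self, one_mul]

theorem sub_descEquiv_zero (g : Jet n (Desc n Φ) → Jet n (Desc n Φ ⊕ Desc n W ⊕ Desc n W))
    (hg : ∀ a, Jet.parity n (splitParity (Desc.parity n pφ) (Desc.parity n pw)) (g a) =
      Jet.parity n (Desc.parity n pφ) a) (f : PF Empty n (Jet.parity n p)) :
    f - descEquiv e he he' (renameZ Empty n g hg 0) = f := by
  rw [map_zero, map_zero, sub_zero]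

/-- The argument of `renameZ` is the choice V = 0, so the second system is v_N = 0, and its members
differ from those of s^P w_N = 0 by elements of the ideal of w. -/
theorem span_desc (hS : ∀ A, IsHomog (p A + 1) (S A)) (f g : W → JF (Fin n) n p)
    (hfg : ∀ a, sT S (f a) = g a)
    (r : Jet n (Desc n Φ) → Jet n (Desc n Φ ⊕ Desc n W ⊕ Desc n W))
    (hr : ∀ a, Jet.parity n (splitParity (Desc.parity n pφ) (Desc.parity n pw)) (r a) =
      Jet.parity n (Desc.parity n pφ) a) :
    Ideal.span (Set.range (fun k : Desc n W × (Fin n → ℕ) =>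
          iterSym totD k.2 (desc (f k.1.1) k.1.2)) ∪
        Set.range (fun k : Desc n W × (Fin n → ℕ) =>
          iterSym totD k.2 (sP S (desc (f k.1.1) k.1.2)))) =
      Ideal.span (Set.range (fun k : Desc n W × (Fin n → ℕ) =>
          iterSym totD k.2 (desc (f k.1.1) k.1.2)) ∪
        Set.range (fun k : Desc n W × (Fin n → ℕ) =>
          iterSym totD k.2 (sgn (k.1.2.card : ZMod 2) • desc (g k.1.1) k.1.2 -
            descEquiv e he he' (renameZ Empty n r hr 0)))) := by
  refine span_union_congr fun k => ?_
  rw [sub_descEquiv_zero]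
  refine Ideal.span_mono ?_ (hfg k.1.1 ▸ iterSym_sP_desc hS (f k.1.1) k.1.2 k.2)
  rintro _ ⟨l, rfl⟩
  exact ⟨((k.1.1, l.1), l.2), rfl⟩

end Descendants

end ZF

end

/-! ### Assembly of the three statements. -/

theorem proposition2p5 {n : ℕ} {ι : Type u} (𝒯 : BRSTTheory n ι) :
    (∀ f : 𝒯.ParentFun (Fin n),
      𝒯.sTildeP f =
        ∑ μ, cθ n _ μ * (dx _ μ f + 𝒯.dFy μ f) + 𝒯.dF f - 𝒯.sigmaF f + 𝒯.sBar (Fin n) f) ∧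
    (∀ f : 𝒯.ParentFun (Fin n), thetaZero _ (𝒯.sTildeP f) = 𝒯.sP (thetaZero _ f)) ∧
    ∀ {Φ : Type v} {W : Type w} (tp : TrivialPairs 𝒯 Φ W),
      IsGeneralizedAuxiliary 𝒯.pParity 𝒯.sP (Desc.parity n tp.pφ) (Desc.parity n tp.pw)
        tp.phiDesc tp.wDesc tp.vDesc := by
  have hS : ∀ A, IsHomog (A := JF Empty n 𝒯.parity) (𝒯.parity A + 1) (𝒯.S A) := 𝒯.S_parity
  -- The operators in `ZF` agree by definition with those of the statement, so (i) and (ii) need no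
  -- translation.
  refine ⟨fun f => ZF.sTP_eq hS f, fun f => ZF.thetaZero_sTP hS f, fun {Φ W} tp => ?_⟩
  let e : ZF (Fin n) n (splitParity tp.pφ tp.pw) ≃ₐ[ℝ] JF (Fin n) n 𝒯.parity := tp.e
  have he : ZF.IsBaseHom e.toAlgHom := ⟨tp.e_parity, tp.e_x, tp.e_theta⟩
  have he' : ZF.IsBaseHom e.symm.toAlgHom :=
    ⟨fun f => e.injective (by
        refine (e.apply_symm_apply _).trans ?_
        refine Eq.trans ?_ (he.map_σ (e.symm f)).symm
        exact congrArg _ (e.apply_symm_apply f).symm),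
      fun μ => e.symm_apply_eq.2 (he.map_cx μ).symm,
      fun μ => e.symm_apply_eq.2 (he.map_cθ μ).symm⟩
  -- The witness is V = 0: the auxiliary equations amount to v = 0 once w and its derivatives
  -- vanish.
  refine ⟨ZF.descEquiv e he he', ZF.descEquiv_σ e he he', ZF.descEquiv_cx e he he',
    ZF.descEquiv_totD e he he', ZF.descEquiv_phi e he he', ZF.descEquiv_w e he he',
    ZF.descEquiv_v e he he', fun _ => 0, fun a => ?_, ?_⟩
  · exact IsHomog.zero (A := JF Empty n (Desc.parity n tp.pφ)) _
  · exact ZF.span_desc e he he' hS (fun a => e (ZF.cz (Fin n) n _ (.inr (.inl a))))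
      (fun a => e (ZF.cz (Fin n) n _ (.inr (.inr a)))) tp.pair
      (fun i => (Sum.inl i.1, i.2)) (fun _ => rfl)
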